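/- **Conventions.** Let $G$ be a group and $A$ a finite alphabet with an involution $a\mapsto a^{-1}$ and a map $a\mapsto\bar a\in G$ such that $\overline{a^{-1}}=\bar a^{\,-1}$ and the elements $\bar a$ generate $G$ as a monoid. For a word $w\in A^*$ let $\ell(w)$ be its length and $\bar w\in G$ its value; $e$ is the empty word. Let $d$ be the path metric of the Cayley graph of $G$ with respect to $A$ (vertex set $G$, an edge of length one labelled $a$ from $g$ to $g\bar a$), and $\ell(g)=d(1,g)$ for $g\in G$. Let $w(t)$, $t\in[0,\infty)$, be the unit-speed edge path in the Cayley graph that starts at $1$, is labelled by $w$, and is constant for $t\ge\ell(w)$. Let $L\subseteq A^*$. - $L$ is an *asynchronous combing* of $G$ if $\bar L=G$ and there is a constant $K$ such that for all $w,w'\in L$ with $d(\bar w,\overline{w'})\le 1$ there are nondecreasing surjections $\varphi,\psi:[0,\infty)\to[0,\infty)$ with $d\bigl(w(\varphi(t)),w'(\psi(t))\bigr)\le K$ for all $t$. - $D:\mathbb N\to\mathbb N$ is a *departure function* for $L$ if for all $n$ and all $xyz\in L$ with $\ell(y)\ge D(n)$ one has $\ell(\bar y)\ge n$. - $L$ is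 *short* if there are constants $\lambda,\epsilon$ such that $\ell(w)\le\lambda\,\ell(\bar w)+\epsilon$ for all $w\in L$. A language is *context sensitive* if it is generated by a grammar with finitely many productions $\alpha\to\beta$, all with $\alpha\neq e$ and $\ell(\beta)\ge\ell(\alpha)$ (such a language never contains $e$). A *linear bounded automaton* is a nondeterministic one-tape Turing machine that works only on the cells of its input and of two end markers; its language is the set of inputs on which some computation enters an accepting state. **Theorem.** Let $L$ be a short asynchronous combing of $G$ that has a departure function. Let $H$ be a finitely generated subgroup of $G$, let $B$ be a finite alphabet with a map to $H$ whose image generates $H$ as a monoid, and let $W=\{w\in B^*:\bar w=1\}$ be the word problem of $H$. 1. If $L\setminus\{e\}$ is context sensitive (in particular, if $L$ is), then $W\setminus\{e\}$ is context sensitive, and $W$ is the language of a linear bounded automaton. 2. If $L$ is the language of a deterministic linear bounded automaton, then $W$ is decided by a deterministic linear bounded automaton, that is, $W$ is the language of a deterministic linear bounded automaton that halts on every input. -/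

import Mathlib

open scoped NNReal

/-! ### Context-sensitive languages -/

/-- The language with the empty word deleted. -/
def Language.deleteEmpty {T : Type*} (L : Language T) : Language T :=
  {w | w ∈ L ∧ w ≠ []}

/-- A context-sensitive grammar with terminal alphabet `T`, in the length-nondecreasing form of
Hopcroft and Ullman: a production `α → β` has `α` nonempty and `β` at least as long as `α`. -/
structure ContextSensitiveGrammar (T : Type*) where
  /-- nonterminal symbols -/
  NT : Type
  finite_NT : Finite NT
  /-- start symbol -/
  initial : NT
  /-- productions, as pairs (left-hand side, right-hand side) -/
  rules : Set (List (Symbol T NT) × List (Symbol T NT))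
  finite_rules : rules.Finite
  lhs_ne_nil : ∀ r ∈ rules, r.1 ≠ []
  length_le : ∀ r ∈ rules, r.1.length ≤ r.2.length

namespace ContextSensitiveGrammar

variable {T : Type*}

/-- One derivation step: a factor equal to the left-hand side of a production is replaced by the
right-hand side. -/
def Produces (g : ContextSensitiveGrammar T) (u v : List (Symbol T g.NT)) : Prop :=
  ∃ r ∈ g.rules, ∃ p q : List (Symbol T g.NT), u = p ++ r.1 ++ q ∧ v = p ++ r.2 ++ q

/-- The terminal words derivable from the start symbol. -/
def language (g : ContextSensitiveGrammar T) : Language T :=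
  {w | Relation.ReflTransGen g.Produces [Symbol.nonterminal g.initial] (w.map Symbol.terminal)}

end ContextSensitiveGrammar

/-- `L` is generated by a context-sensitive grammar (so `L` does not contain the empty word). -/
def Language.IsContextSensitive {T : Type*} (L : Language T) : Prop :=
  ∃ g : ContextSensitiveGrammar T, g.language = L

/-! ### Linear bounded automata -/

/-- Tape symbols of a linear bounded automaton: the two end markers, the input letters, and the
additional work symbols. -/
inductive TapeSymbol (A : Type*) (W : Type) where
  | leftEnd : TapeSymbol A W
  | rightEnd : TapeSymbol A W
  | input (a : A) : TapeSymbol A W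
  | work (s : W) : TapeSymbol A W

/-- Head movements. -/
inductive HeadMove where
  | left : HeadMove
  | stay : HeadMove
  | right : HeadMove

/-- The new position of the head. -/
def HeadMove.apply : HeadMove → ℕ → ℕ
  | .left, i => i - 1
  | .stay, i => i
  | .right, i => i + 1

/-- A (nondeterministic) linear bounded automaton with input alphabet `A`: a one-tape Turing
machine that works on the cells of its input and of two end markers, never overwrites an end
marker and never moves beyond one. -/
structure LBA (A : Type*) where
  State : Type
  finite_State : Finite State
  /-- tape symbols other than input letters and end markers -/
  Work : Type
  finite_Work : Finite Work
  start : State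
  accepting : Set State
  /-- the possible actions (new state, printed symbol, head movement), given the state and the
  scanned symbol -/
  trans : State → TapeSymbol A Work → Set (State × TapeSymbol A Work × HeadMove)
  trans_leftEnd : ∀ q q' s d, (q', s, d) ∈ trans q .leftEnd → s = .leftEnd ∧ d ≠ .left
  trans_rightEnd : ∀ q q' s d, (q', s, d) ∈ trans q .rightEnd → s = .rightEnd ∧ d ≠ .right

namespace LBA

variable {A : Type*}

/-- A configuration: state, head position and tape content. -/
structure Cfg (M : LBA A) where
  state : M.State
  head : ℕ
  tape : List (TapeSymbol A M.Work)

/-- The initial configuration on input `w`: the tape holds `w` between the two end markers, and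
the left end marker is scanned. -/
def init (M : LBA A) (w : List A) : M.Cfg where
  state := M.start
  head := 0
  tape := .leftEnd :: (w.map .input ++ [.rightEnd])

/-- One step of the machine. The tape has constant length. -/
def Step (M : LBA A) (c c' : M.Cfg) : Prop :=
  ∃ s q' s' d, c.tape[c.head]? = some s ∧ (q', s', d) ∈ M.trans c.state s ∧
    c' = { state := q', head := d.apply c.head, tape := c.tape.set c.head s' }

/-- Some computation leads from `c` to `c'`. -/
def Reaches (M : LBA A) : M.Cfg → M.Cfg → Prop :=
  Relation.ReflTransGen M.Step

/-- The language of the machine: the inputs on which some computation enters an accepting state. -/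
def language (M : LBA A) : Language A :=
  {w | ∃ c, M.Reaches (M.init w) c ∧ c.state ∈ M.accepting}

/-- There is at most one possible action in every situation. -/
def Deterministic (M : LBA A) : Prop :=
  ∀ q s, (M.trans q s).Subsingleton

/-- On every input, a configuration without successor is reached. For a deterministic machine
this says that the computation on every input stops. -/
def Halts (M : LBA A) : Prop :=
  ∀ w, ∃ c, M.Reaches (M.init w) c ∧ ∀ c', ¬ M.Step c c'

end LBA

/-- `L` is the language of a nondeterministic linear bounded automaton. -/
def Language.IsLBALanguage {A : Type*} (L : Language A) : Prop :=
  ∃ M : LBA A, M.language = L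

/-- `L` is the language of a deterministic linear bounded automaton. -/
def Language.IsDeterministicLBALanguage {A : Type*} (L : Language A) : Prop :=
  ∃ M : LBA A, M.Deterministic ∧ M.language = L

/-- `L` is decided by a deterministic linear bounded automaton: the automaton stops on every
input, and `L` is its language. -/
def Language.IsDecidedByDeterministicLBA {A : Type*} (L : Language A) : Prop :=
  ∃ M : LBA A, M.Deterministic ∧ M.Halts ∧ M.language = L

/-! ### Words in the generators of a group, and the Cayley graph -/

section Cayley

variable {G : Type*} [Group G] {A : Type*}

/-- The element of `G` represented by a word, where `val a` is the value of the letter `a`. -/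
def evalWord (val : A → G) (w : List A) : G := (w.map val).prod

/-- The word problem: the words that represent the identity. -/
def wordProblem (val : A → G) : Language A := {w | evalWord val w = 1}

/-- The length of a group element: the least length of a word that represents it. -/
noncomputable def wordLength (val : A → G) (g : G) : ℕ :=
  sInf {n | ∃ w : List A, evalWord val w = g ∧ w.length = n}

/-- The word metric on the group. -/
noncomputable def wordDist (val : A → G) (g h : G) : ℕ := wordLength val (g⁻¹ * h)

/-- Points of the Cayley graph: a vertex, or the point at distance `s` from `g` on the edge from
`g` to `g * val a` labelled `a` (where `0 ≤ s ≤ 1`). -/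
inductive CayleyPoint (G : Type*) (A : Type*) where
  | vertex (g : G) : CayleyPoint G A
  | edge (g : G) (a : A) (s : ℝ) : CayleyPoint G A

/-- The vertices adjacent to a point, each with the length of the edge segment that leads to it. -/
def CayleyPoint.ends (val : A → G) : CayleyPoint G A → Set (G × ℝ)
  | .vertex g => {(g, 0)}
  | .edge g a s => {(g, s), (g * val a, 1 - s)}

/-- The path metric of the Cayley graph, in which every edge has length one: a shortest path
between two points runs through vertices, or else it is a segment of a single edge. -/
noncomputable def cayleyDist (val : A → G) (p q : CayleyPoint G A) : ℝ :=
  sInf ({r | ∃ x ∈ p.ends val, ∃ y ∈ q.ends val, r = x.2 + wordDist val x.1 y.1 + y.2} ∪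
    {r | ∃ g a s t, p = .edge g a s ∧ q = .edge g a t ∧ r = |s - t|})

/-- The path `t ↦ w(t)`, `0 ≤ t < ∞`, in the Cayley graph: it starts at `1`, runs at unit speed
along the edges labelled by the letters of `w`, and is constant after time `w.length`. -/
noncomputable def wordPath (val : A → G) (w : List A) (t : ℝ≥0) : CayleyPoint G A :=
  match w[⌊t⌋₊]? with
  | some a => .edge (evalWord val (w.take ⌊t⌋₊)) a ((t : ℝ) - ⌊t⌋₊)
  | none => .vertex (evalWord val w)

/-- A monotone reparameterization of `[0, ∞)`: a nondecreasing map of `[0, ∞)` onto itself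
(it is automatically continuous and fixes `0`). -/
def IsReparameterization (φ : ℝ≥0 → ℝ≥0) : Prop := Monotone φ ∧ Function.Surjective φ

/-- Every group element is represented by a word of `L`. -/
def IsNormalForm (val : A → G) (L : Language A) : Prop := ∀ g, ∃ w ∈ L, evalWord val w = g

/-- `L` is an asynchronous combing: a normal form in which any two words that end at distance at
most one are, after suitable reparameterizations, uniformly close. -/
def IsAsynchronousCombing (val : A → G) (L : Language A) : Prop :=
  IsNormalForm val L ∧ ∃ K : ℝ, ∀ w ∈ L, ∀ w' ∈ L,
    wordDist val (evalWord val w) (evalWord val w') ≤ 1 →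
      ∃ φ ψ : ℝ≥0 → ℝ≥0, IsReparameterization φ ∧ IsReparameterization ψ ∧
        ∀ t, cayleyDist val (wordPath val w (φ t)) (wordPath val w' (ψ t)) ≤ K

/-- `D` is a departure function for `L`. -/
def IsDepartureFunction (val : A → G) (L : Language A) (D : ℕ → ℕ) : Prop :=
  ∀ (n : ℕ) (x y z : List A), x ++ y ++ z ∈ L → D n ≤ y.length →
    n ≤ wordLength val (evalWord val y)

/-- `L` is short: the length of its words is at most an affine function of the length of the
element represented. -/
def IsShort (val : A → G) (L : Language A) : Prop :=
  ∃ lam eps : ℝ, ∀ w ∈ L, (w.length : ℝ) ≤ lam * wordLength val (evalWord val w) + eps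

end Cayley

/-! ### Sweep machines -/

/-! Read the given word letter by letter, each letter of `B` spelled out over `A`, and keep on the
tape a word `u ∈ L` for the prefix read so far. When the next letter is `a`, look for `u' ∈ L` with
value `ū ā`. The combing property allows `u` and `u'` to be merged into a single sequence of
letters, each tagged with the word it comes from, such that after every initial segment the element
leading from the end of the part of `u` to the end of the part of `u'` lies in one fixed finite set
`S` (`exists_merge_of_reparameterization`). A finite automaton with states in `S` can therefore
check a proposed merged pair (`foldl_mergeStep`), while `u' ∈ L` is left to a machine for `L`.
Soundness needs no geometry: a final difference `ā` proves that `u'` represents `ū ā`. At the end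
the current word is compared in the same way with a fixed word `u₀ ∈ L` of value 1.

Shortness keeps everything in linear space: a prefix of length at most `m * n` has a normal form of
length at most `C * n`, so two normal forms and their merged pair fit into a constant number of
cells per input letter (`exists_wordProgram`, `exists_subgroupProgram`). Such blocks of cells are
finally packed into single cells.

The next normal form is guessed if nondeterminism is allowed, and otherwise found by running a
counter through all contents of a track (`Testable.search`). Membership in `L` is tested in two
ways. For a grammar, productions are applied backwards; they never lengthen the word, and blanks
fill the gap. A deterministic automaton is simulated against a clock: configurations represented on
a tape of fixed length are finite in number, so an accepting state that is reached at all is reached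
before the clock overflows.

Machines are handled through their input-output relations, `TapeProgram`, which are closed under
sequencing, loops and restriction to a track. The proposition `d` in `Implementable d` records
whether the machine is required to be deterministic, so both parts of the theorem come from one
program. The underlying model only sweeps back and forth, which makes it easy to turn into an
automaton (`language_toLBA`) and into a grammar (`mem_language_toGrammar`,
`exec_of_mem_language_toGrammar`). -/

/-- A left-to-right pass of a nondeterministic letter-to-letter transducer. -/
inductive Sweep {σ Γ : Type*} (act : σ → Γ → Set (σ × Γ)) : σ → List Γ → σ → List Γ → Prop
  | nil (q) : Sweep act q [] q []
  | cons {q x q' y l q'' l'} : (q', y) ∈ act q x → Sweep act q' l q'' l' →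
      Sweep act q (x :: l) q'' (y :: l')

namespace Sweep

variable {σ τ Γ Γ' : Type*} {act : σ → Γ → Set (σ × Γ)}

@[simp] theorem nil_iff {q q' : σ} {l : List Γ} :
    Sweep act q [] q' l ↔ q = q' ∧ l = [] := by
  constructor
  · intro h; cases h; simp
  · rintro ⟨rfl, rfl⟩; exact .nil _

@[simp] theorem cons_iff {q q'' : σ} {x : Γ} {l m : List Γ} :
    Sweep act q (x :: l) q'' m ↔
      ∃ q' y l', (q', y) ∈ act q x ∧ Sweep act q' l q'' l' ∧ m = y :: l' := by
  constructor
  · intro h; cases h with | cons h1 h2 => exact ⟨_, _, _, h1, h2, rfl⟩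
  · rintro ⟨q', y, l', h1, h2, rfl⟩; exact .cons h1 h2

theorem length_eq {q q' : σ} {l l' : List Γ} (h : Sweep act q l q' l') :
    l'.length = l.length := by
  induction h with
  | nil => rfl
  | cons _ _ ih => simp [ih]

theorem append_iff {q q'' : σ} {l₁ l₂ m : List Γ} :
    Sweep act q (l₁ ++ l₂) q'' m ↔
      ∃ q' m₁ m₂, Sweep act q l₁ q' m₁ ∧ Sweep act q' l₂ q'' m₂ ∧ m = m₁ ++ m₂ := by
  induction l₁ generalizing q m with
  | nil => simp
  | cons x l ih =>
    simp only [List.cons_append, cons_iff, ih]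
    constructor
    · rintro ⟨q', y, l', h1, ⟨q2, m1, m2, h2, h3, rfl⟩, rfl⟩
      exact ⟨q2, y :: m1, m2, ⟨q', y, m1, h1, h2, rfl⟩, h3, rfl⟩
    · rintro ⟨q2, _, m2, ⟨q', y, m1, h1, h2, rfl⟩, h3, rfl⟩
      exact ⟨q', y, m1 ++ m2, h1, ⟨q2, m1, m2, h2, h3, rfl⟩, rfl⟩

/-- The hypothesis is an equality of sets, so a pass that starts in the range of `f` never leaves
it. This embeds a machine into a larger one or renumbers its states; injectivity of `f` is not
needed. -/
theorem map_state_iff {act' : τ → Γ → Set (τ × Γ)} (f : σ → τ)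
    (hf : ∀ q x, act' (f q) x = (fun p => (f p.1, p.2)) '' act q x) {q : σ} {t : τ}
    {l l' : List Γ} :
    Sweep act' (f q) l t l' ↔ ∃ q', t = f q' ∧ Sweep act q l q' l' := by
  induction l generalizing q l' with
  | nil =>
    simp only [nil_iff]
    exact ⟨fun ⟨h, h'⟩ => ⟨q, h.symm, rfl, h'⟩, fun ⟨q', h, h', h''⟩ => ⟨by rw [h, h'], h''⟩⟩
  | cons x l ih =>
    simp only [cons_iff, hf]
    constructor
    · rintro ⟨_, y, m, ⟨⟨q', _⟩, h1, h2⟩, h3, rfl⟩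
      obtain ⟨rfl, rfl⟩ := Prod.mk.inj h2
      obtain ⟨q'', rfl, h4⟩ := ih.1 h3
      exact ⟨q'', rfl, q', _, m, h1, h4, rfl⟩
    · rintro ⟨q'', rfl, q', y, m, h1, h4, rfl⟩
      exact ⟨f q', y, m, ⟨(q', y), h1, rfl⟩, ih.2 ⟨q'', rfl, h4⟩, rfl⟩

theorem map_fst_zipWith {Δ : Type*} (e : Γ' ≃ Γ × Δ) {l₁ : List Γ} {l₂ : List Δ}
    (h : l₁.length = l₂.length) :
    ((List.zipWith (fun a b => e.symm (a, b)) l₁ l₂).map fun x => (e x).1) = l₁ := by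
  induction l₁ generalizing l₂ with
  | nil => simp
  | cons x l ih => cases l₂ <;> simp_all

theorem map_snd_zipWith {Δ : Type*} (e : Γ' ≃ Γ × Δ) {l₁ : List Γ} {l₂ : List Δ}
    (h : l₁.length = l₂.length) :
    ((List.zipWith (fun a b => e.symm (a, b)) l₁ l₂).map fun x => (e x).2) = l₂ := by
  induction l₁ generalizing l₂ with
  | nil => simp_all [eq_comm]
  | cons x l ih => cases l₂ <;> simp_all

theorem onTrack_iff {Δ : Type*} (e : Γ' ≃ Γ × Δ) {q q' : σ} {l l' : List Γ'} :
    Sweep (fun q x => (fun p => (p.1, e.symm (p.2, (e x).2))) '' act q (e x).1) q l q' l' ↔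
      Sweep act q (l.map fun x => (e x).1) q' (l'.map fun x => (e x).1) ∧
      (l'.map fun x => (e x).2) = l.map fun x => (e x).2 := by
  induction l generalizing q l' with
  | nil => simp +contextual
  | cons x l ih =>
    simp only [Sweep.cons_iff, List.map_cons, ih]
    constructor
    · rintro ⟨q₁, _, l₁, ⟨⟨_, y⟩, h1, h2⟩, ⟨h3, h4⟩, rfl⟩
      obtain ⟨rfl, rfl⟩ := Prod.mk.inj h2
      exact ⟨⟨_, y, _, h1, h3, by simp⟩, by simp [h4]⟩
    · rintro ⟨⟨q₁, y, l₁, h1, h3, h5⟩, h4⟩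
      obtain ⟨y', l', rfl, rfl, rfl⟩ := List.map_eq_cons_iff.1 h5
      simp only [List.map_cons, List.cons.injEq] at h4
      refine ⟨q₁, y', l', ⟨(q₁, (e y').1), h1, ?_⟩, ⟨h3, h4.2⟩, rfl⟩
      rw [← h4.1]; simp

theorem functional (hd : ∀ q x, (act q x).Subsingleton) {q q₁ q₂ : σ} {l l₁ l₂ : List Γ}
    (h₁ : Sweep act q l q₁ l₁) (h₂ : Sweep act q l q₂ l₂) : q₁ = q₂ ∧ l₁ = l₂ := by
  induction h₁ generalizing l₂ with
  | nil => simp at h₂; exact ⟨h₂.1, h₂.2.symm⟩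
  | cons h _ ih =>
    obtain ⟨q', y, l', h3, h4, rfl⟩ := cons_iff.1 h₂
    obtain ⟨rfl, rfl⟩ := Prod.mk.inj (hd _ _ h h3)
    obtain ⟨rfl, rfl⟩ := ih h4
    exact ⟨rfl, rfl⟩

end Sweep

/-- The input-output relation of a program that works on a tape with cells in `Γ` and returns a
value in `ρ`. -/
abbrev TapeProgram (Γ ρ : Type*) := List Γ → ρ → List Γ → Prop

/-- A pass from left to right followed by a pass from right to left. -/
def RoundTrip {σ Γ : Type*} (act back : σ → Γ → Set (σ × Γ)) (q : σ) (l : List Γ) (q' : σ)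
    (l' : List Γ) : Prop :=
  ∃ q₁ l₁, Sweep act q l q₁ l₁ ∧ Sweep back q₁ l₁.reverse q' l'.reverse

namespace RoundTrip

variable {σ τ Γ : Type*} {act back : σ → Γ → Set (σ × Γ)}

theorem length_eq {q q' : σ} {l l' : List Γ} (h : RoundTrip act back q l q' l') :
    l'.length = l.length := by
  obtain ⟨_, _, h1, h2⟩ := h
  have := h2.length_eq
  simp only [List.length_reverse] at this
  rw [this, h1.length_eq]

theorem map_state_iff {act' back' : τ → Γ → Set (τ × Γ)} (f : σ → τ)
    (hf : ∀ q x, act' (f q) x = (fun p => (f p.1, p.2)) '' act q x)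
    (hf' : ∀ q x, back' (f q) x = (fun p => (f p.1, p.2)) '' back q x) {q : σ} {t : τ}
    {l l' : List Γ} :
    RoundTrip act' back' (f q) l t l' ↔ ∃ q', t = f q' ∧ RoundTrip act back q l q' l' := by
  constructor
  · rintro ⟨_, l₁, h1, h2⟩
    obtain ⟨q₁, rfl, h3⟩ := (Sweep.map_state_iff f hf).1 h1
    obtain ⟨q', rfl, h4⟩ := (Sweep.map_state_iff f hf').1 h2
    exact ⟨q', rfl, q₁, l₁, h3, h4⟩
  · rintro ⟨q', rfl, q₁, l₁, h3, h4⟩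
    exact ⟨f q₁, l₁, (Sweep.map_state_iff f hf).2 ⟨_, rfl, h3⟩,
      (Sweep.map_state_iff f hf').2 ⟨_, rfl, h4⟩⟩

theorem functional (hd : ∀ q x, (act q x).Subsingleton) (hd' : ∀ q x, (back q x).Subsingleton)
    {q q₁ q₂ : σ} {l l₁ l₂ : List Γ} (h₁ : RoundTrip act back q l q₁ l₁)
    (h₂ : RoundTrip act back q l q₂ l₂) : q₁ = q₂ ∧ l₁ = l₂ := by
  obtain ⟨_, _, h1, h2⟩ := h₁
  obtain ⟨_, _, h3, h4⟩ := h₂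
  obtain ⟨rfl, rfl⟩ := h1.functional hd h3
  obtain ⟨rfl, h⟩ := h2.functional hd' h4
  exact ⟨rfl, List.reverse_injective h⟩

end RoundTrip

/-- A machine that moves back and forth over the tape. After every round trip it starts another
one or returns a value. -/
structure SweepMachine (Γ ρ : Type*) where
  State : Type
  finite_State : Finite State
  start : State
  act : State → Γ → Set (State × Γ)
  back : State → Γ → Set (State × Γ)
  next : State → State ⊕ ρ

namespace SweepMachine

variable {Γ ρ : Type*} (m : SweepMachine Γ ρ)

/-- The computations of a sweep machine. -/
inductive Exec : m.State → List Γ → ρ → List Γ → Prop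
  | exit {q l q' l' r} : RoundTrip m.act m.back q l q' l' → m.next q' = .inr r → Exec q l r l'
  | step {q l q' l' q'' r l''} : RoundTrip m.act m.back q l q' l' → m.next q' = .inl q'' →
      Exec q'' l' r l'' → Exec q l r l''

/-- There is at most one action in every situation. -/
def Deterministic : Prop :=
  (∀ q x, (m.act q x).Subsingleton) ∧ ∀ q x, (m.back q x).Subsingleton

variable {m} in
theorem Exec.functional (hm : m.Deterministic) {q : m.State} {l l₁ l₂ : List Γ} {r₁ r₂ : ρ}
    (h₁ : m.Exec q l r₁ l₁) (h₂ : m.Exec q l r₂ l₂) : r₁ = r₂ ∧ l₁ = l₂ := by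
  induction h₁ with
  | exit hs hn =>
    cases h₂ with
    | exit hs' hn' =>
      obtain ⟨rfl, rfl⟩ := hs.functional hm.1 hm.2 hs'
      rw [hn] at hn'
      exact ⟨Sum.inr.inj hn', rfl⟩
    | step hs' hn' _ =>
      obtain ⟨rfl, rfl⟩ := hs.functional hm.1 hm.2 hs'
      simp [hn] at hn'
  | step hs hn _ ih =>
    cases h₂ with
    | exit hs' hn' =>
      obtain ⟨rfl, rfl⟩ := hs.functional hm.1 hm.2 hs'
      simp [hn] at hn'
    | step hs' hn' h' =>
      obtain ⟨rfl, rfl⟩ := hs.functional hm.1 hm.2 hs'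
      rw [hn] at hn'
      obtain rfl := Sum.inl.inj hn'
      exact ih h'

end SweepMachine

/-! ### Tape programs and their composition -/

namespace TapeProgram

variable {Γ ρ : Type*}

/-- The program is carried out by a sweep machine, by a deterministic one if `d` holds. -/
def Implementable (d : Prop) (R : TapeProgram Γ ρ) : Prop :=
  ∃ m : SweepMachine Γ ρ, (d → m.Deterministic) ∧ ∀ l r l', m.Exec m.start l r l' ↔ R l r l'

/-- Run `R`, then the program that depends on the value returned. -/
def bind {τ : Type*} (R : TapeProgram Γ ρ) (S : ρ → TapeProgram Γ τ) : TapeProgram Γ τ :=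
  fun l t l'' => ∃ r l', R l r l' ∧ S r l' t l''

/-- Repeat `R` until it returns a value. -/
inductive loop (R : TapeProgram Γ (Option ρ)) : TapeProgram Γ ρ
  | exit {l r l'} : R l (some r) l' → loop R l r l'
  | again {l l' r l''} : R l none l' → loop R l' r l'' → loop R l r l''

/-- Run `R` on the first of two tracks. -/
def onTrack {Γ' Δ : Type*} (e : Γ' ≃ Γ × Δ) (R : TapeProgram Γ ρ) : TapeProgram Γ' ρ :=
  fun l r l' => R (l.map fun x => (e x).1) r (l'.map fun x => (e x).1) ∧
    (l'.map fun x => (e x).2) = l.map fun x => (e x).2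

variable {d : Prop}

/-- A deterministic machine has at most one result. This is how determinism is used in arguments
about relations, for instance to exclude that a test which has failed could also have succeeded. -/
theorem Implementable.functional {R : TapeProgram Γ ρ} (h : Implementable d R) (hd : d)
    {l l₁ l₂ : List Γ} {r₁ r₂ : ρ} (h₁ : R l r₁ l₁) (h₂ : R l r₂ l₂) : r₁ = r₂ ∧ l₁ = l₂ := by
  obtain ⟨m, hm, hR⟩ := h
  exact ((hR _ _ _).2 h₁).functional (hm hd) ((hR _ _ _).2 h₂)

theorem implementable_roundTrip {σ : Type*} [Finite σ] (act back : σ → Γ → Set (σ × Γ)) (q : σ)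
    (hd : d → ∀ q x, (act q x).Subsingleton) (hd' : d → ∀ q x, (back q x).Subsingleton) :
    Implementable d (RoundTrip act back q) := by
  -- States of a sweep machine must live in `Type`, while `σ` lies in any universe, so the states
  -- are numbered.
  obtain ⟨n, ⟨e⟩⟩ := Finite.exists_equiv_fin σ
  let m : SweepMachine Γ σ :=
    { State := Fin n
      finite_State := inferInstance
      start := e q
      act := fun i x => (fun p => (e p.1, p.2)) '' act (e.symm i) x
      back := fun i x => (fun p => (e p.1, p.2)) '' back (e.symm i) x
      next := fun i => .inr (e.symm i) }
  have hs : ∀ {q i l l'}, RoundTrip m.act m.back (e q) l i l' ↔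
      ∃ q', i = e q' ∧ RoundTrip act back q l q' l' :=
    RoundTrip.map_state_iff e (fun q x => by simp [m]) (fun q x => by simp [m])
  refine ⟨m, fun h => ⟨fun i x => (hd h _ _).image _, fun i x => (hd' h _ _).image _⟩,
    fun l r l' => ⟨fun h => ?_, fun h => ?_⟩⟩
  · cases h with
    | exit h1 h2 =>
      obtain ⟨q', rfl, h3⟩ := hs.1 h1
      simp only [m, Equiv.symm_apply_apply, Sum.inr.injEq] at h2
      subst h2
      exact h3
    | step h1 h2 => simp [m] at h2
  · exact .exit (hs.2 ⟨r, rfl, h⟩) (by simp [m])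

/-- The composite machine is the disjoint sum of the first machine and one copy of the second for
each possible value `r`; returning `r` becomes a jump to the start of copy `r`. -/
theorem Implementable.bind {τ : Type*} [Finite ρ] {R : TapeProgram Γ ρ}
    {S : ρ → TapeProgram Γ τ} (hR : Implementable d R) (hS : ∀ r, Implementable d (S r)) :
    Implementable d (R.bind S) := by
  obtain ⟨m, hm, hR⟩ := hR
  choose k hk hS using hS
  -- The copies are indexed by `Fin n` instead of `ρ`, again to stay in `Type`.
  obtain ⟨n, ⟨e⟩⟩ := Finite.exists_equiv_fin ρ
  have := m.finite_State
  have := fun r => (k r).finite_State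
  let M : SweepMachine Γ τ :=
    { State := m.State ⊕ Σ i : Fin n, (k (e.symm i)).State
      finite_State := inferInstance
      start := .inl m.start
      act := fun q x => match q with
        | .inl q => (fun p => (Sum.inl p.1, p.2)) '' m.act q x
        | .inr ⟨i, q⟩ => (fun p => (Sum.inr ⟨i, p.1⟩, p.2)) '' (k (e.symm i)).act q x
      back := fun q x => match q with
        | .inl q => (fun p => (Sum.inl p.1, p.2)) '' m.back q x
        | .inr ⟨i, q⟩ => (fun p => (Sum.inr ⟨i, p.1⟩, p.2)) '' (k (e.symm i)).back q x
      next := fun q => match q with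
        | .inl q => match m.next q with
          | .inl q' => .inl (.inl q')
          | .inr r => .inl (.inr ⟨e r, (k (e.symm (e r))).start⟩)
        | .inr ⟨i, q⟩ => match (k (e.symm i)).next q with
          | .inl q' => .inl (.inr ⟨i, q'⟩)
          | .inr r => .inr r }
  have hl : ∀ {q i l l'}, RoundTrip M.act M.back (.inl q) l i l' ↔
      ∃ q', i = .inl q' ∧ RoundTrip m.act m.back q l q' l' :=
    RoundTrip.map_state_iff (σ := m.State) Sum.inl (fun q x => rfl) (fun q x => rfl)
  have hr : ∀ {j q i l l'}, RoundTrip M.act M.back (.inr ⟨j, q⟩) l i l' ↔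
      ∃ q', i = .inr ⟨j, q'⟩ ∧ RoundTrip (k (e.symm j)).act (k (e.symm j)).back q l q' l' :=
    fun {j q i l l'} => RoundTrip.map_state_iff (τ := M.State) (σ := (k (e.symm j)).State)
      (fun q => (Sum.inr ⟨j, q⟩ : M.State)) (fun q x => rfl) (fun q x => rfl)
  have hr' : ∀ {j q l t l'}, M.Exec (.inr ⟨j, q⟩) l t l' ↔ (k (e.symm j)).Exec q l t l' := by
    intro j q l t l'
    constructor
    · suffices H : ∀ {p : M.State} {l t l'}, M.Exec p l t l' → ∀ q, .inr ⟨j, q⟩ = p →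
          (k (e.symm j)).Exec q l t l' from fun h => H h q rfl
      intro p l t l' h
      induction h with
      | exit h1 h2 =>
        rintro q rfl
        obtain ⟨q', rfl, h3⟩ := hr.1 h1
        refine .exit h3 ?_
        simp only [M] at h2
        split at h2 <;> simp_all
      | step h1 h2 _ ih =>
        rintro q rfl
        obtain ⟨q', rfl, h3⟩ := hr.1 h1
        simp only [M] at h2
        split at h2
        · next q2 h4 =>
          obtain rfl := Sum.inl.inj h2
          exact .step h3 h4 (ih _ rfl)
        · simp at h2
    · intro h
      induction h with
      | exit h1 h2 => exact .exit (hr.2 ⟨_, rfl, h1⟩) (by simp [M, h2])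
      | step h1 h2 _ ih => exact .step (hr.2 ⟨_, rfl, h1⟩) (by simp [M, h2]) ih
  have hl' : ∀ {q l t l'}, M.Exec (.inl q) l t l' ↔
      ∃ r l₁, m.Exec q l r l₁ ∧ (k r).Exec (k r).start l₁ t l' := by
    intro q l t l'
    constructor
    · suffices H : ∀ {p : M.State} {l t l'}, M.Exec p l t l' → ∀ q, .inl q = p →
          ∃ r l₁, m.Exec q l r l₁ ∧ (k r).Exec (k r).start l₁ t l' from fun h => H h q rfl
      intro p l t l' h
      induction h with
      | exit h1 h2 =>
        rintro q rfl
        obtain ⟨q', rfl, h3⟩ := hl.1 h1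
        simp only [M] at h2
        split at h2 <;> simp at h2
      | step h1 h2 h5 ih =>
        rintro q rfl
        obtain ⟨q', rfl, h3⟩ := hl.1 h1
        simp only [M] at h2
        split at h2
        · next q2 h4 =>
          obtain rfl := Sum.inl.inj h2
          obtain ⟨r, l₁, h6, h7⟩ := ih _ rfl
          exact ⟨r, l₁, .step h3 h4 h6, h7⟩
        · next r h4 =>
          obtain rfl := Sum.inl.inj h2
          refine ⟨r, _, .exit h3 h4, ?_⟩
          have := hr'.1 h5
          rwa [e.symm_apply_apply] at this
    · rintro ⟨r, l₁, h, h'⟩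
      induction h with
      | @exit q l q' l' r h1 h2 =>
        refine .step (q'' := (.inr ⟨e r, (k (e.symm (e r))).start⟩ : M.State)) (hl.2 ⟨_, rfl, h1⟩)
          (by simp [M, h2]) (hr'.2 ?_)
        rwa [e.symm_apply_apply]
      | step h1 h2 _ ih => exact .step (hl.2 ⟨_, rfl, h1⟩) (by simp [M, h2]) (ih h')
  refine ⟨M, fun h => ⟨fun q x => ?_, fun q x => ?_⟩, fun l r l' => ?_⟩
  · rcases q with q | ⟨j, q⟩
    · exact ((hm h).1 _ _).image _
    · exact ((hk _ h).1 _ _).image _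
  · rcases q with q | ⟨j, q⟩
    · exact ((hm h).2 _ _).image _
    · exact ((hk _ h).2 _ _).image _
  · simp only [TapeProgram.bind, ← hR, ← hS]
    exact hl'

/-- The same machine serves, with the return of `none` redirected to the start state. -/
theorem Implementable.loop {R : TapeProgram Γ (Option ρ)} (hR : Implementable d R) :
    Implementable d R.loop := by
  obtain ⟨m, hm, hR⟩ := hR
  let M : SweepMachine Γ ρ :=
    { State := m.State
      finite_State := m.finite_State
      start := m.start
      act := m.act
      back := m.back
      next := fun q => match m.next q with
        | .inl q' => .inl q'
        | .inr none => .inl m.start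
        | .inr (some r) => .inr r }
  -- Stated for every state, not only the start: the current run of `m` either ends the loop or
  -- returns `none`, after which a fresh loop begins.
  have key : ∀ {q l r l'}, M.Exec q l r l' ↔ m.Exec q l (some r) l' ∨
      ∃ l₁, m.Exec q l none l₁ ∧ R.loop l₁ r l' := by
    intro q l r l'
    constructor
    · intro h
      induction h with
      | exit h1 h2 =>
        refine .inl (.exit h1 ?_)
        simp only [M] at h2
        split at h2 <;> simp_all
      | step h1 h2 h5 ih =>
        simp only [M] at h2
        split at h2
        · next q2 h4 =>
          obtain rfl := Sum.inl.inj h2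
          rcases ih with ih | ⟨l₁, h6, h7⟩
          · exact .inl (.step h1 h4 ih)
          · exact .inr ⟨l₁, .step h1 h4 h6, h7⟩
        · next h4 =>
          obtain rfl := Sum.inl.inj h2
          refine .inr ⟨_, .exit h1 h4, ?_⟩
          rcases ih with ih | ⟨l₁, h6, h7⟩
          · exact .exit ((hR _ _ _).1 ih)
          · exact .again ((hR _ _ _).1 h6) h7
        · simp at h2
    · have aux : ∀ {q l r l₁}, m.Exec q l r l₁ → (∀ t, r = some t → M.Exec q l t l₁) ∧
          (r = none → ∀ t l', M.Exec M.start l₁ t l' → M.Exec q l t l') := by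
        intro q l r l₁ h
        induction h with
        | exit h1 h2 =>
          refine ⟨fun t ht => .exit h1 (by simp [M, h2, ht]), fun ht t l' h => ?_⟩
          exact .step (q'' := M.start) h1 (by simp [M, h2, ht]) h
        | step h1 h2 _ ih =>
          exact ⟨fun t ht => .step h1 (by simp [M, h2]) (ih.1 t ht),
            fun ht t l' h => .step h1 (by simp [M, h2]) (ih.2 ht t l' h)⟩
      have hloop : ∀ {l r l'}, R.loop l r l' → M.Exec m.start l r l' := by
        intro l r l' h
        induction h with
        | exit h => exact (aux ((hR _ _ _).2 h)).1 _ rfl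
        | again h _ ih => exact (aux ((hR _ _ _).2 h)).2 rfl _ _ ih
      rintro (h | ⟨l₁, h, h'⟩)
      · exact (aux h).1 _ rfl
      · exact (aux h).2 rfl _ _ (hloop h')
  refine ⟨M, hm, fun l r l' => key.trans ⟨?_, ?_⟩⟩
  · rintro (h | ⟨l₁, h, h'⟩)
    · exact .exit ((hR _ _ _).1 h)
    · exact .again ((hR _ _ _).1 h) h'
  · rintro (h | ⟨h, h'⟩)
    · exact .inl ((hR _ _ _).2 h)
    · exact .inr ⟨_, (hR _ _ _).2 h, h'⟩

theorem Implementable.onTrack {Γ' Δ : Type*} (e : Γ' ≃ Γ × Δ) {R : TapeProgram Γ ρ}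
    (hR : Implementable d R) : Implementable d (R.onTrack e) := by
  obtain ⟨m, hm, hR⟩ := hR
  let M : SweepMachine Γ' ρ :=
    { State := m.State
      finite_State := m.finite_State
      start := m.start
      act := fun q x => (fun p => (p.1, e.symm (p.2, (e x).2))) '' m.act q (e x).1
      back := fun q x => (fun p => (p.1, e.symm (p.2, (e x).2))) '' m.back q (e x).1
      next := m.next }
  have hs : ∀ {q q' l l'}, RoundTrip M.act M.back q l q' l' ↔
      RoundTrip m.act m.back q (l.map fun x => (e x).1) q' (l'.map fun x => (e x).1) ∧
      (l'.map fun x => (e x).2) = l.map fun x => (e x).2 := by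
    intro q q' l l'
    constructor
    · rintro ⟨q₁, l₁, h1, h2⟩
      obtain ⟨h3, h4⟩ := (Sweep.onTrack_iff e).1 h1
      obtain ⟨h5, h6⟩ := (Sweep.onTrack_iff e).1 h2
      simp only [List.map_reverse, List.reverse_inj] at h5 h6
      exact ⟨⟨q₁, _, h3, h5⟩, h6.trans h4⟩
    · rintro ⟨⟨q₁, l₁, h1, h2⟩, h3⟩
      -- Between the two passes only the first track is prescribed; pairing it with the unchanged
      -- second track gives the intermediate tape.
      have hlen : l₁.length = (l.map fun x => (e x).2).length := by
        rw [h1.length_eq]; simp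
      have e1 : ((List.zipWith (fun a b => e.symm (a, b)) l₁
          (l.map fun x => (e x).2)).map fun x => (e x).1) = l₁ :=
        Sweep.map_fst_zipWith e hlen
      have e2 : ((List.zipWith (fun a b => e.symm (a, b)) l₁
          (l.map fun x => (e x).2)).map fun x => (e x).2) = l.map fun x => (e x).2 :=
        Sweep.map_snd_zipWith e hlen
      refine ⟨q₁, List.zipWith (fun a b => e.symm (a, b)) l₁ (l.map fun x => (e x).2),
        (Sweep.onTrack_iff e).2 ?_, (Sweep.onTrack_iff e).2 ?_⟩
      · rw [e1, e2]; exact ⟨h1, rfl⟩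
      · simp only [List.map_reverse, List.reverse_inj, e1, e2]
        exact ⟨h2, h3⟩
  refine ⟨M, fun h => ⟨fun q x => ((hm h).1 _ _).image _, fun q x => ((hm h).2 _ _).image _⟩,
    fun l r l' => ?_⟩
  simp only [TapeProgram.onTrack, ← hR]
  change M.Exec M.start _ _ _ ↔ m.Exec M.start _ _ _ ∧ _
  generalize M.start = q
  constructor
  · intro h
    induction h with
    | exit h1 h2 => exact ⟨.exit (hs.1 h1).1 h2, (hs.1 h1).2⟩
    | step h1 h2 _ ih => exact ⟨.step (hs.1 h1).1 h2 ih.1, ih.2.trans (hs.1 h1).2⟩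
  · rintro ⟨h, h'⟩
    generalize hx : (l.map fun x => (e x).1) = x at h
    generalize hy : (l'.map fun x => (e x).1) = y at h
    induction h generalizing l with
    | exit h1 h2 =>
      subst hx hy
      exact .exit (hs.2 ⟨h1, h'⟩) h2
    | @step q x q' x₁ q'' r y h1 h2 _ ih =>
      subst hx hy
      have hlen : x₁.length = (l.map fun x => (e x).2).length := by
        rw [h1.length_eq]; simp
      have e1 : ((List.zipWith (fun a b => e.symm (a, b)) x₁
          (l.map fun x => (e x).2)).map fun x => (e x).1) = x₁ :=
        Sweep.map_fst_zipWith e hlen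
      have e2 : ((List.zipWith (fun a b => e.symm (a, b)) x₁
          (l.map fun x => (e x).2)).map fun x => (e x).2) = l.map fun x => (e x).2 :=
        Sweep.map_snd_zipWith e hlen
      exact .step (hs.2 ⟨by rw [e1]; exact h1, e2⟩) h2 (ih _ (by rw [e2, h']) e1 rfl)

end TapeProgram

/-! ### Packing blocks of cells into one cell -/

/-- Lists of a given length. -/
abbrev Block (Γ : Type*) (c : ℕ) := {l : List Γ // l.length = c}

section Blocks

variable {σ Γ β : Type*} {c : ℕ}

/-- Passes preserve length, so the image of a block is again cut off by its length `c`. Positivity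
of `c` makes the number of blocks recoverable from the concatenation. -/
theorem Sweep.flatMap_iff {act : σ → Γ → Set (σ × Γ)} (f : β → List Γ) (hf : ∀ v, (f v).length = c)
    (hc : 0 < c) {q q' : σ} {L L' : List β} :
    Sweep (fun q v => {p : σ × β | Sweep act q (f v) p.1 (f p.2)}) q L q' L' ↔
      Sweep act q (L.flatMap f) q' (L'.flatMap f) := by
  have hne : ∀ v, f v ≠ [] := fun v h => by have := hf v; simp [h] at this; omega
  induction L generalizing q L' with
  | nil => cases L' <;> simp [hne]
  | cons v L ih =>
    simp only [Sweep.cons_iff, List.flatMap_cons, Sweep.append_iff, ih, Set.mem_ofPred_eq]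
    constructor
    · rintro ⟨q₁, w, L₁, h1, h2, rfl⟩
      exact ⟨q₁, _, _, h1, h2, by simp⟩
    · rintro ⟨q₁, m₁, m₂, h1, h2, h3⟩
      have hl := h1.length_eq
      cases L' with
      | nil =>
        have : m₁ = [] := by simp_all
        subst this
        exact absurd (by simpa using hl.symm) (hne v)
      | cons w L' =>
        rw [List.flatMap_cons] at h3
        obtain ⟨rfl, rfl⟩ := List.append_inj h3 (by rw [hl, hf, hf])
        exact ⟨q₁, w, L', h1, h2, rfl⟩

theorem exists_flatMap_eq {n : ℕ} {l : List Γ} (h : l.length = n * c) :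
    ∃ L : List (Block Γ c), L.flatMap (·.1) = l := by
  induction n generalizing l with
  | zero => exact ⟨[], by simp_all⟩
  | succ n ih =>
    obtain ⟨L, hL⟩ := ih (l := l.drop c) (by rw [List.length_drop, h]; simp [Nat.succ_mul])
    have : (l.take c).length = c := by rw [List.length_take, h]; simp [Nat.succ_mul]
    exact ⟨⟨l.take c, this⟩ :: L, by simp [hL]⟩

theorem length_flatMap_block (L : List (Block Γ c)) :
    (L.flatMap (·.1)).length = L.length * c := by
  induction L with
  | nil => simp
  | cons v L ih => simp only [List.flatMap_cons, List.length_append, ih, v.2]; simp; ring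

theorem reverse_flatMap_block (L : List (Block Γ c)) :
    (L.flatMap (·.1)).reverse = L.reverse.flatMap fun v => v.1.reverse := by
  induction L with
  | nil => simp
  | cons v L ih => simp only [List.flatMap_cons, List.reverse_append, List.reverse_cons, List.flatMap_append,
      List.flatMap_nil, List.append_nil, ih]

theorem RoundTrip.flatMap_iff {act back : σ → Γ → Set (σ × Γ)} (hc : 0 < c) {q q' : σ}
    {L L' : List (Block Γ c)} :
    RoundTrip (fun q v => {p : σ × Block Γ c | Sweep act q v.1 p.1 p.2.1})
      (fun q v => {p : σ × Block Γ c | Sweep back q v.1.reverse p.1 p.2.1.reverse})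
      q L q' L' ↔
      RoundTrip act back q (L.flatMap (·.1)) q' (L'.flatMap (·.1)) := by
  have H1 : ∀ {q q' : σ} {L L' : List (Block Γ c)},
      Sweep (fun q v => {p : σ × Block Γ c | Sweep act q v.1 p.1 p.2.1}) q L q' L' ↔
      Sweep act q (L.flatMap (·.1)) q' (L'.flatMap (·.1)) :=
    Sweep.flatMap_iff (fun v : Block Γ c => v.1) (fun v => v.2) hc
  have H2 : ∀ {q q' : σ} {L L' : List (Block Γ c)},
      Sweep (fun q v => {p : σ × Block Γ c | Sweep back q v.1.reverse p.1 p.2.1.reverse})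
      q L q' L' ↔ Sweep back q (L.flatMap (·.1.reverse)) q' (L'.flatMap (·.1.reverse)) :=
    Sweep.flatMap_iff (fun v : Block Γ c => v.1.reverse) (fun v => by simpa using v.2) hc
  constructor
  · rintro ⟨q₁, L₁, h1, h2⟩
    refine ⟨q₁, _, H1.1 h1, ?_⟩
    rw [reverse_flatMap_block, reverse_flatMap_block]
    exact H2.1 h2
  · rintro ⟨q₁, l₁, h1, h2⟩
    obtain ⟨L₁, rfl⟩ := exists_flatMap_eq (h1.length_eq.trans (length_flatMap_block L))
    refine ⟨q₁, L₁, H1.2 h1, H2.2 ?_⟩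
    rwa [reverse_flatMap_block, reverse_flatMap_block] at h2

/-- Tape compression: the new machine treats `c` cells as one, running through a whole block in a
single action. On the way back each block must be read in reverse as well. -/
theorem TapeProgram.Implementable.packed {ρ : Type*} {d : Prop} {R : TapeProgram Γ ρ}
    (hR : Implementable d R) (hc : 0 < c) :
    Implementable d fun (L : List (Block Γ c)) r L' =>
      R (L.flatMap (·.1)) r (L'.flatMap (·.1)) := by
  obtain ⟨m, hm, hR⟩ := hR
  let M : SweepMachine (Block Γ c) ρ :=
    { State := m.State
      finite_State := m.finite_State
      start := m.start
      act := fun q v => {p | Sweep m.act q v.1 p.1 p.2.1}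
      back := fun q v => {p | Sweep m.back q v.1.reverse p.1 p.2.1.reverse}
      next := m.next }
  have hs : ∀ {q q' L L'}, RoundTrip M.act M.back q L q' L' ↔
      RoundTrip m.act m.back q (L.flatMap (·.1)) q' (L'.flatMap (·.1)) :=
    RoundTrip.flatMap_iff hc
  refine ⟨M, fun h => ⟨fun q v p hp p' hp' => ?_, fun q v p hp p' hp' => ?_⟩, fun L r L' => ?_⟩
  · obtain ⟨h1, h2⟩ := Sweep.functional (hm h).1 hp hp'
    exact Prod.ext h1 (Subtype.ext h2)
  · obtain ⟨h1, h2⟩ := Sweep.functional (hm h).2 hp hp'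
    exact Prod.ext h1 (Subtype.ext (List.reverse_injective h2))
  · simp only [← hR]
    change M.Exec M.start _ _ _ ↔ m.Exec M.start _ _ _
    generalize M.start = q
    constructor
    · intro h
      induction h with
      | exit h1 h2 => exact .exit (hs.1 h1) h2
      | step h1 h2 _ ih => exact .step (hs.1 h1) h2 ih
    · suffices H : ∀ {q x r y}, m.Exec q x r y → ∀ L L' : List (Block Γ c),
          L.flatMap (·.1) = x → L'.flatMap (·.1) = y → M.Exec q L r L' from
        fun h => H h L L' rfl rfl
      intro q x r y h
      induction h with
      | exit h1 h2 =>
        rintro L L' rfl rfl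
        exact .exit (hs.2 h1) h2
      | step h1 h2 _ ih =>
        rintro L L' rfl hy
        obtain ⟨L₁, rfl⟩ := exists_flatMap_eq (h1.length_eq.trans (length_flatMap_block L))
        exact .step (hs.2 h1) h2 (ih _ _ rfl hy)

end Blocks

/-! ### Elementary steps of a sweep machine -/

namespace SweepMachine

variable {Γ ρ : Type*} (m : SweepMachine Γ ρ)

/-- Configurations of a sweep machine in the middle of a sweep: the state and the tape to the left
and to the right of the head, or the value that has been returned. -/
inductive Cfg where
  | forth (q : m.State) (l r : List Γ)
  | back (q : m.State) (l r : List Γ)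
  | done (r : ρ)

/-- Elementary steps of a sweep machine. -/
inductive Step : m.Cfg → m.Cfg → Prop
  | forth {q x q' y l r} : (q', y) ∈ m.act q x → Step (.forth q l (x :: r)) (.forth q' (l ++ [y]) r)
  | turn {q l} : Step (.forth q l []) (.back q l [])
  | back {q x q' y l r} : (q', y) ∈ m.back q x → Step (.back q (l ++ [x]) r) (.back q' l (y :: r))
  | next {q q' l} : m.next q = .inl q' → Step (.back q [] l) (.forth q' [] l)
  | done {q t l} : m.next q = .inr t → Step (.back q [] l) (.done t)

variable {m}

open Relation in
theorem reaches_forth {q q' : m.State} {l r r' : List Γ} (h : Sweep m.act q r q' r') :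
    ReflTransGen m.Step (.forth q l r) (.forth q' (l ++ r') []) := by
  induction h generalizing l with
  | nil => simp [ReflTransGen.refl]
  | @cons _ _ _ y _ _ _ h1 _ ih =>
    refine .head (.forth h1) ?_
    have := ih (l := l ++ [y])
    simpa using this

open Relation in
theorem reaches_back {q q' : m.State} {s s' l r : List Γ} (h : Sweep m.back q s q' s') :
    ReflTransGen m.Step (.back q (l ++ s.reverse) r) (.back q' l (s'.reverse ++ r)) := by
  induction h generalizing r with
  | nil => simp [ReflTransGen.refl]
  | @cons _ _ _ y _ _ _ h1 _ ih =>
    simp only [List.reverse_cons, List.append_assoc, List.singleton_append]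
    rw [← List.append_assoc]
    exact .head (.back h1) ih

open Relation in
theorem reaches_roundTrip {q q' : m.State} {l l' : List Γ}
    (h : RoundTrip m.act m.back q l q' l') :
    ReflTransGen m.Step (.forth q [] l) (.back q' [] l') := by
  obtain ⟨q₁, l₁, h1, h2⟩ := h
  refine ((reaches_forth h1).tail .turn).trans ?_
  have := reaches_back (l := []) (r := []) h2
  simpa using this

open Relation in
theorem Exec.reaches {q : m.State} {l l' : List Γ} {r : ρ} (h : m.Exec q l r l') :
    ReflTransGen m.Step (.forth q [] l) (.done r) := by
  induction h with
  | exit h1 h2 => exact (reaches_roundTrip h1).tail (.done h2)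
  | step h1 h2 _ ih => exact ((reaches_roundTrip h1).tail (.next h2)).trans ih

/-- The computation can be continued from the configuration so that `t` is returned. -/
def Cfg.CanReturn (t : ρ) : m.Cfg → Prop
  | .forth q l r => ∃ q' r' q'' s, Sweep m.act q r q' r' ∧
      Sweep m.back q' (l ++ r').reverse q'' s.reverse ∧
      (m.next q'' = .inr t ∨ ∃ p s', m.next q'' = .inl p ∧ m.Exec p s t s')
  | .back q l r => ∃ q'' s, Sweep m.back q l.reverse q'' s.reverse ∧
      (m.next q'' = .inr t ∨ ∃ p s', m.next q'' = .inl p ∧ m.Exec p (s ++ r) t s')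
  | .done t' => t' = t

theorem exists_exec_of_canReturn {t : ρ} {q : m.State} {l : List Γ}
    (h : (Cfg.forth q [] l).CanReturn t) : ∃ l', m.Exec q l t l' := by
  obtain ⟨q', r', q'', s, h1, h2, h3⟩ := h
  have hr : RoundTrip m.act m.back q l q'' s := ⟨_, _, h1, h2⟩
  rcases h3 with h3 | ⟨p, s', h3, h4⟩
  · exact ⟨_, .exit hr h3⟩
  · exact ⟨_, .step hr h3 h4⟩

/-- Backward preservation: each step prepends one action to a pass, or one round trip to an
execution. This direction suits an induction from the final configuration, since the rest of the
current pass is then already known. -/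
theorem Step.canReturn {t : ρ} {c c' : m.Cfg} (h : m.Step c c') (h' : c'.CanReturn t) :
    c.CanReturn t := by
  cases h with
  | forth h1 =>
    obtain ⟨q', r', q'', s, h2, h3, h4⟩ := h'
    exact ⟨q', _, q'', s, .cons h1 h2, by simpa using h3, h4⟩
  | turn =>
    obtain ⟨q'', s, h2, h3⟩ := h'
    exact ⟨_, [], q'', s, .nil _, by simpa using h2, by simpa using h3⟩
  | @back q x q' y l r h1 =>
    obtain ⟨q'', s, h2, h3⟩ := h'
    refine ⟨q'', s ++ [y], ?_, by simpa using h3⟩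
    simp only [List.reverse_append, List.reverse_cons, List.reverse_nil, List.nil_append,
      List.singleton_append]
    exact .cons h1 h2
  | next h1 =>
    obtain ⟨l', h2⟩ := exists_exec_of_canReturn h'
    exact ⟨_, [], by simp, .inr ⟨_, _, h1, by simpa using h2⟩⟩
  | done h1 =>
    cases h'
    exact ⟨_, [], by simp, .inl h1⟩

theorem exec_iff_reaches {q : m.State} {l : List Γ} {t : ρ} :
    (∃ l', m.Exec q l t l') ↔ Relation.ReflTransGen m.Step (.forth q [] l) (.done t) := by
  refine ⟨fun ⟨_, h⟩ => h.reaches, fun h => exists_exec_of_canReturn ?_⟩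
  generalize Cfg.forth q [] l = c at h
  induction h using Relation.ReflTransGen.head_induction_on with
  | refl => rfl
  | head h1 _ ih => exact h1.canReturn ih

end SweepMachine

/-! ### Sweep machines as linear bounded automata -/

namespace SweepMachine

variable {B : Type*} {Γ : Type} (m : SweepMachine Γ Bool) (enc : B → Γ)

/-- The actions on a cell between the end markers; the flag tells the direction. -/
def cellTrans (q : m.State) (f : Bool) (x : Γ) :
    Set (((m.State × Bool) ⊕ Bool) × TapeSymbol B Γ × HeadMove) :=
  match f with
  | true => (fun p => (.inl (p.1, true), .work p.2, .right)) '' m.act q x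
  | false => (fun p => (.inl (p.1, false), .work p.2, .left)) '' m.back q x

/-- The actions of the linear bounded automaton that simulates a sweep machine. -/
def lbaTrans : (m.State × Bool) ⊕ Bool → TapeSymbol B Γ →
    Set (((m.State × Bool) ⊕ Bool) × TapeSymbol B Γ × HeadMove)
  | .inl (q, f), .input b => m.cellTrans q f (enc b)
  | .inl (q, f), .work x => m.cellTrans q f x
  | .inl (q, true), .leftEnd => {(.inl (q, true), .leftEnd, .right)}
  | .inl (q, false), .leftEnd =>
    match m.next q with
    | .inl q' => {(.inl (q', true), .leftEnd, .right)}
    | .inr t => {(.inr t, .leftEnd, .stay)}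
  | .inl (q, true), .rightEnd => {(.inl (q, false), .rightEnd, .left)}
  | .inl (_, false), .rightEnd => ∅
  | .inr _, _ => ∅

/-- The cell content that a tape symbol stands for. -/
def decodeSymbol : TapeSymbol B Γ → Option Γ
  | .input b => some (enc b)
  | .work x => some x
  | _ => none

/-- An input letter is treated as the cell content that encodes it, so no preliminary pass is needed
to encode the input. -/
theorem lbaTrans_of_decodeSymbol {enc : B → Γ} {s : TapeSymbol B Γ} {x : Γ} (h : decodeSymbol enc s = some x)
    (q : m.State) (f : Bool) :
    m.lbaTrans enc (.inl (q, f)) s = m.cellTrans q f x := by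
  cases s <;> simp [decodeSymbol] at h <;> subst h <;> cases f <;> rfl

variable [Finite Γ]

/-- The linear bounded automaton that simulates a sweep machine on the encoded input. -/
abbrev toLBA : LBA B where
  State := (m.State × Bool) ⊕ Bool
  finite_State := have := m.finite_State; inferInstance
  Work := Γ
  finite_Work := inferInstance
  start := .inl (m.start, true)
  accepting := {.inr true}
  trans := m.lbaTrans enc
  trans_leftEnd := by
    rintro (⟨q, _ | _⟩ | _) q' s e h
    · simp only [lbaTrans] at h
      split at h <;> simp at h <;> simp [h]
    · simp [lbaTrans] at h; simp [h]
    · simp [lbaTrans] at h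
  trans_rightEnd := by
    rintro (⟨q, _ | _⟩ | _) q' s e h <;> simp [lbaTrans] at h
    simp [h]

theorem toLBA_deterministic (hm : m.Deterministic) : (m.toLBA enc).Deterministic := by
  have hc : ∀ q f x, (m.cellTrans (B := B) q f x).Subsingleton := by
    rintro q (_ | _) x
    · exact (hm.2 _ _).image _
    · exact (hm.1 _ _).image _
  rintro (⟨q, f⟩ | b) s
  · change (m.lbaTrans enc _ _).Subsingleton
    rcases f with _ | _ <;> rcases s with _ | _ | _ | _ <;> simp only [lbaTrans] <;>
      first
      | exact hc _ _ _
      | exact Set.subsingleton_singleton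
      | exact Set.subsingleton_empty
      | split <;> exact Set.subsingleton_singleton
  · exact Set.subsingleton_empty

/-- Corresponding configurations of a sweep machine and of the linear bounded automaton. -/
def Represents : m.Cfg → (m.toLBA enc).Cfg → Prop
  | .forth q l r, c => c.state = .inl (q, true) ∧ ∃ s t,
      s.map (decodeSymbol enc) = l.map some ∧ t.map (decodeSymbol enc) = r.map some ∧
      c.head = s.length + 1 ∧ c.tape = .leftEnd :: (s ++ (t ++ [.rightEnd]))
  | .back q l r, c => c.state = .inl (q, false) ∧ ∃ s t,
      s.map (decodeSymbol enc) = l.map some ∧ t.map (decodeSymbol enc) = r.map some ∧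
      c.head = s.length ∧ c.tape = .leftEnd :: (s ++ (t ++ [.rightEnd]))
  | .done t, c => c.state = .inr t

variable {m enc}

theorem Represents.step {a a' : m.Cfg} {c : (m.toLBA enc).Cfg} (h : m.Represents enc a c)
    (h' : m.Step a a') : ∃ c', (m.toLBA enc).Step c c' ∧ m.Represents enc a' c' := by
  obtain ⟨cs, ch, ct⟩ := c
  cases h' with
  | @forth q x q' y l r h1 =>
    obtain ⟨rfl, s, t, h2, h3, rfl, rfl⟩ := h
    obtain ⟨z, t, rfl, h4, h5⟩ := List.map_eq_cons_iff.1 h3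
    -- The left marker occupies position 0, so the head stands at `s.length + 1`; the move to the
    -- right adds one.
    refine ⟨⟨.inl (q', true), s.length + 1 + 1, _⟩, ⟨z, .inl (q', true), .work y, .right, ?_, ?_,
      rfl⟩, rfl, s ++ [.work y], t, ?_, h5, ?_, ?_⟩
    · simp
    · change _ ∈ m.lbaTrans enc _ _
      rw [lbaTrans_of_decodeSymbol _ h4]
      exact ⟨_, h1, rfl⟩
    · simp [h2, decodeSymbol]
    · simp
    · simp
  | turn =>
    obtain ⟨rfl, s, t, h2, h3, rfl, rfl⟩ := h
    obtain rfl : t = [] := by simpa using h3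
    refine ⟨⟨.inl (_, false), s.length, _⟩, ⟨.rightEnd, .inl (_, false), .rightEnd, .left, ?_, rfl,
      rfl⟩, rfl, s, [], h2, rfl, rfl, ?_⟩
    · simp
    · simp
  | @back q x q' y l r h1 =>
    obtain ⟨rfl, s, t, h2, h3, rfl, rfl⟩ := h
    rw [List.map_append] at h2
    obtain ⟨s, u, rfl, h4, h5⟩ := List.map_eq_append_iff.1 h2
    obtain ⟨z, u, rfl, h6, h7⟩ := List.map_eq_cons_iff.1 h5
    obtain rfl : u = [] := by simpa using h7
    refine ⟨⟨.inl (q', false), s.length, _⟩, ⟨z, .inl (q', false), .work y, .left, ?_, ?_,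
      ?_⟩, rfl, s, .work y :: t, h4, ?_, rfl, rfl⟩
    · simp
    · change _ ∈ m.lbaTrans enc _ _
      rw [lbaTrans_of_decodeSymbol _ h6]
      exact ⟨_, h1, rfl⟩
    · simp [HeadMove.apply]
    · simp [h3, decodeSymbol]
  | @next q q' l h1 =>
    obtain ⟨rfl, s, t, h2, h3, rfl, rfl⟩ := h
    obtain rfl : s = [] := by simpa using h2
    refine ⟨⟨.inl (q', true), 1, _⟩, ⟨.leftEnd, .inl (q', true), .leftEnd, .right, ?_, ?_,
      rfl⟩, rfl, [], t, rfl, h3, rfl, ?_⟩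
    · simp
    · change _ ∈ m.lbaTrans enc (.inl (q, false)) .leftEnd
      simp [lbaTrans, h1]
    · simp
  | @done q b l h1 =>
    obtain ⟨rfl, s, t, h2, h3, rfl, rfl⟩ := h
    obtain rfl : s = [] := by simpa using h2
    refine ⟨⟨.inr b, 0, _⟩, ⟨.leftEnd, .inr b, .leftEnd, .stay, ?_, ?_, rfl⟩, rfl⟩
    · simp
    · change _ ∈ m.lbaTrans enc (.inl (q, false)) .leftEnd
      simp [lbaTrans, h1]

/-- The converse simulation is needed because the automaton is nondeterministic: every one of its
computations must come from the sweep machine, or it might accept too much. -/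
theorem Represents.step_symm {a : m.Cfg} {c c' : (m.toLBA enc).Cfg} (h : m.Represents enc a c)
    (h' : (m.toLBA enc).Step c c') : ∃ a', m.Step a a' ∧ m.Represents enc a' c' := by
  obtain ⟨cs, ch, ct⟩ := c
  obtain ⟨z, p, z', e, h1, h2, rfl⟩ := h'
  change _ ∈ m.lbaTrans enc cs z at h2
  simp only at h1 ⊢
  cases a with
  | forth q l r =>
    obtain ⟨h3, s, t, h4, h5, h6, h7⟩ := h
    simp only at h3 h6 h7
    subst h3 h6 h7
    cases t with
    | nil =>
      obtain rfl : r = [] := by simpa using h5.symm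
      obtain rfl : z = .rightEnd := by simpa [eq_comm] using h1
      obtain ⟨rfl, rfl, rfl⟩ : p = .inl (q, false) ∧ z' = .rightEnd ∧ e = .left := by
        simpa [lbaTrans] using h2
      exact ⟨_, .turn, rfl, s, [], h4, rfl, rfl, by simp⟩
    | cons y t =>
      obtain ⟨x, r, rfl, h8, h9⟩ := List.map_eq_cons_iff.1 h5.symm
      obtain rfl : z = y := by simpa [eq_comm] using h1
      rw [lbaTrans_of_decodeSymbol _ h8.symm] at h2
      obtain ⟨⟨q', y'⟩, h10, h11⟩ := h2
      simp only [Prod.mk.injEq] at h11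
      obtain ⟨rfl, rfl, rfl⟩ := h11
      exact ⟨_, .forth h10, rfl, s ++ [.work y'], t, by simp [h4, decodeSymbol], h9.symm,
        by simp [HeadMove.apply], by simp⟩
  | back q l r =>
    obtain ⟨h3, s, t, h4, h5, h6, h7⟩ := h
    simp only at h3 h6 h7
    subst h3 h6 h7
    rcases List.eq_nil_or_concat s with rfl | ⟨s, y, rfl⟩
    · obtain rfl : l = [] := by simpa using h4.symm
      obtain rfl : z = .leftEnd := by simpa [eq_comm] using h1
      simp only [lbaTrans] at h2
      split at h2
      · next q' h8 =>
        simp only [Set.mem_singleton_iff, Prod.mk.injEq] at h2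
        obtain ⟨rfl, rfl, rfl⟩ := h2
        exact ⟨_, .next h8, rfl, [], t, rfl, h5, rfl, by simp⟩
      · next b h8 =>
        simp only [Set.mem_singleton_iff, Prod.mk.injEq] at h2
        obtain ⟨rfl, rfl, rfl⟩ := h2
        exact ⟨_, .done h8, rfl⟩
    · simp only [List.map_append, List.map_cons, List.map_nil, List.concat_eq_append] at h4
      obtain ⟨l, u, rfl, h8, h9⟩ := List.map_eq_append_iff.1 h4.symm
      obtain ⟨x, u, rfl, h10, h11⟩ := List.map_eq_cons_iff.1 h9
      obtain rfl : u = [] := by simpa using h11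
      obtain rfl : z = y := by simpa [eq_comm] using h1
      rw [lbaTrans_of_decodeSymbol _ h10.symm] at h2
      obtain ⟨⟨q', y'⟩, h12, h13⟩ := h2
      simp only [Prod.mk.injEq] at h13
      obtain ⟨rfl, rfl, rfl⟩ := h13
      exact ⟨_, .back h12, rfl, s, .work y' :: t, h8.symm, by simp [h5, decodeSymbol],
        by simp [HeadMove.apply], by simp⟩
  | done b =>
    have h3 : cs = .inr b := h
    subst h3
    exact absurd h2 (by simp [lbaTrans])

/-- The configuration after the first step. -/
theorem step_init_iff {w : List B} {c : (m.toLBA enc).Cfg} :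
    (m.toLBA enc).Step ((m.toLBA enc).init w) c ↔
      c = ⟨.inl (m.start, true), 1, .leftEnd :: (w.map .input ++ [.rightEnd])⟩ := by
  constructor
  · rintro ⟨z, p, z', e, h1, h2, rfl⟩
    obtain rfl : z = .leftEnd := by simpa [LBA.init, eq_comm] using h1
    change _ ∈ m.lbaTrans enc (.inl (m.start, true)) .leftEnd at h2
    simp only [lbaTrans, Set.mem_singleton_iff, Prod.mk.injEq] at h2
    obtain ⟨rfl, rfl, rfl⟩ := h2
    rfl
  · rintro rfl
    refine ⟨.leftEnd, .inl (m.start, true), .leftEnd, .right, rfl, ?_, rfl⟩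
    change _ ∈ m.lbaTrans enc (.inl (m.start, true)) .leftEnd
    simp [lbaTrans]

theorem represents_init (w : List B) : m.Represents enc (.forth m.start [] (w.map enc))
    ⟨.inl (m.start, true), 1, .leftEnd :: (w.map .input ++ [.rightEnd])⟩ :=
  ⟨rfl, [], w.map .input, rfl, by simp [decodeSymbol], rfl, rfl⟩

theorem exists_reaches_toLBA {w : List B} {t : Bool} (h : ∃ l, m.Exec m.start (w.map enc) t l) :
    ∃ c, (m.toLBA enc).Reaches ((m.toLBA enc).init w) c ∧ c.state = .inr t := by
  rw [exec_iff_reaches] at h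
  suffices H : ∀ a c, Relation.ReflTransGen m.Step a (.done t) → m.Represents enc a c →
      ∃ c', (m.toLBA enc).Reaches c c' ∧ c'.state = .inr t by
    obtain ⟨c, h1, h2⟩ := H _ _ h (represents_init w)
    exact ⟨c, .head (step_init_iff.2 rfl) h1, h2⟩
  intro a c h hac
  induction h using Relation.ReflTransGen.head_induction_on generalizing c with
  | refl => exact ⟨c, .refl, hac⟩
  | head h1 _ ih =>
    obtain ⟨c₁, h2, h3⟩ := hac.step h1
    obtain ⟨c', h4, h5⟩ := ih c₁ h3
    exact ⟨c', .head h2 h4, h5⟩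

theorem language_toLBA :
    (m.toLBA enc).language = {w | ∃ l, m.Exec m.start (w.map enc) true l} := by
  ext w
  constructor
  · rintro ⟨c, h1, h2⟩
    rcases Relation.ReflTransGen.cases_head h1 with rfl | ⟨c₁, h3, h4⟩
    -- The start state is not accepting, so an accepting computation has a first step.
    · exact absurd h2 (by change Sum.inl _ ∉ ({.inr true} : Set _); simp)
    · obtain rfl := step_init_iff.1 h3
      suffices H : ∃ a, Relation.ReflTransGen m.Step (.forth m.start [] (w.map enc)) a ∧
          m.Represents enc a c by
        obtain ⟨a, h5, h6⟩ := H
        refine exec_iff_reaches.2 ?_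
        have h2 : c.state = .inr true := h2
        cases a with
        | forth => cases h2.symm.trans h6.1
        | back => cases h2.symm.trans h6.1
        | done t =>
          cases h2.symm.trans h6
          exact h5
      clear h1 h2
      induction h4 with
      | refl => exact ⟨_, .refl, represents_init w⟩
      | tail _ h6 ih =>
        obtain ⟨a, h7, h8⟩ := ih
        obtain ⟨a', h9, h10⟩ := h8.step_symm h6
        exact ⟨a', h7.tail h9, h10⟩
  · intro h
    obtain ⟨c, h1, h2⟩ := exists_reaches_toLBA h
    exact ⟨c, h1, h2⟩

/-- Once the machine has returned a value, the automaton is in a state without actions. -/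
theorem toLBA_halts (h : ∀ w : List B, ∃ t l, m.Exec m.start (w.map enc) t l) :
    (m.toLBA enc).Halts := by
  intro w
  obtain ⟨t, ht⟩ := h w
  obtain ⟨c, h1, h2⟩ := exists_reaches_toLBA ht
  refine ⟨c, h1, ?_⟩
  rintro c' ⟨z, p, z', e, -, h3, -⟩
  rw [h2] at h3
  exact h3

end SweepMachine

/-! ### Sweep machines as context-sensitive grammars -/

/-- Nonterminals of the grammar of a sweep machine. A cell carries its input letter, two flags that
tell whether it is the first or the last one, its content, and possibly the state and the direction
of the machine. -/
inductive SweepNT (β Γ Q : Type) where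
  | start : SweepNT β Γ Q
  | more : SweepNT β Γ Q
  | cell (o : β × Bool × Bool) (x : Γ) (mark : Option (Q × Bool)) : SweepNT β Γ Q
  | accepted (b : β) : SweepNT β Γ Q

theorem SweepNT.finite {β Γ Q : Type} [Finite β] [Finite Γ] [Finite Q] :
    Finite (SweepNT β Γ Q) := by
  let f : SweepNT β Γ Q → Bool ⊕ ((β × Bool × Bool) × Γ × Option (Q × Bool)) ⊕ β
    | start => .inl true
    | more => .inl false
    | cell o x mark => .inr (.inl (o, x, mark))
    | accepted b => .inr (.inr b)
  refine Finite.of_injective f fun a b h => ?_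
  cases a <;> cases b <;> simp_all [f]

theorem Symbol.finite (T N : Type*) [Finite T] [Finite N] : Finite (Symbol T N) := by
  let f : Symbol T N → T ⊕ N
    | terminal t => .inl t
    | nonterminal n => .inr n
  refine Finite.of_injective f fun a b h => ?_
  cases a <;> cases b <;> simp_all [f]

/-- If `P` can hold at only one place of a list, that place is determined. With `P := IsKey` this
locates the only spot where a production can be applied. -/
theorem List.eq_of_append_cons_eq {α : Type*} {P : α → Prop} {p q p' q' : List α} {a a' : α}
    (h : p ++ a :: q = p' ++ a' :: q') (ha : P a) (hp : ∀ x ∈ p', ¬ P x) (hq : ∀ x ∈ q', ¬ P x) :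
    p = p' ∧ a = a' ∧ q = q' := by
  induction p generalizing p' with
  | nil =>
    cases p' with
    | nil => simpa using h
    | cons x p' =>
      simp only [List.nil_append, List.cons_append, List.cons.injEq] at h
      exact absurd (h.1 ▸ ha) (hp x (by simp))
  | cons y p ih =>
    cases p' with
    | nil =>
      simp only [List.nil_append, List.cons_append, List.cons.injEq] at h
      exact absurd ha (hq a (by simp [← h.2]))
    | cons x p' =>
      simp only [List.cons_append, List.cons.injEq] at h
      obtain ⟨h1, h2, h3⟩ := ih h.2 (fun x hx => hp x (by simp [hx]))
      exact ⟨by rw [h.1, h1], h2, h3⟩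

namespace SweepMachine

open Relation

variable {B : Type*} {β Γ : Type} (m : SweepMachine Γ Bool) (enc : B → Γ) (e : B ≃ β)

/-- A cell as a symbol of the grammar. -/
def cellSymbol (o : β × Bool × Bool) (x : Γ) (mark : Option (m.State × Bool)) :
    Symbol B (SweepNT β Γ m.State) := .nonterminal (.cell o x mark)

/-- The productions of the grammar of a sweep machine. -/
inductive Rule : List (Symbol B (SweepNT β Γ m.State)) → List (Symbol B (SweepNT β Γ m.State)) →
    Prop
  | single (b) : Rule [.nonterminal .start]
      [m.cellSymbol (e b, true, true) (enc b) (some (m.start, true))]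
  | last (b) : Rule [.nonterminal .start]
      [.nonterminal .more, m.cellSymbol (e b, false, true) (enc b) none]
  | middle (b) : Rule [.nonterminal .more]
      [.nonterminal .more, m.cellSymbol (e b, false, false) (enc b) none]
  | first (b) : Rule [.nonterminal .more]
      [m.cellSymbol (e b, true, false) (enc b) (some (m.start, true))]
  | forth {q x q' y} (b f o' x') : (q', y) ∈ m.act q x →
      Rule [m.cellSymbol (b, f, false) x (some (q, true)), m.cellSymbol o' x' none]
        [m.cellSymbol (b, f, false) y none, m.cellSymbol o' x' (some (q', true))]
  | turn {q x q' y} (b f) : (q', y) ∈ m.act q x →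
      Rule [m.cellSymbol (b, f, true) x (some (q, true))]
        [m.cellSymbol (b, f, true) y (some (q', false))]
  | back {q x q' y} (b f o' x') : (q', y) ∈ m.back q x →
      Rule [m.cellSymbol o' x' none, m.cellSymbol (b, false, f) x (some (q, false))]
        [m.cellSymbol o' x' (some (q', false)), m.cellSymbol (b, false, f) y none]
  | next {q x q' y q''} (b f) : (q', y) ∈ m.back q x → m.next q' = .inl q'' →
      Rule [m.cellSymbol (b, true, f) x (some (q, false))]
        [m.cellSymbol (b, true, f) y (some (q'', true))]
  | done {q x q' y} (b f) : (q', y) ∈ m.back q x → m.next q' = .inr true →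
      Rule [m.cellSymbol (b, true, f) x (some (q, false))] [.nonterminal (.accepted b)]
  | spread (b o x) : Rule [.nonterminal (.accepted b), m.cellSymbol o x none]
      [.nonterminal (.accepted b), .nonterminal (.accepted o.1)]
  | letter (b) : Rule [.nonterminal (.accepted (e b))] [.terminal b]

variable {m enc e} in
theorem Rule.lengths {u v : List (Symbol B (SweepNT β Γ m.State))} (h : m.Rule enc e u v) :
    0 < u.length ∧ u.length ≤ v.length ∧ v.length ≤ 2 := by
  cases h <;> simp

/-- The grammar that simulates a sweep machine. -/
abbrev toGrammar [Finite Γ] [Finite B] : ContextSensitiveGrammar B where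
  NT := SweepNT β Γ m.State
  finite_NT := have := m.finite_State; have := Finite.of_equiv _ e; SweepNT.finite
  initial := .start
  rules := {p | m.Rule enc e p.1 p.2}
  finite_rules := by
    have := m.finite_State
    have := Finite.of_equiv _ e
    have : Finite (SweepNT β Γ m.State) := SweepNT.finite
    have := Symbol.finite B (SweepNT β Γ m.State)
    have hf := List.finite_length_le (Symbol B (SweepNT β Γ m.State)) 2
    refine (hf.prod hf).subset fun p hp => ?_
    have := Rule.lengths hp
    exact ⟨by simp; omega, by simp; omega⟩
  lhs_ne_nil := fun p hp h => by simpa [h] using (Rule.lengths hp).1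
  length_le := fun p hp => (Rule.lengths hp).2.1

/-- The number of cells in a configuration. -/
def Cfg.HasLength {m : SweepMachine Γ Bool} (n : ℕ) : m.Cfg → Prop
  | .forth _ l r => l.length + r.length = n
  | .back _ l r => l.length + r.length = n
  | .done _ => True

theorem Step.hasLength {m : SweepMachine Γ Bool} {n : ℕ} {a a' : m.Cfg} (h : m.Step a a')
    (ha : a.HasLength n) : a'.HasLength n := by
  cases h <;> simp [Cfg.HasLength] at ha ⊢ <;> omega

/-- The input letters with the flags for the first and the last position. -/
def flagged (e : B ≃ β) (f : Bool) : List B → List (β × Bool × Bool)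
  | [] => []
  | b :: w => (e b, f, w.isEmpty) :: flagged e false w

variable {m enc e}

theorem map_fst_flagged (f : Bool) (w : List B) : (flagged e f w).map (·.1) = w.map e := by
  induction w generalizing f with
  | nil => rfl
  | cons b w ih => simp [flagged, ih]

theorem length_flagged (f : Bool) (w : List B) : (flagged e f w).length = w.length := by
  simpa using congrArg List.length (map_fst_flagged (e := e) f w)

theorem flag_last {f : Bool} {w : List B} {p q : List (β × Bool × Bool)} {o : β × Bool × Bool}
    (h : flagged e f w = p ++ o :: q) : o.2.2 = true ↔ q = [] := by
  induction w generalizing f p with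
  | nil => simp [flagged] at h
  | cons b w ih =>
    cases p with
    | nil =>
      simp only [flagged, List.nil_append, List.cons.injEq] at h
      obtain ⟨rfl, rfl⟩ := h
      cases w <;> simp [flagged]
    | cons _ p =>
      simp only [flagged, List.cons_append, List.cons.injEq] at h
      exact ih h.2

theorem flag_first {w : List B} {p q : List (β × Bool × Bool)} {o : β × Bool × Bool}
    (h : flagged e true w = p ++ o :: q) : o.2.1 = true ↔ p = [] := by
  have aux : ∀ {w : List B}, ∀ o ∈ flagged e false w, o.2.1 = false := by
    intro w
    induction w with
    | nil => simp [flagged]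
    | cons b w ih => simpa [flagged] using ih
  cases w with
  | nil => simp [flagged] at h
  | cons b w =>
    cases p with
    | nil =>
      simp only [flagged, List.nil_append, List.cons.injEq] at h
      simp [← h.1]
    | cons _ p =>
      simp only [flagged, List.cons_append, List.cons.injEq] at h
      simp [aux o (w := w) (by simp [h.2])]

theorem exists_flagged_eq {w : List B} {l : List Γ} (h : l.length = w.length) :
    ∃ s : List ((β × Bool × Bool) × Γ), s.map (·.2) = l ∧ s.map (·.1) = flagged e true w := by
  have : (flagged e true w).length = l.length := by
    have := congrArg List.length (map_fst_flagged (e := e) true w)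
    simp_all
  exact ⟨(flagged e true w).zip l, List.map_snd_zip this.ge, List.map_fst_zip this.le⟩

variable (m) in
/-- Unmarked cells. -/
def cells (l : List ((β × Bool × Bool) × Γ)) : List (Symbol B (SweepNT β Γ m.State)) :=
  l.map fun c => m.cellSymbol c.1 c.2 none

variable (m) in
/-- Cells with one marked cell. -/
def row (l : List ((β × Bool × Bool) × Γ)) (c : (β × Bool × Bool) × Γ) (q : m.State) (f : Bool)
    (r : List ((β × Bool × Bool) × Γ)) : List (Symbol B (SweepNT β Γ m.State)) :=
  m.cells l ++ m.cellSymbol c.1 c.2 (some (q, f)) :: m.cells r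

/-- The input letter that a symbol carries. -/
def symbolLetter (e : B ≃ β) {Q : Type} : Symbol B (SweepNT β Γ Q) → Option β
  | .terminal b => some (e b)
  | .nonterminal (.cell o _ _) => some o.1
  | .nonterminal (.accepted b) => some b
  | _ => none

/-- Symbols that take part in the left-hand side of a production other than as neighbours. -/
def IsKey {Q : Type} : Symbol B (SweepNT β Γ Q) → Prop
  | .terminal _ => False
  | .nonterminal (.cell _ _ none) => False
  | _ => True

theorem not_isKey_cells {l : List ((β × Bool × Bool) × Γ)} :
    ∀ x ∈ m.cells (B := B) l, ¬ IsKey x := by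
  intro x hx
  obtain ⟨c, -, rfl⟩ := List.mem_map.1 hx
  simp [cellSymbol, IsKey]

/-- After the input has been generated, every symbol carries its input letter and no production
changes these letters. A terminal word derived later must therefore spell the original input. -/
theorem Rule.symbolLetter_eq {u v : List (Symbol B (SweepNT β Γ m.State))} (h : m.Rule enc e u v)
    (hu : ∀ x ∈ u, symbolLetter e x ≠ none) :
    v.map (symbolLetter e) = u.map (symbolLetter e) := by
  cases h <;> simp_all [symbolLetter, cellSymbol]

/-- The marked cell is the only key of a row, so a production with a key on its left-hand side can
only act there. -/
theorem row_eq {p s : List (Symbol B (SweepNT β Γ m.State))} {K : Symbol B (SweepNT β Γ m.State)}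
    {c : (β × Bool × Bool) × Γ} {q : m.State} {f : Bool} {l r : List ((β × Bool × Bool) × Γ)}
    (h : m.row l c q f r = p ++ K :: s) (hK : IsKey K) :
    p = m.cells l ∧ K = m.cellSymbol c.1 c.2 (some (q, f)) ∧ s = m.cells r :=
  List.eq_of_append_cons_eq (P := IsKey) h.symm hK not_isKey_cells not_isKey_cells

theorem cells_eq_cons {l : List ((β × Bool × Bool) × Γ)} {o : β × Bool × Bool} {x : Γ}
    {s : List (Symbol B (SweepNT β Γ m.State))} (h : m.cellSymbol o x none :: s = m.cells l) :
    ∃ l', l = (o, x) :: l' ∧ s = m.cells l' := by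
  obtain ⟨⟨o', x'⟩, l', rfl, h1, h2⟩ := List.map_eq_cons_iff.1 h.symm
  simp only [cellSymbol, Symbol.nonterminal.injEq, SweepNT.cell.injEq, and_true] at h1
  obtain ⟨rfl, rfl⟩ := h1
  exact ⟨l', rfl, h2.symm⟩

theorem cells_eq_concat {l : List ((β × Bool × Bool) × Γ)} {o : β × Bool × Bool} {x : Γ}
    {s : List (Symbol B (SweepNT β Γ m.State))} (h : s ++ [m.cellSymbol o x none] = m.cells l) :
    ∃ l', l = l' ++ [(o, x)] ∧ s = m.cells l' := by
  obtain ⟨l', r, rfl, rfl, h1⟩ := List.map_eq_append_iff.1 h.symm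
  obtain ⟨r', rfl, h3⟩ := cells_eq_cons (l := r) h1.symm
  obtain rfl : r' = [] := by simpa [cells] using h3
  exact ⟨l', rfl, rfl⟩

section

variable [Finite Γ] [Finite B]

theorem produces_of_rule {u v : List (Symbol B (SweepNT β Γ m.State))} (h : m.Rule enc e u v)
    (p q : List (Symbol B (SweepNT β Γ m.State))) :
    (m.toGrammar enc e).Produces (p ++ u ++ q) (p ++ v ++ q) :=
  ⟨(u, v), h, p, q, rfl, rfl⟩

/-- What the derivability of the sentential form of a configuration means. -/
def Derivable (m : SweepMachine Γ Bool) (enc : B → Γ) (e : B ≃ β) (w : List B) : m.Cfg → Prop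
  | .forth q l r => ∀ p s, p.map (·.2) = l → s.map (·.2) = r →
      (p ++ s).map (·.1) = flagged e true w →
      (∀ c s', s = c :: s' → ReflTransGen (m.toGrammar enc e).Produces
        [.nonterminal .start] (m.row p c q true s')) ∧
      (∀ c p', s = [] → p = p' ++ [c] → ReflTransGen (m.toGrammar enc e).Produces
        [.nonterminal .start] (m.row p' c q false []))
  | .back q l r => ∀ p s, p.map (·.2) = l → s.map (·.2) = r →
      (p ++ s).map (·.1) = flagged e true w →
      (∀ c p', p = p' ++ [c] → ReflTransGen (m.toGrammar enc e).Produces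
        [.nonterminal .start] (m.row p' c q false s)) ∧
      (∀ c s' q', p = [] → s = c :: s' → m.next q = .inl q' →
        ReflTransGen (m.toGrammar enc e).Produces
        [.nonterminal .start] (m.row [] c q' true s')) ∧
      (∀ c s', p = [] → s = c :: s' → m.next q = .inr true →
        ReflTransGen (m.toGrammar enc e).Produces
        [.nonterminal .start] (.nonterminal (.accepted c.1.1) :: m.cells s'))
  | .done t => t = true → ReflTransGen (m.toGrammar enc e).Produces
        [.nonterminal .start] (w.map .terminal)

theorem derives_accepted (b : β) (l : List ((β × Bool × Bool) × Γ))
    (p : List (Symbol B (SweepNT β Γ m.State))) :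
    ReflTransGen (m.toGrammar enc e).Produces (p ++ .nonterminal (.accepted b) :: m.cells l)
      (p ++ .nonterminal (.accepted b) :: l.map fun c => .nonterminal (.accepted c.1.1)) := by
  induction l generalizing b p with
  | nil => exact .refl
  | cons c l ih =>
    have h1 := produces_of_rule (Rule.spread (m := m) (enc := enc) (e := e) b c.1 c.2) p (m.cells l)
    have h2 := ih c.1.1 (p ++ [.nonterminal (.accepted b)])
    simp only [List.append_assoc, List.cons_append, List.nil_append, cells, List.map_cons] at h1 h2 ⊢
    exact .head h1 h2

theorem derives_letters (w : List B) (p : List (Symbol B (SweepNT β Γ m.State))) :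
    ReflTransGen (m.toGrammar enc e).Produces
      (p ++ w.map fun b => .nonterminal (.accepted (e b))) (p ++ w.map .terminal) := by
  induction w generalizing p with
  | nil => exact .refl
  | cons b w ih =>
    have h1 := produces_of_rule (Rule.letter (m := m) (enc := enc) (e := e) b) p
      (w.map fun b => .nonterminal (.accepted (e b)))
    have h2 := ih (p ++ [.terminal b])
    simp only [List.append_assoc, List.cons_append, List.nil_append, List.map_cons] at h1 h2 ⊢
    exact .head h1 h2

/-- The input is generated from its last letter to its first: `more` stays at the left end, and each
production inserts a cell directly behind it. -/
theorem derives_more (w : List B) (hw : w ≠ []) :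
    ReflTransGen (m.toGrammar enc e).Produces [.nonterminal .start]
      (.nonterminal .more :: m.cells ((flagged e false w).zip (w.map enc))) := by
  induction w with
  | nil => exact absurd rfl hw
  | cons b w ih =>
    cases w with
    | nil => exact .single (produces_of_rule (Rule.last (m := m) (enc := enc) (e := e) b) [] [])
    | cons b' w =>
      exact (ih (by simp)).tail
        (produces_of_rule (Rule.middle (m := m) (enc := enc) (e := e) b) [] _)

theorem derivable_start (w : List B) :
    Derivable m enc e w (.forth m.start [] (w.map enc)) := by
  intro p s hp hs hps
  obtain rfl : p = [] := by simpa using hp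
  have hs' : s = (flagged e true w).zip (w.map enc) := by
    rw [← hps, ← hs, List.nil_append, List.zip_map', List.map_id']
  refine ⟨?_, by simp⟩
  rintro c s' rfl
  cases w with
  | nil => simp at hs
  | cons b w =>
    simp only [flagged, List.map_cons, List.zip_cons_cons, List.cons.injEq] at hs'
    obtain ⟨rfl, rfl⟩ := hs'
    cases w with
    | nil =>
      exact .single (produces_of_rule (Rule.single (m := m) (enc := enc) (e := e) b) [] [])
    | cons b' w =>
      exact (derives_more (b' :: w) (by simp)).tail
        (produces_of_rule (Rule.first (m := m) (enc := enc) (e := e) b) [] _)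

/-- In the grammar the state always sits on a cell, so a head beyond the last cell or before the
first has no sentential form of its own. The productions `turn`, `next` and `done` therefore combine
the action on an end cell with the step that follows it, and `Derivable` describes such
configurations by what that following step leads to. -/
theorem Derivable.step {w : List B} {a a' : m.Cfg} (h : Derivable m enc e w a)
    (h' : m.Step a a') (hw : w ≠ []) (hl : a.HasLength w.length) : Derivable m enc e w a' := by
  cases h' with
  | @forth q x q' y l r h1 =>
    intro p s hp hs hps
    rw [List.map_eq_append_iff] at hp
    obtain ⟨p, u, rfl, hp, hu⟩ := hp
    obtain ⟨⟨⟨b, f₁, f₂⟩, y'⟩, u, rfl, rfl, hu⟩ := List.map_eq_cons_iff.1 hu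
    obtain rfl : u = [] := by simpa using hu
    have h2 := (h p (((b, f₁, f₂), x) :: s) hp (by simp [hs]) (by simpa using hps)).1 _ _ rfl
    -- The flag of the cell just read tells whether it is the last one, which decides between the
    -- productions `forth` and `turn`.
    have hf := flag_last (e := e) (f := true) (w := w) (p := p.map (·.1)) (o := (b, f₁, f₂))
      (q := s.map (·.1)) (by simpa using hps.symm)
    constructor
    · rintro c s rfl
      refine h2.tail ?_
      obtain rfl : f₂ = false := by simpa using hf
      have := produces_of_rule (Rule.forth (enc := enc) (e := e) b f₁ c.1 c.2 h1)
        (m.cells p) (m.cells s)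
      simpa [row, cells] using this
    · rintro c p' rfl hp'
      obtain ⟨rfl, rfl⟩ : p = p' ∧ ((b, f₁, f₂), y') = c := by simpa using hp'
      refine h2.tail ?_
      obtain rfl : f₂ = true := by simpa using hf
      have := produces_of_rule (Rule.turn (enc := enc) (e := e) b f₁ h1)
        (m.cells p) []
      simpa [row, cells] using this
  | @turn q l =>
    intro p s hp hs hps
    obtain rfl : s = [] := by simpa using hs
    refine ⟨fun c p' hp' => (h p [] hp rfl hps).2 c p' rfl hp', by simp, by simp⟩
  | @back q x q' y l r h1 =>
    intro p s hp hs hps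
    obtain ⟨⟨⟨b, f₁, f₂⟩, y'⟩, s, rfl, rfl, hs'⟩ := List.map_eq_cons_iff.1 hs
    have h2 := (h (p ++ [((b, f₁, f₂), x)]) s (by simp [hp]) hs' (by simpa using hps)).1 _ _ rfl
    have hf := flag_first (e := e) (w := w) (p := p.map (·.1)) (o := (b, f₁, f₂))
      (q := s.map (·.1)) (by simpa using hps.symm)
    refine ⟨?_, ?_, ?_⟩
    · rintro c p rfl
      refine h2.tail ?_
      obtain rfl : f₁ = false := by simpa using hf
      have := produces_of_rule (Rule.back (enc := enc) (e := e) b f₂ c.1 c.2 h1)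
        (m.cells p) (m.cells s)
      simpa [row, cells] using this
    · rintro c s' q'' rfl hs' hq
      obtain ⟨rfl, rfl⟩ : ((b, f₁, f₂), y') = c ∧ s = s' := by simpa using hs'
      refine h2.tail ?_
      obtain rfl : f₁ = true := by simpa using hf
      have := produces_of_rule (Rule.next (enc := enc) (e := e) b f₂ h1 hq)
        [] (m.cells s)
      simpa [row, cells] using this
    · rintro c s' rfl hs' hq
      obtain ⟨rfl, rfl⟩ : ((b, f₁, f₂), y') = c ∧ s = s' := by simpa using hs'
      refine h2.tail ?_
      obtain rfl : f₁ = true := by simpa using hf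
      have := produces_of_rule (Rule.done (enc := enc) (e := e) b f₂ h1 hq)
        [] (m.cells s)
      simpa [row, cells] using this
  | @next q q' l h1 =>
    intro p s hp hs hps
    obtain rfl : p = [] := by simpa using hp
    refine ⟨?_, by simp⟩
    rintro c s' rfl
    exact (h [] _ rfl hs hps).2.1 _ _ _ rfl rfl h1
  | @done q t l h1 =>
    rintro rfl
    -- The length invariant allows the input letters and flags to be attached to the final tape
    -- again. Since `w` is nonempty there is a first cell, from which acceptance spreads.
    obtain ⟨s, hs, hs'⟩ := exists_flagged_eq (e := e) (w := w) (l := l) (by simpa [Cfg.HasLength] using hl)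
    cases s with
    | nil => cases w <;> simp_all [flagged]
    | cons c s =>
      have h2 := (h [] _ rfl hs hs').2.2 _ _ rfl rfl h1
      refine (h2.trans (derives_accepted c.1.1 s [])).trans ?_
      have h3 := derives_letters (m := m) (enc := enc) (e := e) w []
      have h4 : w.map e = ((c :: s).map (·.1)).map (·.1) := by rw [hs', map_fst_flagged]
      rw [show (w.map fun b => (Symbol.nonterminal (.accepted (e b)) :
        Symbol B (SweepNT β Γ m.State))) = (w.map e).map fun b => .nonterminal (.accepted b) by
        simp, h4] at h3
      simpa [Function.comp_def] using h3

theorem mem_language_toGrammar {w : List B} (hw : w ≠ [])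
    (h : ∃ l, m.Exec m.start (w.map enc) true l) : w ∈ (m.toGrammar enc e).language := by
  rw [exec_iff_reaches] at h
  suffices H : ∀ a, ReflTransGen m.Step (.forth m.start [] (w.map enc)) a →
      Derivable m enc e w a ∧ a.HasLength w.length from (H _ h).1 rfl
  intro a h
  induction h with
  | refl => exact ⟨derivable_start w, by simp [Cfg.HasLength]⟩
  | tail _ h1 ih => exact ⟨ih.1.step h1 hw ih.2, h1.hasLength ih.2⟩

/-- The sentential forms of the grammar of a sweep machine. -/
inductive Form (m : SweepMachine Γ Bool) (enc : B → Γ) (e : B ≃ β) :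
    List (Symbol B (SweepNT β Γ m.State)) → Prop
  | start : Form m enc e [.nonterminal .start]
  | more (w : List B) (hw : w ≠ []) : Form m enc e
      (.nonterminal .more :: m.cells ((flagged e false w).zip (w.map enc)))
  | forth (w : List B) (l c r q) : (l ++ c :: r).map (·.1) = flagged e true w →
      ReflTransGen m.Step (.forth m.start [] (w.map enc))
        (.forth q (l.map (·.2)) (c.2 :: r.map (·.2))) → Form m enc e (m.row l c q true r)
  | back (w : List B) (l c r q) : (l ++ c :: r).map (·.1) = flagged e true w →
      ReflTransGen m.Step (.forth m.start [] (w.map enc))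
        (.back q (l.map (·.2) ++ [c.2]) (r.map (·.2))) → Form m enc e (m.row l c q false r)
  | accepted (w : List B) (v) :
      ReflTransGen m.Step (.forth m.start [] (w.map enc)) (.done true) →
      v.map (symbolLetter e) = w.map (fun b => some (e b)) → Form m enc e v

/-- Before acceptance a sentential form has exactly one key, so a production acts at a known place,
and the flags rule out those that belong to another position. Each remaining case is one or two
machine steps. -/
theorem Form.step {v v' : List (Symbol B (SweepNT β Γ m.State))} (h : Form m enc e v)
    (h' : (m.toGrammar enc e).Produces v v') : Form m enc e v' := by
  obtain ⟨⟨u, u'⟩, hr, p, s, hv, rfl⟩ := h'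
  simp only at hv ⊢
  change m.Rule enc e u u' at hr
  cases h with
  | start =>
    have key : ∀ {p K s}, [.nonterminal .start] = p ++ K :: s → IsKey K →
        p = [] ∧ K = Symbol.nonterminal (SweepNT.start (β := β) (Γ := Γ) (Q := m.State)) ∧
          s = ([] : List (Symbol B _)) :=
      fun h hK => List.eq_of_append_cons_eq (P := IsKey) (p' := []) (q' := []) h.symm hK
        (by simp) (by simp)
    cases hr with
    | single b =>
      obtain ⟨rfl, -, rfl⟩ := key (by simpa using hv) (by simp [IsKey])
      exact .forth [b] [] ((e b, true, true), enc b) [] m.start rfl .refl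
    | last b =>
      obtain ⟨rfl, -, rfl⟩ := key (by simpa using hv) (by simp [IsKey])
      exact .more [b] (by simp)
    -- In this production the key is the second symbol of the left-hand side, so the prefix before
    -- the key is `p` with one more symbol.
    | back b f o' x' h =>
      have := key (p := p ++ [_]) (by simpa using hv) (by simp [IsKey, cellSymbol])
      simp at this
    | middle | first | forth | turn | next | done | spread | letter =>
      have := key (p := p) (by simpa using hv) (by simp [IsKey, cellSymbol])
      simp [cellSymbol] at this
  | more w hw =>
    have key : ∀ {p K s}, .nonterminal .more :: m.cells ((flagged e false w).zip (w.map enc)) =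
        p ++ K :: s → IsKey K → p = [] ∧ K = Symbol.nonterminal .more ∧
          s = m.cells (B := B) ((flagged e false w).zip (w.map enc)) :=
      fun h hK => List.eq_of_append_cons_eq (P := IsKey) (p' := []) h.symm hK
        (by simp) not_isKey_cells
    obtain ⟨b', w, rfl⟩ := List.exists_cons_of_ne_nil hw
    cases hr with
    | middle b =>
      obtain ⟨rfl, -, rfl⟩ := key (by simpa using hv) (by simp [IsKey])
      exact .more (b :: b' :: w) (by simp)
    | first b =>
      obtain ⟨rfl, -, rfl⟩ := key (by simpa using hv) (by simp [IsKey])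
      refine .forth (b :: b' :: w) [] ((e b, true, false), enc b) _ m.start ?_ ?_
      · simp only [List.nil_append, List.map_cons]
        rw [List.map_fst_zip (by simp [length_flagged])]
        rfl
      · rw [List.map_snd_zip (by simp [length_flagged])]
        exact .refl
    | back b f o' x' h =>
      have := key (p := p ++ [_]) (by simpa using hv) (by simp [IsKey, cellSymbol])
      simp at this
    | single | last | forth | turn | next | done | spread | letter =>
      have := key (p := p) (by simpa using hv) (by simp [IsKey, cellSymbol])
      simp [cellSymbol] at this
  | forth w l c r q h1 h2 =>
    have hf := flag_last (e := e) (f := true) (w := w) (p := l.map (·.1)) (o := c.1)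
      (q := r.map (·.1)) (by simpa using h1.symm)
    cases hr with
    | @forth q₁ x q' y b f o' x' h =>
      obtain ⟨rfl, h3, h4⟩ := row_eq (p := p) (by simpa using hv) (by simp [IsKey, cellSymbol])
      obtain ⟨r, rfl, rfl⟩ := cells_eq_cons h4
      simp only [cellSymbol, Symbol.nonterminal.injEq, SweepNT.cell.injEq, Option.some.injEq,
        Prod.mk.injEq, and_true] at h3
      obtain ⟨hc, rfl, rfl⟩ := h3
      have := Form.forth (enc := enc) (e := e) w (l ++ [(c.1, y)]) (o', x') r q'
        (by simpa using h1) (h2.tail (by simpa using Step.forth (l := l.map (·.2)) h))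
      simpa [row, cells, hc] using this
    | @turn q₁ x q' y b f h =>
      obtain ⟨rfl, h3, rfl⟩ := row_eq (p := p) (by simpa using hv) (by simp [IsKey, cellSymbol])
      simp only [cellSymbol, Symbol.nonterminal.injEq, SweepNT.cell.injEq, Option.some.injEq,
        Prod.mk.injEq, and_true] at h3
      obtain ⟨hc, rfl, rfl⟩ := h3
      obtain rfl : r = [] := by simpa [← hc] using hf
      have := Form.back (enc := enc) (e := e) w l (c.1, y) [] q'
        (by simpa using h1) ((h2.tail (Step.forth (l := l.map (·.2)) h)).tail .turn)
      simpa [row, cells, hc] using this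
    | back b f o' x' h =>
      have := row_eq (p := p ++ [_]) (by simpa using hv) (by simp [IsKey, cellSymbol])
      simp [cellSymbol] at this
    | single | last | middle | first | next | done | spread | letter =>
      have := row_eq (p := p) (by simpa using hv) (by simp [IsKey, cellSymbol])
      simp [cellSymbol] at this
  | back w l c r q h1 h2 =>
    have hf := flag_first (e := e) (w := w) (p := l.map (·.1)) (o := c.1)
      (q := r.map (·.1)) (by simpa using h1.symm)
    cases hr with
    | @back q₁ x q' y b f o' x' h =>
      obtain ⟨h4, h3, rfl⟩ := row_eq (p := p ++ [_]) (by simpa using hv)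
        (by simp [IsKey, cellSymbol])
      obtain ⟨l, rfl, rfl⟩ := cells_eq_concat h4
      simp only [cellSymbol, Symbol.nonterminal.injEq, SweepNT.cell.injEq, Option.some.injEq,
        Prod.mk.injEq, and_true] at h3
      obtain ⟨hc, rfl, rfl⟩ := h3
      have := Form.back (enc := enc) (e := e) w l (o', x') ((c.1, y) :: r) q'
        (by simpa using h1) (h2.tail (by simpa using Step.back (l := l.map (·.2) ++ [x']) (r := r.map (·.2)) h))
      simpa [row, cells, hc] using this
    | @next q₁ x q' y q'' b f h h' =>
      obtain ⟨rfl, h3, rfl⟩ := row_eq (p := p) (by simpa using hv) (by simp [IsKey, cellSymbol])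
      simp only [cellSymbol, Symbol.nonterminal.injEq, SweepNT.cell.injEq, Option.some.injEq,
        Prod.mk.injEq, and_true] at h3
      obtain ⟨hc, rfl, rfl⟩ := h3
      obtain rfl : l = [] := by simpa [← hc] using hf
      have := Form.forth (enc := enc) (e := e) w [] (c.1, y) r q''
        (by simpa using h1) ((h2.tail (Step.back (r := r.map (·.2)) h)).tail (.next h'))
      simpa [row, cells, hc] using this
    | @done q₁ x q' y b f h h' =>
      obtain ⟨rfl, h3, rfl⟩ := row_eq (p := p) (by simpa using hv) (by simp [IsKey, cellSymbol])
      simp only [cellSymbol, Symbol.nonterminal.injEq, SweepNT.cell.injEq, Option.some.injEq,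
        Prod.mk.injEq, and_true] at h3
      obtain ⟨hc, rfl, rfl⟩ := h3
      obtain rfl : l = [] := by simpa [← hc] using hf
      refine .accepted w _ ((h2.tail (Step.back (r := r.map (·.2)) h)).tail (.done h')) ?_
      have h5 : w.map (fun b => some (e b)) = ((c :: r).map (·.1)).map fun o => some o.1 := by
        have h6 := congrArg (List.map some) (map_fst_flagged (e := e) true w)
        rw [← List.nil_append (c :: r), h1]
        simpa [Function.comp_def] using h6.symm
      rw [h5]
      simp [cells, symbolLetter, cellSymbol, ← hc]
    | single | last | middle | first | forth | turn | spread | letter =>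
      have := row_eq (p := p) (by simpa using hv) (by simp [IsKey, cellSymbol])
      simp [cellSymbol] at this
  -- After acceptance productions may apply in any order; only the letters carried by the symbols
  -- are tracked.
  | accepted w v h1 h2 =>
    subst hv
    refine .accepted w _ h1 ?_
    rw [← h2]
    simp only [List.map_append]
    rw [hr.symbolLetter_eq]
    intro x hx hx'
    have : none ∈ w.map (fun b => some (e b)) := by
      rw [← h2, ← hx']
      exact List.mem_map_of_mem (by simp [hx])
    simp at this

/-- A terminal word contains no key, which excludes every sentential form except those after
acceptance. Its letters then identify it with the word that the machine accepted. -/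
theorem exec_of_mem_language_toGrammar {w : List B} (h : w ∈ (m.toGrammar enc e).language) :
    ∃ l, m.Exec m.start (w.map enc) true l := by
  rw [exec_iff_reaches]
  have H : ∀ v, ReflTransGen (m.toGrammar enc e).Produces [.nonterminal .start] v →
      Form m enc e v := by
    intro v h
    induction h with
    | refl => exact .start
    | tail _ h1 ih => exact ih.step h1
  have key : ∀ v, Form m enc e v → v = w.map .terminal →
      ReflTransGen m.Step (.forth m.start [] (w.map enc)) (.done true) := by
    rintro v hv rfl
    generalize hv' : w.map Symbol.terminal = v at hv
    have hk : ∀ x ∈ v, ¬ IsKey x := by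
      rw [← hv']; simp [IsKey]
    cases hv with
    | start => simp [IsKey] at hk
    | more => simp [IsKey] at hk
    | forth w l c r q => exact absurd (by simp [IsKey, cellSymbol]) (hk (m.cellSymbol c.1 c.2 (some (q, true))) (by simp [row]))
    | back w l c r q => exact absurd (by simp [IsKey, cellSymbol]) (hk (m.cellSymbol c.1 c.2 (some (q, false))) (by simp [row]))
    | accepted w' v h1 h2 =>
      subst hv'
      have : w = w' := by
        have h3 : w.map (fun b => some (e b)) = w'.map fun b => some (e b) := by
          rw [← h2]; simp [symbolLetter]
        exact List.map_injective_iff.2 (fun a b h => by simpa using h) h3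
      rwa [this]
  exact key _ (H _ h) rfl

end

end SweepMachine

/-! ### From programs on blocks to automata and grammars -/

namespace TapeProgram

variable {Γ ρ : Type*} {d : Prop}

theorem Implementable.length_eq {R : TapeProgram Γ ρ} (h : Implementable d R) {l l' : List Γ} {r : ρ}
    (h' : R l r l') : l'.length = l.length := by
  obtain ⟨m, -, hR⟩ := h
  replace h' := (hR _ _ _).2 h'
  generalize m.start = q at h'
  induction h' with
  | exit h1 => exact h1.length_eq
  | step h1 _ _ ih => rw [ih, h1.length_eq]

/-- A program on blocks of cells as a sweep machine with cells in a numbered alphabet. -/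
theorem Implementable.exists_sweepMachine [Finite Γ] {B : Type*} {c : ℕ} (hc : 0 < c)
    {R : TapeProgram Γ Bool} (h : Implementable d R) (enc : B → Block Γ c) :
    ∃ (k : ℕ) (m : SweepMachine (Fin k) Bool) (f : B → Fin k), (d → m.Deterministic) ∧
      ∀ (w : List B) (t : Bool), (∃ l, m.Exec m.start (w.map f) t l) ↔ ∃ l, R (w.flatMap fun b => (enc b).1) t l := by
  have : Finite (Block Γ c) := (List.finite_length_eq Γ c).to_subtype
  obtain ⟨k, ⟨e⟩⟩ := Finite.exists_equiv_fin (Block Γ c)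
  -- A trivial second track turns `onTrack` into a mere renaming of the alphabet.
  let e' : Fin k ≃ Block Γ c × Unit := e.symm.trans (Equiv.prodPUnit _).symm
  obtain ⟨m, hm, hR⟩ := (h.packed hc).onTrack e'
  refine ⟨k, m, fun b => e (enc b), hm, fun w t => ?_⟩
  simp only [hR, TapeProgram.onTrack]
  constructor
  · rintro ⟨l, h1, -⟩
    refine ⟨(l.map fun x => (e' x).1).flatMap (·.1), ?_⟩
    convert h1 using 1
    simp only [List.flatMap_map]
    simp [e']
  · rintro ⟨l, h1⟩
    have hl : l.length = w.length * c := by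
      rw [h.length_eq h1]
      have := length_flatMap_block (w.map enc)
      rw [List.flatMap_map] at this
      simpa using this
    obtain ⟨L, rfl⟩ := exists_flatMap_eq hl
    have hL : L.length = w.length := by
      rw [length_flatMap_block] at hl
      exact Nat.eq_of_mul_eq_mul_right hc hl
    refine ⟨L.map e, ?_, ?_⟩
    · convert h1 using 1
      · simp only [List.flatMap_map]
        simp [e']
      · simp [e', Function.comp_def]
    · apply List.ext_getElem <;> simp [hL]

/-- The inputs on which a program on blocks of cells returns `true` are the language of a linear
bounded automaton. -/
theorem Implementable.exists_LBA [Finite Γ] {B : Type*} {c : ℕ} (hc : 0 < c)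
    {R : TapeProgram Γ Bool} (h : Implementable d R) (enc : B → Block Γ c) :
    ∃ M : LBA B, (d → M.Deterministic) ∧
      ((∀ w : List B, ∃ t l, R (w.flatMap fun b => (enc b).1) t l) → M.Halts) ∧
      M.language = {w | ∃ l, R (w.flatMap fun b => (enc b).1) true l} := by
  obtain ⟨k, m, f, hm, hR⟩ := h.exists_sweepMachine hc enc
  refine ⟨m.toLBA f, fun hd => m.toLBA_deterministic f (hm hd), fun h => ?_, ?_⟩
  · refine SweepMachine.toLBA_halts fun w => ?_
    obtain ⟨t, ht⟩ := h w
    exact ⟨t, (hR w t).2 ht⟩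
  · rw [SweepMachine.language_toLBA]
    ext w
    exact hR w true

/-- The nonempty inputs on which a program on blocks of cells returns `true` form a
context-sensitive language. -/
theorem Implementable.isContextSensitive [Finite Γ] {B : Type*} [Finite B] {c : ℕ} (hc : 0 < c)
    {R : TapeProgram Γ Bool} (h : Implementable d R) (enc : B → Block Γ c) :
    (Language.deleteEmpty
      {w | ∃ l, R (w.flatMap fun b => (enc b).1) true l}).IsContextSensitive := by
  obtain ⟨k, m, f, hm, hR⟩ := h.exists_sweepMachine hc enc
  obtain ⟨n, ⟨e⟩⟩ := Finite.exists_equiv_fin B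
  refine ⟨m.toGrammar f e, ?_⟩
  ext w
  constructor
  · intro hw
    refine ⟨(hR w true).1 (SweepMachine.exec_of_mem_language_toGrammar hw), ?_⟩
    rintro rfl
    -- Left-hand sides are nonempty and productions do not shorten, so no sentential form is empty.
    have H : ∀ v, Relation.ReflTransGen (m.toGrammar f e).Produces
        [.nonterminal (m.toGrammar f e).initial] v → v ≠ [] := by
      intro v hv
      induction hv with
      | refl => simp
      | tail _ h1 ih =>
        obtain ⟨r, hr, p, q, rfl, rfl⟩ := h1
        have h2 := (m.toGrammar f e).length_le r hr
        have h3 := List.length_pos_iff.2 ((m.toGrammar f e).lhs_ne_nil r hr)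
        intro h
        have h4 := congrArg List.length h
        simp only [List.length_append, List.length_nil] at h4
        omega
    exact H _ hw rfl
  · rintro ⟨hw, hne⟩
    exact SweepMachine.mem_language_toGrammar hne ((hR w true).2 hw)

/-! ### Elementary programs -/

/-- The pass of a deterministic transducer. -/
def mealy {σ : Type*} (δ : σ → Γ → σ × Γ) : σ → List Γ → σ × List Γ
  | q, [] => (q, [])
  | q, x :: l => ((mealy δ (δ q x).1 l).1, (δ q x).2 :: (mealy δ (δ q x).1 l).2)

theorem mealy_append {σ : Type*} (δ : σ → Γ → σ × Γ) (q : σ) (l₁ l₂ : List Γ) :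
    mealy δ q (l₁ ++ l₂) = ((mealy δ (mealy δ q l₁).1 l₂).1,
      (mealy δ q l₁).2 ++ (mealy δ (mealy δ q l₁).1 l₂).2) := by
  induction l₁ generalizing q with
  | nil => rfl
  | cons x l ih => simp [mealy, ih]

theorem length_mealy {σ : Type*} (δ : σ → Γ → σ × Γ) (q : σ) (l : List Γ) :
    (mealy δ q l).2.length = l.length := by
  induction l generalizing q with
  | nil => rfl
  | cons x l ih => simp [mealy, ih]

theorem sweep_singleton_iff {σ : Type*} (δ : σ → Γ → σ × Γ) {q q' : σ} {l l' : List Γ} :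
    Sweep (fun q x => {δ q x}) q l q' l' ↔ mealy δ q l = (q', l') := by
  induction l generalizing q l' with
  | nil => simp [mealy, eq_comm]
  | cons x l ih =>
    simp only [Sweep.cons_iff, ih, mealy, Set.mem_singleton_iff, Prod.mk.injEq]
    constructor
    · rintro ⟨q₁, y, l₁, h1, h2, rfl⟩
      rw [← h1]
      simp [h2]
    · rintro ⟨h1, rfl⟩
      exact ⟨_, _, _, rfl, by simp [← h1], rfl⟩

theorem sweep_id_iff {σ : Type*} {q q' : σ} {l l' : List Γ} :
    Sweep (fun q x => {(q, x)}) q l q' l' ↔ q = q' ∧ l = l' := by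
  rw [sweep_singleton_iff (fun q x => (q, x)), ← Prod.mk.injEq]
  have : mealy (fun (q : σ) (x : Γ) => (q, x)) q l = (q, l) := by
    induction l with
    | nil => rfl
    | cons x l ih => simp [mealy, ih]
  rw [this]

variable {σ : Type*} [Finite σ]

theorem implementable_sweep (act : σ → Γ → Set (σ × Γ)) (q : σ)
    (hd : d → ∀ q x, (act q x).Subsingleton) : Implementable d (Sweep act q) := by
  convert implementable_roundTrip (d := d) act (fun q x => {(q, x)}) q hd
    (fun _ _ _ => Set.subsingleton_singleton) using 1
  ext l r l'
  simp [RoundTrip, sweep_id_iff]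

theorem implementable_mealy (δ : σ → Γ → σ × Γ) (q : σ) :
    Implementable d fun l r l' => mealy δ q l = (r, l') := by
  convert implementable_sweep (d := d) (fun q x => {δ q x}) q
    (fun _ _ _ => Set.subsingleton_singleton) using 1
  ext l r l'
  exact (sweep_singleton_iff δ).symm

theorem implementable_mealy_reverse (δ : σ → Γ → σ × Γ) (q : σ) :
    Implementable d fun l r l' => mealy δ q l.reverse = (r, l'.reverse) := by
  convert implementable_roundTrip (d := d) (fun q x => {(q, x)}) (fun q x => {δ q x}) q
    (fun _ _ _ => Set.subsingleton_singleton) (fun _ _ _ => Set.subsingleton_singleton) using 1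
  ext l r l'
  simp [RoundTrip, sweep_id_iff, sweep_singleton_iff]

/-- Apply a function to every cell. -/
def mapCells (f : Γ → Γ) : TapeProgram Γ Unit := fun l _ l' => l' = l.map f

theorem implementable_mapCells (f : Γ → Γ) : Implementable d (mapCells f) := by
  convert implementable_mealy (d := d) (fun (_ : Unit) x => ((), f x)) () using 1
  ext l r l'
  have : mealy (fun (_ : Unit) x => ((), f x)) () l = ((), l.map f) := by
    induction l with
    | nil => rfl
    | cons x l ih => simp [mealy, ih]
  simp [this, mapCells, eq_comm]

/-- Return the final state of a finite automaton, without change of the tape. -/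
def scan (step : σ → Γ → σ) (q : σ) : TapeProgram Γ σ := fun l r l' => r = l.foldl step q ∧ l' = l

theorem implementable_scan (step : σ → Γ → σ) (q : σ) : Implementable d (scan step q) := by
  convert implementable_mealy (d := d) (fun q x => (step q x, x)) q using 1
  ext l r l'
  have : mealy (fun q x => (step q x, x)) q l = (l.foldl step q, l) := by
    induction l generalizing q with
    | nil => rfl
    | cons x l ih => simp [mealy, ih]
  simp [this, scan, eq_comm]

/-- Return a value. -/
def return' (r : ρ) : TapeProgram Γ ρ := fun l r' l' => r' = r ∧ l' = l

/-- One state suffices for any `ρ`, finite or not, because the value comes from `next`. -/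
theorem implementable_return (r : ρ) : Implementable d (return' (Γ := Γ) r) := by
  let m : SweepMachine Γ ρ :=
    { State := Unit
      finite_State := inferInstance
      start := ()
      act := fun q x => {(q, x)}
      back := fun q x => {(q, x)}
      next := fun _ => .inr r }
  have hs : ∀ {q q' l l'}, RoundTrip m.act m.back q l q' l' ↔ l' = l := by
    simp [m, RoundTrip, sweep_id_iff, eq_comm]
  refine ⟨m, fun _ => ⟨fun _ _ => Set.subsingleton_singleton, fun _ _ =>
    Set.subsingleton_singleton⟩, fun l r' l' => ⟨fun h => ?_, ?_⟩⟩
  · cases h with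
    | exit h1 h2 => exact ⟨(Sum.inr.inj h2).symm, hs.1 h1⟩
    | step _ h => simp [m] at h
  · rintro ⟨rfl, rfl⟩
    exact .exit (q' := ()) (hs.2 rfl) rfl

/-- Partial correctness by a loop invariant; it says something about every terminating run. -/
theorem loop_induction {R : TapeProgram Γ (Option ρ)} (I : List Γ → Prop)
    (post : ρ → List Γ → Prop) (hexit : ∀ l r l', I l → R l (some r) l' → post r l')
    (hagain : ∀ l l', I l → R l none l' → I l') {l l' : List Γ} {r : ρ} (hl : I l)
    (h : R.loop l r l') : post r l' := by
  induction h with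
  | exit h => exact hexit _ _ _ hl h
  | again h _ ih => exact ih (hagain _ _ hl h)

/-- Total correctness: the variant `μ` bounds the number of repetitions. For nondeterministic bodies
it produces one good run. -/
theorem exists_loop {R : TapeProgram Γ (Option ρ)} (I : List Γ → Prop) (post : ρ → List Γ → Prop)
    (μ : List Γ → ℕ) (h : ∀ l, I l → (∃ r l', R l (some r) l' ∧ post r l') ∨
      ∃ l', R l none l' ∧ I l' ∧ μ l' < μ l) {l : List Γ} (hl : I l) :
    ∃ r l', R.loop l r l' ∧ post r l' := by
  induction hn : μ l using Nat.strong_induction_on generalizing l with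
  | _ n ih =>
    rcases h l hl with ⟨r, l', h1, h2⟩ | ⟨l', h1, h2, h3⟩
    · exact ⟨r, l', .exit h1, h2⟩
    · obtain ⟨r, l'', h4, h5⟩ := ih _ (hn ▸ h3) h2 rfl
      exact ⟨r, l'', .again h1 h4, h5⟩

end TapeProgram

theorem List.eq_of_map_fst_of_map_snd {α β : Type*} {l l' : List (α × β)}
    (h₁ : l.map Prod.fst = l'.map Prod.fst) (h₂ : l.map Prod.snd = l'.map Prod.snd) : l = l' := by
  induction l generalizing l' with
  | nil => exact (List.map_eq_nil_iff.1 h₁.symm).symm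
  | cons x l ih =>
    cases l' with
    | nil => simp at h₁
    | cons y l' =>
      simp only [List.map_cons, List.cons.injEq] at h₁ h₂
      rw [ih h₁.2 h₂.2, Prod.ext h₁.1 h₂.1]

/-! ### Counters -/

section Counter

variable {Y : Type*} {k : ℕ} (η : Y ≃ Fin k)

/-- The number represented by a list of digits, least significant digit first. -/
def counterValue : List Y → ℕ
  | [] => 0
  | y :: l => η y + k * counterValue l

theorem counterValue_lt (l : List Y) : counterValue η l < k ^ l.length := by
  induction l with
  | nil => simp [counterValue]
  | cons y l ih =>
    have h1 := (η y).2
    have h2 : counterValue η l + 1 ≤ k ^ l.length := ih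
    have := Nat.mul_le_mul_left k h2
    simp only [counterValue, List.length_cons, pow_succ]
    rw [mul_comm (k ^ _)]
    linarith

theorem counterValue_injective {l l' : List Y} (hl : l.length = l'.length)
    (h : counterValue η l = counterValue η l') : l = l' := by
  induction l generalizing l' with
  | nil => simpa [eq_comm] using hl
  | cons y l ih =>
    cases l' with
    | nil => simp at hl
    | cons y' l' =>
      simp only [counterValue] at h
      have hk : 0 < k := (η y).pos
      have h1 := congrArg (· % k) h
      have h2 := congrArg (· / k) h
      simp only [Nat.add_mul_mod_self_left, Nat.add_mul_div_left _ _ hk,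
        Nat.mod_eq_of_lt (η y).2, Nat.mod_eq_of_lt (η y').2, Nat.div_eq_of_lt (η y).2,
        Nat.div_eq_of_lt (η y').2, zero_add] at h1 h2
      rw [ih (by simpa using hl) h2, η.injective (Fin.ext h1)]

/-- One digit of the addition of one; the state is the carry. -/
def incrementDigit (c : Bool) (y : Y) : Bool × Y :=
  if c then
    if h : (η y : ℕ) + 1 < k then (false, η.symm ⟨η y + 1, h⟩)
    else (true, η.symm ⟨0, (η y).pos⟩)
  else (false, y)

/-- Addition with carry, where a carry out of the last digit has weight `k ^ l.length`. A carry
therefore means overflow, and otherwise the value grows by exactly one. -/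
theorem counterValue_increment (l : List Y) (c : Bool) :
    counterValue η (TapeProgram.mealy (incrementDigit η) c l).2 +
      (if (TapeProgram.mealy (incrementDigit η) c l).1 then k ^ l.length else 0) =
      counterValue η l + if c then 1 else 0 := by
  induction l generalizing c with
  | nil => simp [TapeProgram.mealy]
  | cons y l ih =>
    have ih := ih (incrementDigit η c y).1
    simp only [TapeProgram.mealy, counterValue, List.length_cons, pow_succ]
    have : ∀ a b x y z: ℕ, a + (if b = 1 then x else 0) = y + z →
      k * a + (if b = 1 then x * k else 0) = k * y + k * z := by
      intro a b x y z h
      rw [← mul_add, ← h, mul_add, mul_ite, mul_comm k x, mul_zero]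
    generalize hd : incrementDigit η c y = D at *
    obtain ⟨c', y'⟩ := D
    generalize TapeProgram.mealy (incrementDigit η) c' l = D at *
    obtain ⟨c'', l''⟩ := D
    simp only at ih ⊢
    have key : (η y' : ℕ) + k * (if c' then 1 else 0) = η y + if c then 1 else 0 := by
      unfold incrementDigit at hd
      split_ifs at hd with h1 h2
      · simp only [Prod.mk.injEq] at hd
        obtain ⟨rfl, rfl⟩ := hd
        simp [h1]
      · simp only [Prod.mk.injEq] at hd
        obtain ⟨rfl, rfl⟩ := hd
        have := (η y).2
        simp [h1]
        omega
      · simp only [Prod.mk.injEq] at hd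
        obtain ⟨rfl, rfl⟩ := hd
        simp [h1]
    have h2 : k * (counterValue η l'' + if c'' then k ^ l.length else 0) =
      k * (counterValue η l + if c' then 1 else 0) := by rw [ih]
    have h3 : k * (if c'' = true then k ^ l.length else 0) =
        if c'' = true then k ^ l.length * k else 0 := by
      split_ifs <;> ring
    rw [mul_add, mul_add, h3] at h2
    linarith

theorem counterValue_map_zero (hk : 0 < k) (l : List Γ) :
    counterValue η (l.map fun _ => η.symm ⟨0, hk⟩) = 0 := by
  induction l with
  | nil => rfl
  | cons x l ih => rw [List.map_cons, counterValue, ih]; simp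

end Counter

/-! ### Testable properties of a track -/

namespace TapeProgram

variable {T Z ρ : Type*} {d : Prop}

/-- There is a program that tests whether the contents of the first track have the property `P`,
without change of this track. The second track is work space with arbitrary initial contents. -/
def Testable (d : Prop) (Z : Type*) (P : List T → Prop) : Prop :=
  ∃ R : TapeProgram (T × Z) Bool, Implementable d R ∧
    (∀ l b l', R l b l' → l'.map Prod.fst = l.map Prod.fst ∧ (b = true → P (l.map Prod.fst))) ∧
    (∀ l, P (l.map Prod.fst) → ∃ l', R l true l') ∧ (d → ∀ l, ∃ b l', R l b l')

theorem testable_foldl {σ : Type*} [Finite σ] (step : σ → T → σ) (q : σ) (acc : σ → Prop) :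
    Testable d Z fun l => acc (l.foldl step q) := by
  classical
  refine ⟨bind (scan (fun q x => step q x.1) q) fun s => return' (decide (acc s)),
    (implementable_scan _ _).bind fun s => implementable_return _, ?_, ?_, ?_⟩
  · rintro l b l' ⟨s, l₁, ⟨rfl, rfl⟩, rfl, rfl⟩
    simp [List.foldl_map]
  · intro l h
    refine ⟨l, _, l, ⟨rfl, rfl⟩, ?_, rfl⟩
    simpa [List.foldl_map, eq_comm] using h
  · exact fun _ l => ⟨_, l, _, l, ⟨rfl, rfl⟩, rfl, rfl⟩

theorem Testable.and {P Q : List T → Prop} (hP : Testable d Z P) (hQ : Testable d Z Q) :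
    Testable d Z fun l => P l ∧ Q l := by
  obtain ⟨R, hR, h1, h2, h3⟩ := hP
  obtain ⟨S, hS, h4, h5, h6⟩ := hQ
  refine ⟨bind R fun b => if b then S else return' false, hR.bind fun b => ?_, ?_, ?_, ?_⟩
  · cases b
    · exact implementable_return _
    · exact hS
  · rintro l b l' ⟨c, l₁, h7, h8⟩
    obtain ⟨h9, h10⟩ := h1 _ _ _ h7
    cases c
    · obtain ⟨rfl, rfl⟩ := h8
      simp [h9]
    · obtain ⟨h11, h12⟩ := h4 _ _ _ h8
      exact ⟨h11.trans h9, fun hb => ⟨h10 rfl, h9 ▸ h12 hb⟩⟩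
  · rintro l ⟨hl, hl'⟩
    obtain ⟨l₁, h7⟩ := h2 l hl
    obtain ⟨l₂, h8⟩ := h5 l₁ (by rwa [(h1 _ _ _ h7).1])
    exact ⟨l₂, _, _, h7, h8⟩
  · intro hd l
    obtain ⟨b, l₁, h7⟩ := h3 hd l
    cases b
    · exact ⟨_, _, _, _, h7, rfl, rfl⟩
    · obtain ⟨c, l₂, h8⟩ := h6 hd l₁
      exact ⟨c, l₂, _, _, h7, h8⟩

/-- A program that works on a copy of the first track. -/
theorem testable_of_implementable {Z₁ Z₂ : Type*} (e : Z ≃ Z₁ × Z₂) (copy : T → Z₁)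
    {R : TapeProgram Z₁ Bool} (hR : Implementable d R)
    (htotal : d → ∀ l : List T, ∃ b l', R (l.map copy) b l') :
    Testable d Z fun l => ∃ l', R (l.map copy) true l' := by
  -- The original track is put on the idle side of the equivalence, so running `R` on the copy
  -- leaves it unchanged.
  let e' : T × Z ≃ Z₁ × T × Z₂ :=
    { toFun := fun x => ((e x.2).1, x.1, (e x.2).2)
      invFun := fun y => (y.2.1, e.symm (y.1, y.2.2))
      left_inv := fun x => by simp
      right_inv := fun y => by simp }
  have key : ∀ {l b l'}, bind (mapCells fun x : T × Z => (x.1, e.symm (copy x.1, (e x.2).2)))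
      (fun _ => onTrack e' R) l b l' → R ((l.map Prod.fst).map copy) b
        (l'.map fun x => (e' x).1) ∧ l'.map Prod.fst = l.map Prod.fst := by
    rintro l b l' ⟨_, l₁, rfl, h1, h2⟩
    constructor
    · simpa [e', Function.comp_def] using h1
    · have h3 := congrArg (List.map Prod.fst) h2
      simpa [e', Function.comp_def] using h3
  have key' : ∀ {l b m}, R (List.map copy (List.map Prod.fst l)) b m → ∃ l',
      bind (mapCells fun x : T × Z => (x.1, e.symm (copy x.1, (e x.2).2)))
      (fun _ => onTrack e' R) l b l' := by
    intro l b m h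
    have hm := hR.length_eq h
    simp only [List.length_map] at hm
    refine ⟨List.zipWith (fun a b => e'.symm (a, b)) m (l.map fun x => (x.1, (e x.2).2)),
      (), _, rfl, ?_, ?_⟩
    · rw [Sweep.map_fst_zipWith e' (by simpa using hm)]
      simpa [e', Function.comp_def] using h
    · rw [Sweep.map_snd_zipWith e' (by simpa using hm)]
      simp [e']
  refine ⟨bind (mapCells fun x => (x.1, e.symm (copy x.1, (e x.2).2))) fun _ => R.onTrack e',
    (implementable_mapCells _).bind fun _ => hR.onTrack e', ?_, ?_, ?_⟩
  · intro l b l' h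
    obtain ⟨h1, h2⟩ := key h
    refine ⟨h2, ?_⟩
    rintro rfl
    exact ⟨_, h1⟩
  · rintro l ⟨m, hm⟩
    exact key' hm
  · intro hd l
    obtain ⟨b, m, hm⟩ := htotal hd (l.map Prod.fst)
    obtain ⟨l', hl'⟩ := key' hm
    exact ⟨b, l', hl'⟩

/-! ### Exhaustive search -/

/-- Increment the counter on the first track; the value returned tells whether there is an
overflow. -/
def increment {Γ Y X : Type*} {k : ℕ} (η : Y ≃ Fin k) (e : Γ ≃ Y × X) : TapeProgram Γ Bool :=
  onTrack e fun l r l' => mealy (incrementDigit η) true l = (r, l')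

section

variable {Γ Y X : Type*} {k : ℕ} {η : Y ≃ Fin k} {e : Γ ≃ Y × X}

theorem implementable_increment : Implementable d (increment η e) :=
  (implementable_mealy _ _).onTrack e

theorem increment_spec {l l' : List Γ} {b : Bool} (h : increment η e l b l') :
    (l'.map fun x => (e x).2) = l.map (fun x => (e x).2) ∧
      counterValue η (l'.map fun x => (e x).1) + (if b then k ^ l.length else 0) =
        counterValue η (l.map fun x => (e x).1) + 1 := by
  refine ⟨h.2, ?_⟩
  have := counterValue_increment η (l.map fun x => (e x).1) true
  rw [h.1] at this
  simpa using this

theorem exists_increment (l : List Γ) : ∃ b l', increment η e l b l' := by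
  set r := mealy (incrementDigit η) true (l.map fun x => (e x).1) with hr
  have hlen : r.2.length = (l.map fun x => (e x).2).length := by
    rw [hr, length_mealy]; simp
  refine ⟨r.1, List.zipWith (fun a b => e.symm (a, b)) r.2 (l.map fun x => (e x).2), ?_, ?_⟩
  · rw [Sweep.map_fst_zipWith e hlen]
  · rw [Sweep.map_snd_zipWith e hlen]

/-- Repeat `R` until it returns a value, but stop when the counter overflows. -/
def clockedLoop (η : Y ≃ Fin k) (e : Γ ≃ Y × X) (R : TapeProgram Γ (Option ρ)) :
    TapeProgram Γ (Option ρ) :=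
  loop <| bind R fun o => match o with
    | some r => return' (some (some r))
    | none => bind (increment η e) fun b => return' (if b then some none else none)

theorem Implementable.clockedLoop [Finite ρ] {R : TapeProgram Γ (Option ρ)}
    (hR : Implementable d R) : Implementable d (clockedLoop η e R) := by
  refine (hR.bind fun o => ?_).loop
  cases o
  · exact implementable_increment.bind fun b => implementable_return _
  · exact implementable_return _

theorem clockedLoop_induction {R : TapeProgram Γ (Option ρ)} (I : List Γ → Prop)
    (post : ρ → List Γ → Prop) (hexit : ∀ l r l', I l → R l (some r) l' → post r l')
    (hagain : ∀ l l' b l'', I l → R l none l' → increment η e l' b l'' → I l'')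
    {l l' : List Γ} {o : Option ρ} (hl : I l) (h : clockedLoop η e R l o l') :
    (∀ r, o = some r → post r l') ∧ (o = none → I l') := by
  refine loop_induction I (fun o l' => (∀ r, o = some r → post r l') ∧ (o = none → I l'))
    ?_ ?_ hl h
  · rintro l o l' hl ⟨r, l₁, h1, h2⟩
    cases r with
    | some r =>
      obtain ⟨h3, rfl⟩ := h2
      obtain rfl := Option.some.inj h3
      exact ⟨fun r' hr => Option.some.inj hr ▸ hexit _ _ _ hl h1, by simp⟩
    | none =>
      obtain ⟨b, l₂, h3, h4, rfl⟩ := h2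
      obtain rfl : o = none := by cases b <;> simp_all
      exact ⟨by simp, fun _ => hagain _ _ _ _ hl h1 h3⟩
  · rintro l l' hl ⟨r, l₁, h1, h2⟩
    cases r with
    | some r => exact absurd h2.1 (by simp)
    | none =>
      obtain ⟨b, l₂, h3, h4, rfl⟩ := h2
      exact hagain _ _ _ _ hl h1 h3

/-- If the counter stays small enough until the loop ends, the overflow does not occur. -/
theorem exists_clockedLoop {R : TapeProgram Γ (Option ρ)} (I : List Γ → Prop)
    (post : Option ρ → List Γ → Prop)
    (h : ∀ l, I l → (∃ r l', R l (some r) l' ∧ post (some r) l') ∨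
      ∃ l', R l none l' ∧ l'.length = l.length ∧
        (l'.map fun x => (e x).1) = (l.map fun x => (e x).1) ∧
        ∀ b l'', increment η e l' b l'' → if b then post none l'' else I l'')
    {l : List Γ} (hl : I l) : ∃ o l', clockedLoop η e R l o l' ∧ post o l' := by
  have key : ∃ o l', clockedLoop η e R l o l' ∧ post o l' := by
    -- The body keeps the counter, so each repetition without overflow brings it one step closer to
    -- its maximum. The variant is the remaining distance.
    refine exists_loop (fun m => I m ∧ m.length = l.length) post
      (fun m => k ^ l.length - counterValue η (m.map fun x => (e x).1)) ?_ ⟨hl, rfl⟩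
    rintro m ⟨hm, hlen⟩
    rcases h m hm with ⟨r, l', h1, h2⟩ | ⟨l', h1, h2, h3, h4⟩
    · exact .inl ⟨some r, l', ⟨_, _, h1, rfl, rfl⟩, h2⟩
    · obtain ⟨b, l'', h5⟩ := exists_increment (η := η) (e := e) l'
      have h6 := h4 b l'' h5
      have h7 := (increment_spec h5).2
      have h8 : l''.length = l'.length := by
        simpa using congrArg List.length (increment_spec h5).1
      cases b
      · refine .inr ⟨l'', ⟨_, _, h1, _, _, h5, rfl, rfl⟩, ⟨h6, by rw [h8, h2, hlen]⟩, ?_⟩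
        have h9 := counterValue_lt η (m.map fun x => (e x).1)
        rw [List.length_map, hlen] at h9
        rw [h3] at h7
        simp only [Bool.false_eq_true, if_false, add_zero] at h7
        omega
      · exact .inl ⟨none, l'', ⟨_, _, h1, _, _, h5, rfl, rfl⟩, h6⟩
  exact key

end

/-- There is a program that looks for contents of the first track that have the property `P`
together with the given contents of the second track. -/
theorem Testable.search {Y X : Type*} [Finite Y] [Nonempty Y] {P : List (Y × X) → Prop}
    (hP : Testable d Z P) : ∃ R : TapeProgram ((Y × X) × Z) Bool, Implementable d R ∧
      (∀ l b l', R l b l' → l'.map (·.1.2) = l.map (·.1.2) ∧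
        (b = true → P (l'.map Prod.fst))) ∧
      (∀ l, (∃ t : List (Y × X), t.map Prod.snd = l.map (·.1.2) ∧ P t) → ∃ l', R l true l') ∧
      (d → ∀ l, ∃ b l', R l b l') := by
  obtain ⟨C, hC, h1, h2, h3⟩ := hP
  -- If determinism is required, all contents of the first track are tried, with that track itself
  -- as the counter; otherwise they are guessed.
  by_cases hd : d
  · replace h3 := h3 hd
    obtain ⟨k, ⟨η⟩⟩ := Finite.exists_equiv_fin Y
    have hk : 0 < k := (η (Classical.arbitrary Y)).pos
    let e : (Y × X) × Z ≃ Y × X × Z := Equiv.prodAssoc Y X Z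
    let body : TapeProgram ((Y × X) × Z) (Option Unit) :=
      bind C fun b => return' (if b then some () else none)
    have hbody : Implementable d body := hC.bind fun b => implementable_return _
    let zero : TapeProgram ((Y × X) × Z) Unit := mapCells fun x => ((η.symm ⟨0, hk⟩, x.1.2), x.2)
    refine ⟨bind zero fun _ => bind (clockedLoop η e body) fun o => return' o.isSome,
      (implementable_mapCells _).bind fun _ => hbody.clockedLoop.bind fun o =>
      implementable_return _, ?_, ?_, ?_⟩
    · rintro l b l' ⟨_, l₁, hz, o, l₂, h4, rfl, rfl⟩
      have H := clockedLoop_induction (fun m => m.map (·.1.2) = l.map (·.1.2))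
        (fun _ m => m.map (·.1.2) = l.map (·.1.2) ∧ P (m.map Prod.fst)) ?_ ?_ ?_ h4
      · obtain ⟨h5, h6⟩ := H
        cases o with
        | none => exact ⟨h6 rfl, by simp⟩
        | some r => exact ⟨(h5 r rfl).1, fun _ => (h5 r rfl).2⟩
      · rintro m r m' hm ⟨b, m₁, h5, h6, rfl⟩
        obtain ⟨h7, h8⟩ := h1 _ _ _ h5
        have h9 := congrArg (List.map Prod.snd) h7
        simp only [List.map_map, Function.comp_def] at h9
        cases b
        · simp at h6
        · exact ⟨h9.trans hm, h7 ▸ h8 rfl⟩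
      · rintro m m' b m'' hm ⟨b, m₁, h5, h6, rfl⟩ h10
        obtain ⟨h7, h8⟩ := h1 _ _ _ h5
        have h9 := congrArg (List.map Prod.snd) h7
        simp only [List.map_map, Function.comp_def] at h9
        have h11 := congrArg (List.map Prod.fst) (increment_spec h10).1
        simp only [List.map_map, Function.comp_def, e, Equiv.prodAssoc_apply] at h11
        exact h11.trans (h9.trans hm)
      · rw [hz]; simp
    · rintro l ⟨t, ht, hPt⟩
      -- The invariant keeps the counter at most at the value of a known solution, so the search
      -- cannot overflow before it has tested that value.
      let v := counterValue η (t.map Prod.fst)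
      have H := exists_clockedLoop (η := η) (e := e) (R := body)
        (fun m => m.map (·.1.2) = l.map (·.1.2) ∧ counterValue η (m.map (·.1.1)) ≤ v)
        (fun o _ => o.isSome = true) ?_
        (l := l.map fun x => ((η.symm ⟨0, hk⟩, x.1.2), x.2)) ?_
      · obtain ⟨o, l', h4, h5⟩ := H
        exact ⟨l', (), _, rfl, o, l', h4, h5.symm, rfl⟩
      · rintro m ⟨hm, hv⟩
        obtain ⟨b, m', h4⟩ := h3 m
        obtain ⟨h5, h6⟩ := h1 _ _ _ h4
        have hlen : m.length = t.length := by
          have h7 := congrArg List.length hm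
          have h8 := congrArg List.length ht
          simp only [List.length_map] at h7 h8
          rw [h7, h8]
        cases b
        · refine .inr ⟨m', ⟨_, _, h4, rfl, rfl⟩, ?_, ?_, ?_⟩
          · simpa using congrArg List.length h5
          · have h7 := congrArg (List.map Prod.fst) h5
            simpa [e, Function.comp_def] using h7
          · intro b m'' h7
            obtain ⟨h8, h9⟩ := increment_spec h7
            have h5' := congrArg (List.map Prod.fst) h5
            have h5'' := congrArg (List.map Prod.snd) h5
            simp only [List.map_map, Function.comp_def] at h5' h5''
            simp only [e, Equiv.prodAssoc_apply, h5'] at h9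
            -- At the value `v` the tape would show the solution `t`. Then the test has a successful
            -- run, and by determinism the failed run cannot exist.
            have hne : counterValue η (m.map (·.1.1)) ≠ v := by
              intro h10
              have h11 := counterValue_injective η (by simp [hlen]) h10
              have h12 : m.map Prod.fst = t := by
                refine List.eq_of_map_fst_of_map_snd ?_ ?_
                · simpa [Function.comp_def] using h11
                · rw [ht, ← hm]; simp
              obtain ⟨m₁, h13⟩ := h2 m (h12 ▸ hPt)
              exact absurd (hC.functional hd h4 h13).1 (by simp)
            have hlt := counterValue_lt η (t.map Prod.fst)
            have hm' : m'.length = t.length := by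
              rw [← hlen]; simpa using congrArg List.length h5
            rw [List.length_map, ← hm'] at hlt
            change v < _ at hlt
            have h11 := congrArg (List.map Prod.fst) h8
            simp only [List.map_map, Function.comp_def, e, Equiv.prodAssoc_apply] at h11
            cases b
            · simp only [Bool.false_eq_true, if_false, add_zero] at h9 ⊢
              exact ⟨h11.trans (h5''.trans hm), by omega⟩
            · simp only [if_true] at h9
              omega
        · exact .inl ⟨(), m', ⟨_, _, h4, rfl, rfl⟩, rfl⟩
      · refine ⟨by simp, ?_⟩
        have := counterValue_map_zero η hk l
        simp [Function.comp_def] at this ⊢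
        rw [this]
        exact Nat.zero_le _
    · intro _ l
      have H := exists_clockedLoop (η := η) (e := e) (R := body)
        (fun m => True) (fun o _ => True) ?_ (l := l.map fun x => ((η.symm ⟨0, hk⟩, x.1.2), x.2))
        trivial
      · obtain ⟨o, l', h4, -⟩ := H
        exact ⟨_, l', (), _, rfl, o, l', h4, rfl, rfl⟩
      · intro m _
        obtain ⟨b, m', h4⟩ := h3 m
        cases b
        · refine .inr ⟨m', ⟨_, _, h4, rfl, rfl⟩, hC.length_eq h4, ?_, by simp⟩
          have h7 := congrArg (List.map Prod.fst) (h1 _ _ _ h4).1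
          simpa [e, Function.comp_def] using h7
        · exact .inl ⟨(), m', ⟨_, _, h4, rfl, rfl⟩, trivial⟩
  -- The guess is one nondeterministic pass that may change everything except the `X`-component; the
  -- test follows.
  · let act : Unit → (Y × X) × Z → Set (Unit × (Y × X) × Z) :=
      fun _ x => {p | p.2.1.2 = x.1.2}
    have hs : ∀ {l u l'}, Sweep act () l u l' ↔ l'.map (·.1.2) = l.map (·.1.2) := by
      intro l u l'
      induction l generalizing l' with
      | nil => simp
      | cons x l ih =>
        simp only [Sweep.cons_iff, ih, act, Set.mem_ofPred_eq, List.map_cons]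
        constructor
        · rintro ⟨_, y, l₁, h4, h5, rfl⟩
          simp [h4, h5]
        · intro h
          obtain ⟨y, l₁, rfl, h4, h5⟩ := List.map_eq_cons_iff.1 h
          exact ⟨(), y, l₁, h4, h5, rfl⟩
    refine ⟨bind (Sweep act ()) fun _ => C,
      (implementable_sweep _ _ fun h => absurd h hd).bind fun _ => hC, ?_, ?_,
      fun h => absurd h hd⟩
    · rintro l b l' ⟨_, l₁, h4, h5⟩
      obtain ⟨h6, h7⟩ := h1 _ _ _ h5
      have h8 := congrArg (List.map Prod.snd) h6
      simp only [List.map_map, Function.comp_def] at h8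
      exact ⟨h8.trans (hs.1 h4), fun hb => h6 ▸ h7 hb⟩
    · rintro l ⟨t, ht, hPt⟩
      have hlen : t.length = (l.map Prod.snd).length := by
        simpa using congrArg List.length ht
      have h4 : (t.zip (l.map Prod.snd)).map Prod.fst = t := List.map_fst_zip hlen.le
      obtain ⟨l', h5⟩ := h2 (t.zip (l.map Prod.snd)) (h4.symm ▸ hPt)
      refine ⟨l', (), _, hs.2 ?_, h5⟩
      have h6 := congrArg (List.map Prod.snd) h4
      rw [ht] at h6
      simpa [Function.comp_def] using h6

end TapeProgram

namespace TapeProgram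

variable {d : Prop}

/-! ### Comparison of two words -/

/-- One cell of the pass that removes the first letter of a word with blanks. -/
def popCell {α : Type*} : Option α → Option α → Option α × Option α
  | none, u => (u, none)
  | some a, u => (some a, u)

theorem mealy_popCell_some {α : Type*} (a : α) (l : List (Option α)) :
    mealy popCell (some a) l = (some a, l) := by
  induction l with
  | nil => rfl
  | cons x l ih => simp [mealy, popCell, ih]

theorem mealy_popCell {α : Type*} (l : List (Option α)) :
    (mealy popCell none l).1 = l.reduceOption.head? ∧
      (mealy popCell none l).2.reduceOption = l.reduceOption.tail := by
  induction l with
  | nil => simp [mealy]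
  | cons x l ih =>
    cases x with
    | none => simpa [mealy, popCell] using ih
    | some a => simp [mealy, popCell, mealy_popCell_some]

/-- Two transducers side by side. -/
def mealyProd {σ τ Γ Δ : Type*} (δ₁ : σ → Γ → σ × Γ) (δ₂ : τ → Δ → τ × Δ) (q : σ × τ)
    (x : Γ × Δ) : (σ × τ) × Γ × Δ :=
  (((δ₁ q.1 x.1).1, (δ₂ q.2 x.2).1), (δ₁ q.1 x.1).2, (δ₂ q.2 x.2).2)

theorem mealy_mealyProd {σ τ Γ Δ : Type*} (δ₁ : σ → Γ → σ × Γ) (δ₂ : τ → Δ → τ × Δ) (q : σ × τ)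
    (l : List (Γ × Δ)) :
    (mealy (mealyProd δ₁ δ₂) q l).1 =
      ((mealy δ₁ q.1 (l.map Prod.fst)).1, (mealy δ₂ q.2 (l.map Prod.snd)).1) ∧
    (mealy (mealyProd δ₁ δ₂) q l).2.map Prod.fst = (mealy δ₁ q.1 (l.map Prod.fst)).2 ∧
    (mealy (mealyProd δ₁ δ₂) q l).2.map Prod.snd = (mealy δ₂ q.2 (l.map Prod.snd)).2 := by
  induction l generalizing q with
  | nil => simp [mealy]
  | cons x l ih =>
    have := ih (mealyProd δ₁ δ₂ q x).1
    simp only [mealy, List.map_cons]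
    refine ⟨this.1, ?_, ?_⟩
    · rw [this.2.1]; rfl
    · rw [this.2.2]; rfl

/-- There is a program that compares two words with blanks. -/
theorem exists_compare (α : Type*) [Finite α] :
    ∃ R : TapeProgram (Option α × Option α) Bool, Implementable d R ∧
      (∀ l, (∃ l', R l true l') ↔
        (l.map Prod.fst).reduceOption = (l.map Prod.snd).reduceOption) ∧
      ∀ l, ∃ b l', R l b l' := by
  classical
  -- One round removes the first letter of both words and compares the two. The words agree exactly
  -- when both run out in the same round with no mismatch before.
  let body : TapeProgram (Option α × Option α) (Option Bool) :=
    bind (fun l r l' => mealy (mealyProd popCell popCell) (none, none) l = (r, l')) fun r =>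
      return' (if r.1 = r.2 then (if r.1 = none then some true else none) else some false)
  have hbody : Implementable d body := (implementable_mealy _ _).bind fun _ =>
    implementable_return _
  let w₁ (l : List (Option α × Option α)) := (l.map Prod.fst).reduceOption
  let w₂ (l : List (Option α × Option α)) := (l.map Prod.snd).reduceOption
  have hb : ∀ l, ∃ o l', body l o l' ∧ w₁ l' = (w₁ l).tail ∧ w₂ l' = (w₂ l).tail ∧
      o = if (w₁ l).head? = (w₂ l).head? then (if (w₁ l).head? = none then some true else none)
        else some false := by
    intro l
    obtain ⟨h1, h2, h3⟩ := mealy_mealyProd popCell popCell ((none, none) : Option α × Option α) l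
    refine ⟨_, _, ⟨_, _, rfl, rfl, rfl⟩, ?_, ?_, ?_⟩
    · simp only [w₁, h2, mealy_popCell]
    · simp only [w₂, h3, mealy_popCell]
    · simp only [h1, mealy_popCell, w₁, w₂]
  -- The body is deterministic whatever `d` is, so the run exhibited above is the only one and its
  -- description holds for every run.
  have hdet : Implementable True body := (implementable_mealy _ _).bind fun _ =>
    implementable_return _
  have hb' : ∀ {l o l'}, body l o l' → w₁ l' = (w₁ l).tail ∧ w₂ l' = (w₂ l).tail ∧
      o = if (w₁ l).head? = (w₂ l).head? then (if (w₁ l).head? = none then some true else none)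
        else some false := by
    intro l o l' h
    obtain ⟨o', m, h1, h2⟩ := hb l
    obtain ⟨rfl, rfl⟩ := hdet.functional trivial h h1
    exact h2
  refine ⟨body.loop, hbody.loop, ?_, ?_⟩
  · intro l
    constructor
    · rintro ⟨l', h⟩
      generalize hr : true = r at h
      induction h with
      | @exit l r l' h =>
        subst hr
        obtain ⟨-, -, h1⟩ := hb' h
        split_ifs at h1 with h2 h3
        · have h4 : w₁ l = [] := List.head?_eq_none_iff.1 h3
          have h5 : w₂ l = [] := List.head?_eq_none_iff.1 (h2 ▸ h3)
          exact h4.trans h5.symm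
        · simp at h1
      | @again l l' r l'' h _ ih =>
        subst hr
        obtain ⟨h1, h2, h3⟩ := hb' h
        have h4 : w₁ l' = w₂ l' := ih rfl
        split_ifs at h3 with h5 h6
        change w₁ l = w₂ l
        rw [h1, h2] at h4
        revert h4 h5 h6
        generalize w₁ l = x
        generalize w₂ l = y
        cases x <;> cases y <;> simp +contextual
    · intro hl
      have H := exists_loop (R := body) (fun l => w₁ l = w₂ l) (fun b _ => b = true)
        (fun l => (w₁ l).length) ?_ hl
      · obtain ⟨b, l', h1, rfl⟩ := H
        exact ⟨l', h1⟩
      · intro l hl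
        obtain ⟨o, l', h1, h2, h3, h4⟩ := hb l
        rw [hl] at h4
        simp only [if_true] at h4
        split_ifs at h4 with h5
        · subst h4
          exact .inl ⟨_, _, h1, rfl⟩
        · subst h4
          refine .inr ⟨_, h1, by rw [h2, h3, hl], ?_⟩
          rw [h2, hl]
          cases h6 : w₂ l with
          | nil => simp [h6] at h5
          | cons => simp
  · intro l
    have H := exists_loop (R := body) (fun _ => True) (fun _ _ => True)
        (fun l => (w₁ l).length) ?_ (l := l) trivial
    · obtain ⟨b, l', h1, -⟩ := H
      exact ⟨b, l', h1⟩
    · intro l _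
      obtain ⟨o, l', h1, h2, h3, h4⟩ := hb l
      cases o with
      | some b => exact .inl ⟨_, _, h1, trivial⟩
      | none =>
        refine .inr ⟨_, h1, trivial, ?_⟩
        rw [h2]
        split_ifs at h4 with h5 h6
        cases h7 : w₁ l with
        | nil => simp [h7] at h6
        | cons => simp

/-- The words equal to a given word are recognized by a finite automaton. -/
theorem exists_foldl_eq {α : Type*} (w : List α) :
    ∃ (σ : Type) (_ : Finite σ) (step : σ → α → σ) (q : σ) (acc : σ → Prop),
      ∀ l, acc (l.foldl step q) ↔ l = w := by
  classical
  induction w with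
  | nil =>
    refine ⟨Bool, inferInstance, fun _ _ => false, true, fun b => b = true, fun l => ?_⟩
    have : ∀ l : List α, l.foldl (fun _ _ => false) false = false := by
      intro l; induction l <;> simp_all
    cases l <;> simp [this]
  | cons a w ih =>
    obtain ⟨σ, hσ, step, q, acc, h⟩ := ih
    -- `none` is the state before the first letter, `some none` the state after a wrong first
    -- letter, and `some (some s)` runs the automaton for the rest.
    let step' : Option (Option σ) → α → Option (Option σ)
      | none, x => if x = a then some (some q) else some none
      | some none, _ => some none
      | some (some s), x => some (some (step s x))
    refine ⟨Option (Option σ), inferInstance, step', none, fun s => ∃ t, s = some (some t) ∧ acc t,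
      fun l => ?_⟩
    have h1 : ∀ l : List α, l.foldl step' (some none) = some none := by
      intro l; induction l <;> simp_all [step']
    have h2 : ∀ (l : List α) s, l.foldl step' (some (some s)) = some (some (l.foldl step s)) := by
      intro l; induction l <;> simp_all [step']
    cases l with
    | nil => simp
    | cons x l =>
      by_cases hx : x = a
      · simp [step', hx, h2, h]
      · simp [step', hx, h1]

theorem exists_foldl_filterMap_eq {α Γ : Type*} (f : Γ → Option α) (w : List α) :
    ∃ (σ : Type) (_ : Finite σ) (step : σ → Γ → σ) (q : σ) (acc : σ → Prop),
      ∀ l : List Γ, acc (l.foldl step q) ↔ l.filterMap f = w := by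
  obtain ⟨σ, hσ, step, q, acc, h⟩ := exists_foldl_eq w
  refine ⟨σ, hσ, fun s x => match f x with | some a => step s a | none => s, q, acc, fun l => ?_⟩
  rw [← h, List.foldl_filterMap]
  congr!

/-! ### Rewriting -/

/-- Replacement of a factor by another one, according to a set of pairs. -/
def Rewrites {Λ : Type*} (P : Set (List Λ × List Λ)) (l l' : List Λ) : Prop :=
  ∃ X Y p q, (X, Y) ∈ P ∧ l = p ++ X ++ q ∧ l' = p ++ Y ++ q

/-- The state type may be infinite, as it is for pairs of words below. It is enough that a finite
set of states contains the start and is closed under the actions. -/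
theorem implementable_sweep_of_finite {σ Γ ρ : Type*} (act : σ → Γ → Set (σ × Γ)) (q : σ)
    (hd : d → ∀ q x, (act q x).Subsingleton) {S : Set σ} (hS : S.Finite) (hq : q ∈ S)
    (hact : ∀ q ∈ S, ∀ x, ∀ p ∈ act q x, p.1 ∈ S) (f : σ → ρ) :
    Implementable d fun l r l' => ∃ q', Sweep act q l q' l' ∧ r = f q' := by
  have := hS.to_subtype
  let act' : S → Γ → Set (S × Γ) := fun q x => {p | (p.1.1, p.2) ∈ act q x}
  have hs : ∀ {q : S} {t l l'}, Sweep act q.1 l t l' ↔ ∃ q' : S, t = q'.1 ∧ Sweep act' q l q' l' := by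
    refine Sweep.map_state_iff Subtype.val fun q x => ?_
    ext ⟨t, y⟩
    constructor
    · intro h
      exact ⟨(⟨t, hact _ q.2 _ _ h⟩, y), h, rfl⟩
    · rintro ⟨p, h, h'⟩
      rw [← h']
      exact h
  convert (implementable_sweep (d := d) act' ⟨q, hq⟩ fun h q x p hp p' hp' => ?_).bind
    (S := fun q' => return' (f q'.1)) (fun _ => implementable_return _) using 1
  · ext l r l'
    constructor
    · rintro ⟨q', h, rfl⟩
      obtain ⟨q'', rfl, h1⟩ := (hs (q := ⟨q, hq⟩)).1 h
      exact ⟨q'', l', h1, rfl, rfl⟩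
    · rintro ⟨q', l₁, h1, rfl, rfl⟩
      exact ⟨q'.1, (hs (q := ⟨q, hq⟩)).2 ⟨q', rfl, h1⟩, rfl⟩
  · have := hd h _ _ hp hp'
    simp only [Prod.mk.injEq] at this
    exact Prod.ext (Subtype.ext this.1) this.2

/-- The transducer that replaces one factor. The state holds the rest of the factor and of its
replacement, once the replacement has begun. -/
def rewriteAct {Λ : Type*} (P : Set (List Λ × List Λ)) :
    Option (List Λ × List Λ) → Λ → Set (Option (List Λ × List Λ) × Λ)
  | none, x => {p | p = (none, x) ∨ ∃ X Y, (x :: X, p.2 :: Y) ∈ P ∧ p.1 = some (X, Y)}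
  | some (x' :: X, y :: Y), x => {p | x = x' ∧ p = (some (X, Y), y)}
  | some ([], []), x => {(some ([], []), x)}
  | _, _ => ∅

section

variable {Λ : Type*} {P : Set (List Λ × List Λ)}

theorem sweep_rewriteAct_some {X Y l l' : List Λ} (hXY : X.length = Y.length) :
    Sweep (rewriteAct P) (some (X, Y)) l (some ([], [])) l' ↔ ∃ q, l = X ++ q ∧ l' = Y ++ q := by
  induction l generalizing X Y l' with
  | nil =>
    cases X <;> cases Y <;> simp_all
  | cons x l ih =>
    cases X with
    | nil =>
      obtain rfl : Y = [] := by simpa [eq_comm] using hXY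
      simp [rewriteAct, ih]
    | cons x' X =>
      cases Y with
      | nil => simp at hXY
      | cons y Y =>
        have := fun l' => ih (X := X) (Y := Y) (l' := l') (by simpa using hXY)
        simp only [Sweep.cons_iff, rewriteAct, Set.mem_ofPred_eq, Prod.mk.injEq, List.cons_append,
          List.cons.injEq]
        constructor
        · rintro ⟨_, _, l₁, ⟨rfl, rfl, rfl⟩, h, rfl⟩
          obtain ⟨q, rfl, rfl⟩ := (this _).1 h
          exact ⟨q, ⟨rfl, rfl⟩, rfl⟩
        · rintro ⟨q, ⟨rfl, rfl⟩, rfl⟩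
          exact ⟨_, _, _, ⟨rfl, rfl, rfl⟩, (this _).2 ⟨q, rfl, rfl⟩, rfl⟩

/-- A pass that ends in `some ([], [])` has begun a replacement at some cell, finished it, and
copied the rest. Equal lengths make a cell-by-cell replacement possible, and nonempty left-hand
sides ensure that there is a cell to begin with. -/
theorem sweep_rewriteAct_iff (hlen : ∀ p ∈ P, p.1.length = p.2.length) (hne : ∀ p ∈ P, p.1 ≠ [])
    {l l' : List Λ} :
    Sweep (rewriteAct P) none l (some ([], [])) l' ↔ Rewrites P l l' := by
  induction l generalizing l' with
  | nil =>
    simp only [Sweep.nil_iff, reduceCtorEq, false_and, false_iff]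
    rintro ⟨X, Y, p, q, h1, h2, -⟩
    have : X = [] := by simp_all
    exact hne _ h1 this
  | cons x l ih =>
    simp only [Sweep.cons_iff, rewriteAct, Set.mem_ofPred_eq, Prod.mk.injEq]
    constructor
    · rintro ⟨_, y, l₁, ⟨rfl, rfl⟩ | ⟨X, Y, h1, rfl⟩, h2, rfl⟩
      · obtain ⟨X, Y, p, q, h3, rfl, rfl⟩ := ih.1 h2
        exact ⟨X, Y, y :: p, q, h3, rfl, rfl⟩
      · obtain ⟨q, rfl, rfl⟩ := (sweep_rewriteAct_some (by simpa using hlen _ h1)).1 h2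
        exact ⟨_, _, [], q, h1, rfl, rfl⟩
    · rintro ⟨X, Y, p, q, h1, h2, rfl⟩
      cases p with
      | nil =>
        obtain ⟨x', X, rfl⟩ := List.exists_cons_of_ne_nil (hne _ h1)
        have h3 := hlen _ h1
        cases Y with
        | nil => simp at h3
        | cons y Y =>
          simp only [List.nil_append, List.cons_append, List.cons.injEq] at h2
          obtain ⟨rfl, rfl⟩ := h2
          exact ⟨_, y, _, .inr ⟨X, Y, h1, rfl⟩,
            (sweep_rewriteAct_some (by simpa using h3)).2 ⟨q, rfl, rfl⟩, rfl⟩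
      | cons y p =>
        simp only [List.cons_append, List.cons.injEq] at h2
        obtain ⟨rfl, rfl⟩ := h2
        exact ⟨none, x, _, .inl ⟨rfl, rfl⟩, ih.2 ⟨X, Y, p, q, h1, rfl, rfl⟩, rfl⟩

theorem sweep_rewriteAct_none {l l' : List Λ} :
    Sweep (rewriteAct P) none l none l' ↔ l' = l := by
  have hs : ∀ {X Y : List Λ} {l l' : List Λ},
      ¬ Sweep (rewriteAct P) (some (X, Y)) l none l' := by
    intro X Y l
    induction l generalizing X Y with
    | nil => simp
    | cons x l ih =>
      intro l' h
      obtain ⟨q', y, l₁, h1, h2, -⟩ := Sweep.cons_iff.1 h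
      cases X <;> cases Y <;> simp only [rewriteAct, Set.mem_empty_iff_false,
        Set.mem_singleton_iff, Set.mem_ofPred_eq, Prod.mk.injEq] at h1
      · rw [h1.1] at h2; exact ih h2
      · rw [h1.2.1] at h2; exact ih h2
  induction l generalizing l' with
  | nil => simp
  | cons x l ih =>
    simp only [Sweep.cons_iff, rewriteAct, Set.mem_ofPred_eq, Prod.mk.injEq]
    constructor
    · rintro ⟨_, y, l₁, ⟨rfl, rfl⟩ | ⟨X, Y, h1, rfl⟩, h2, rfl⟩
      · rw [ih.1 h2]
      · exact absurd h2 hs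
    · rintro rfl
      exact ⟨none, x, l, .inl ⟨rfl, rfl⟩, ih.2 rfl, rfl⟩

/-- There is a program that carries out any number of replacements. -/
theorem exists_rewrite [Finite Λ] (hP : P.Finite) (hlen : ∀ p ∈ P, p.1.length = p.2.length)
    (hne : ∀ p ∈ P, p.1 ≠ []) : ∃ R : TapeProgram Λ Bool, Implementable False R ∧
      ∀ l l', R l true l' ↔ Relation.ReflTransGen (Rewrites P) l l' := by
  -- There are finitely many pairs, so their lengths are bounded and only finitely many states
  -- occur.
  obtain ⟨K, hK⟩ : ∃ K, ∀ p ∈ P, p.1.length ≤ K := by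
    obtain ⟨K, hK⟩ := (hP.image fun p => p.1.length).bddAbove
    exact ⟨K, fun p hp => hK ⟨p, hp, rfl⟩⟩
  let S : Set (Option (List Λ × List Λ)) :=
    insert none (some '' ({l | l.length ≤ K} ×ˢ {l | l.length ≤ K}))
  have hS : S.Finite :=
    (((List.finite_length_le Λ K).prod (List.finite_length_le Λ K)).image _).insert _
  have hact : ∀ q ∈ S, ∀ x, ∀ p ∈ rewriteAct P q x, p.1 ∈ S := by
    rintro q (rfl | ⟨⟨X, Y⟩, ⟨h1, h2⟩, rfl⟩) x p hp
    · rcases hp with rfl | ⟨X, Y, h1, h2⟩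
      · exact .inl rfl
      · rw [h2]
        refine .inr ⟨(X, Y), ⟨?_, ?_⟩, rfl⟩
        · have := hK _ h1
          simp at this ⊢
          omega
        · have h3 := hK _ h1
          have h4 := hlen _ h1
          simp at h3 h4 ⊢
          omega
    · simp only [Set.mem_ofPred_eq] at h1 h2
      cases X <;> cases Y <;> simp only [rewriteAct, Set.mem_empty_iff_false,
        Set.mem_singleton_iff, Set.mem_ofPred_eq] at hp
      · rw [hp]
        exact .inr ⟨([], []), by simp, rfl⟩
      · rw [hp.2]
        refine .inr ⟨(_, _), ⟨?_, ?_⟩, rfl⟩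
        · simp at h1 ⊢; omega
        · simp at h2 ⊢; omega
  classical
  -- A pass without replacement ends the loop, a complete replacement repeats it, and a replacement
  -- broken off at the end of the tape makes the run fail.
  let f : Option (List Λ × List Λ) → Option Bool := fun q =>
    if q = none then some true else if q = some ([], []) then none else some false
  have hR := (implementable_sweep_of_finite (d := False) (rewriteAct P) none (by simp) hS
    (.inl rfl) hact f).loop
  refine ⟨_, hR, fun l l' => ⟨fun h => ?_, fun h => ?_⟩⟩
  · generalize hr : true = r at h
    induction h with
    | exit h =>
      subst hr
      obtain ⟨q, h1, h2⟩ := h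
      simp only [f] at h2
      split_ifs at h2 with h3 h4
      · subst h3
        rw [sweep_rewriteAct_none.1 h1]
      · simp at h2
    | again h _ ih =>
      subst hr
      obtain ⟨q, h1, h2⟩ := h
      simp only [f] at h2
      split_ifs at h2 with h3 h4
      subst h4
      exact .head ((sweep_rewriteAct_iff hlen hne).1 h1) (ih rfl)
  · induction h using Relation.ReflTransGen.head_induction_on with
    | refl => exact .exit ⟨none, sweep_rewriteAct_none.2 rfl, by simp [f]⟩
    | head h1 _ ih =>
      exact .again ⟨some ([], []), (sweep_rewriteAct_iff hlen hne).2 h1, by simp [f]⟩ ih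

end

/-! ### Membership in a context-sensitive language -/

/-- There is a program that tests whether a word with blanks belongs to `L`, provided that the first
and the last cell are blank. -/
def MembershipTest.{u} (d : Prop) {A : Type u} (L : Language A) : Prop :=
  ∃ (Λ : Type u) (_ : Finite Λ) (enc : Option A → Λ) (R : TapeProgram Λ Bool), Implementable d R ∧
    (∀ (v : List (Option A)) (l' : List Λ), R (v.map enc) true l' → v.reduceOption ∈ L) ∧
    (∀ v : List (Option A), v.reduceOption ∈ L → ∃ l', R ((none :: (v ++ [none])).map enc) true l') ∧
    (d → ∀ v : List (Option A), ∃ b l', R (v.map enc) b l')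

/-- The replacements that invert the productions of a grammar, and moves of blanks to the right. -/
inductive InverseRule {A : Type*} (g : ContextSensitiveGrammar A) :
    List (Option (Symbol A g.NT)) × List (Option (Symbol A g.NT)) → Prop
  | move (s) : InverseRule g ([none, some s], [some s, none])
  | rule (r) : r ∈ g.rules → InverseRule g (r.2.map some,
      r.1.map some ++ List.replicate (r.2.length - r.1.length) none)

section

variable {A : Type*} {g : ContextSensitiveGrammar A}

theorem InverseRule.finite [Finite A] : {p | InverseRule g p}.Finite := by
  have := g.finite_NT
  have := Symbol.finite A g.NT
  refine ((Set.finite_range fun s : Symbol A g.NT =>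
    (([none, some s], [some s, none]) : List (Option _) × List (Option _))).union
    (g.finite_rules.image fun r => (r.2.map some,
      r.1.map some ++ List.replicate (r.2.length - r.1.length) none))).subset ?_
  rintro _ (s | ⟨r, hr⟩)
  · exact .inl ⟨s, rfl⟩
  · exact .inr ⟨r, hr, rfl⟩

theorem InverseRule.length_eq {p} (h : InverseRule g p) : p.1.length = p.2.length := by
  cases h with
  | move => rfl
  | rule r hr =>
    have := g.length_le r hr
    simp; omega

theorem InverseRule.ne_nil {p} (h : InverseRule g p) : p.1 ≠ [] := by
  cases h with
  | move => simp
  | rule r hr =>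
    have h1 := g.length_le r hr
    have h2 := List.length_pos_iff.2 (g.lhs_ne_nil r hr)
    intro h
    have := congrArg List.length h
    simp at this
    simp [this] at h1
    exact g.lhs_ne_nil r hr h1

theorem Rewrites.cons {Λ : Type*} {P : Set (List Λ × List Λ)} {l l' : List Λ}
    (h : Rewrites P l l') (x : Λ) : Rewrites P (x :: l) (x :: l') := by
  obtain ⟨X, Y, p, q, h, rfl, rfl⟩ := h
  exact ⟨X, Y, x :: p, q, h, rfl, rfl⟩

theorem reduceOption_map_some {α : Type*} (l : List α) : (l.map some).reduceOption = l := by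
  induction l <;> simp_all

/-- With blanks ignored, moving a blank changes nothing and an inverted production is one derivation
step read backwards. -/
theorem produces_of_rewrites {l l' : List (Option (Symbol A g.NT))}
    (h : Rewrites {p | InverseRule g p} l l') :
    Relation.ReflTransGen g.Produces l'.reduceOption l.reduceOption := by
  obtain ⟨X, Y, p, q, h, rfl, rfl⟩ := h
  cases h with
  | move => simp [List.reduceOption_append, Relation.ReflTransGen.refl]
  | rule r hr =>
    refine .single ⟨r, hr, p.reduceOption, q.reduceOption, ?_, ?_⟩ <;>
      simp [List.reduceOption_append, reduceOption_map_some, List.reduceOption_replicate_none]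

/-- Blanks drift to the right end. Afterwards every factor of the underlying word is a contiguous
factor of the tape, where an inverted production can apply. -/
theorem rewrites_compact (l : List (Option (Symbol A g.NT))) :
    ∃ k, Relation.ReflTransGen (Rewrites {p | InverseRule g p}) l
      (l.reduceOption.map some ++ List.replicate k none) := by
  induction l with
  | nil => exact ⟨0, .refl⟩
  | cons x l ih =>
    obtain ⟨k, hk⟩ := ih
    have h1 := hk.lift (x :: ·) fun _ _ h => h.cons x
    cases x with
    | some s => exact ⟨k, by simpa using h1⟩
    | none =>
      refine ⟨k + 1, h1.trans ?_⟩
      simp only [List.reduceOption_cons_of_none]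
      generalize l.reduceOption = w
      induction w with
      | nil => exact .refl
      | cons s w ih =>
        exact .head ⟨_, _, [], _, .move s, rfl, rfl⟩ (ih.lift (some s :: ·) fun _ _ h => h.cons _)

/-- The derivation is undone from its last step: push the blanks aside, then replace the right-hand
side by the left-hand side padded with blanks. No extra space is needed because productions do not
shorten. -/
theorem exists_rewrites {w : List (Symbol A g.NT)}
    (hw : Relation.ReflTransGen g.Produces [.nonterminal g.initial] w)
    {l : List (Option (Symbol A g.NT))} (hl : l.reduceOption = w) :
    ∃ l', Relation.ReflTransGen (Rewrites {p | InverseRule g p}) l l' ∧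
      l'.reduceOption = [.nonterminal g.initial] := by
  induction hw generalizing l with
  | refl => exact ⟨l, .refl, hl⟩
  | tail _ h1 ih =>
    obtain ⟨r, hr, p, q, rfl, rfl⟩ := h1
    obtain ⟨k, hk⟩ := rewrites_compact l
    obtain ⟨l', h2, h3⟩ := ih (l := p.map some ++ (r.1.map some ++
      List.replicate (r.2.length - r.1.length) none) ++ (q.map some ++ List.replicate k none))
      (by simp [List.reduceOption_append, reduceOption_map_some,
        List.reduceOption_replicate_none])
    refine ⟨l', (hk.tail ⟨_, _, p.map some, q.map some ++ List.replicate k none, .rule r hr, ?_,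
      rfl⟩).trans h2, h3⟩
    rw [hl]
    simp

end

theorem membershipTest_of_isContextSensitive {A : Type*} [Finite A] {L : Language A}
    (h : L.deleteEmpty.IsContextSensitive) : MembershipTest False L := by
  classical
  obtain ⟨g, hg⟩ := h
  have := g.finite_NT
  have := Symbol.finite A g.NT
  let enc : Option A → Option (Symbol A g.NT) := Option.map .terminal
  have henc : ∀ v : List (Option A),
      (v.map enc).reduceOption = v.reduceOption.map Symbol.terminal := by
    intro v
    induction v with
    | nil => rfl
    | cons x v ih => cases x <;> simp [enc, ih]
  obtain ⟨R, hR, hRl⟩ := exists_rewrite (InverseRule.finite (g := g)) (fun _ => InverseRule.length_eq)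
    (fun _ => InverseRule.ne_nil)
  obtain ⟨σ₀, _, step₀, q₀, acc₀, h₀⟩ :=
    exists_foldl_filterMap_eq (id : Option (Symbol A g.NT) → _) []
  obtain ⟨σ₁, _, step₁, q₁, acc₁, h₁⟩ :=
    exists_foldl_filterMap_eq (id : Option (Symbol A g.NT) → _) [.nonterminal g.initial]
  -- The grammar generates only `L.deleteEmpty`, so an input without letters is recognized first and
  -- gets the constant answer for the empty word.
  let prog : TapeProgram (Option (Symbol A g.NT)) Bool :=
    bind (scan step₀ q₀) fun s => if acc₀ s then return' (decide ([] ∈ L)) else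
      bind R fun b => if b then bind (scan step₁ q₁) fun t => return' (decide (acc₁ t))
        else return' false
  refine ⟨Option (Symbol A g.NT), inferInstance, enc, prog, ?_, ?_, ?_, fun h => h.elim⟩
  · refine (implementable_scan _ _).bind fun s => ?_
    split_ifs
    · exact implementable_return _
    · refine hR.bind fun b => ?_
      split_ifs
      · exact (implementable_scan _ _).bind fun t => implementable_return _
      · exact implementable_return _
  · rintro v l' ⟨s, l₁, ⟨rfl, rfl⟩, h2⟩
    by_cases h3 : acc₀ ((v.map enc).foldl step₀ q₀)
    · rw [if_pos h3] at h2
      have h4 : (v.map enc).reduceOption = [] := (h₀ _).1 h3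
      rw [henc, List.map_eq_nil_iff] at h4
      rw [h4]
      simpa using h2.1.symm
    · rw [if_neg h3] at h2
      obtain ⟨b, l₂, h4, h5⟩ := h2
      cases b
      · simp [return'] at h5
      · obtain ⟨t, l₃, ⟨rfl, h6'⟩, h6, rfl⟩ := h5
        subst h6'
        have h7 : l'.reduceOption = _ := (h₁ _).1 (by simpa using h6.symm)
        rw [hRl] at h4
        have h8 : v.reduceOption ∈ g.language := by
          change Relation.ReflTransGen _ _ _
          rw [← h7, ← henc]
          clear h7 h6
          induction h4 with
          | refl => exact .refl
          | tail _ h ih => exact (produces_of_rewrites h).trans ih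
        rw [hg] at h8
        exact h8.1
  · intro v hv
    let v' := none :: (v ++ [none])
    have hv' : v'.reduceOption = v.reduceOption := by
      simp [v', List.reduceOption_append]
    by_cases h3 : acc₀ ((v'.map enc).foldl step₀ q₀)
    · refine ⟨v'.map enc, _, _, ⟨rfl, rfl⟩, ?_⟩
      change (if acc₀ ((v'.map enc).foldl step₀ q₀) then _ else _ : TapeProgram _ _) _ _ _
      rw [if_pos h3]
      have h4 : (v'.map enc).reduceOption = [] := (h₀ _).1 h3
      rw [henc, List.map_eq_nil_iff, hv'] at h4
      rw [h4] at hv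
      exact ⟨by simp [hv], rfl⟩
    · have h4 : (v'.map enc).reduceOption ≠ [] := fun h => h3 ((h₀ _).2 h)
      rw [henc, Ne, List.map_eq_nil_iff, hv'] at h4
      have h5 : v.reduceOption ∈ g.language := by rw [hg]; exact ⟨hv, h4⟩
      obtain ⟨l', h6, h7⟩ := exists_rewrites h5 (l := v'.map enc) (by rw [henc, hv'])
      refine ⟨l', _, _, ⟨rfl, rfl⟩, ?_⟩
      change (if acc₀ ((v'.map enc).foldl step₀ q₀) then _ else _ : TapeProgram _ _) _ _ _
      rw [if_neg h3]
      refine ⟨true, l', (hRl _ _).2 h6, _, _, ⟨rfl, rfl⟩, ?_, rfl⟩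
      have := (h₁ l').2 h7
      simp [this]

end TapeProgram

namespace TapeProgram

variable {d : Prop}

theorem Implementable.exists_onTrack {Γ Γ' Δ ρ : Type*} (e : Γ' ≃ Γ × Δ) {R : TapeProgram Γ ρ}
    (hR : Implementable d R) {l : List Γ'} {r : ρ} {m : List Γ}
    (h : R (l.map fun x => (e x).1) r m) :
    ∃ l' : List Γ', TapeProgram.onTrack e R l r l' ∧ (l'.map fun x => (e x).1) = m := by
  have hlen : m.length = (l.map fun x => (e x).2).length := by
    rw [hR.length_eq h]; simp
  refine ⟨List.zipWith (fun a b => e.symm (a, b)) m (l.map fun x => (e x).2), ⟨?_, ?_⟩, ?_⟩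
  · rwa [Sweep.map_fst_zipWith e hlen]
  · rw [Sweep.map_snd_zipWith e hlen]
  · rw [Sweep.map_fst_zipWith e hlen]

/-- Replace the first cell by `y` if it equals `x`; the state tells whether this was done. -/
noncomputable def replaceFirst {Γ : Type*} (x y : Γ) (s : Option Bool) (z : Γ) :
    Option Bool × Γ :=
  open Classical in
  match s with
  | none => if z = x then (some true, y) else (some false, z)
  | some b => (some b, z)

theorem mealy_replaceFirst {Γ : Type*} {x y : Γ} {l m : List Γ} :
    mealy (replaceFirst x y) none l = (some true, m) ↔ ∃ l', l = x :: l' ∧ m = y :: l' := by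
  have h : ∀ b (l : List Γ), mealy (replaceFirst x y) (some b) l = (some b, l) := by
    intro b l
    induction l with
    | nil => rfl
    | cons z l ih => simp [mealy, replaceFirst, ih]
  cases l with
  | nil => simp [mealy]
  | cons z l => by_cases hz : z = x <;> simp [mealy, replaceFirst, hz, h, eq_comm (a := m)]

/-! ### Simulation of a deterministic machine on a tape with blanks -/

/-- The states of a pass that moves a head. -/
inductive HeadPass (σ : Type*) where
  | search : HeadPass σ
  | carry (q : σ) : HeadPass σ
  | finished : HeadPass σ

instance {σ : Type*} [Finite σ] : Finite (HeadPass σ) := by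
  refine Finite.of_surjective (fun x : Option (Option σ) => match x with
    | none => HeadPass.search
    | some none => .finished
    | some (some q) => .carry q) ?_
  rintro (_ | q | _)
  · exact ⟨none, rfl⟩
  · exact ⟨some (some q), rfl⟩
  · exact ⟨some none, rfl⟩

/-- The pass that carries out the actions in `act`; the flag of an action tells whether the head
moves to the next nonblank cell. -/
def headPass {σ S : Type*} (act : σ → S → Option (σ × S × Bool)) :
    HeadPass σ → Option S × Option σ → HeadPass σ × (Option S × Option σ)
  | .search, (some s, some q) =>
    match act q s with
    | none => (.search, (some s, some q))
    | some (q', s', false) => (.finished, (some s', some q'))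
    | some (q', s', true) => (.carry q', (some s', none))
  | .carry q, (some s, none) => (.finished, (some s, some q))
  | t, x => (t, x)

section

variable {σ S : Type*} {act : σ → S → Option (σ × S × Bool)}

theorem mealy_headPass_finished (l : List (Option S × Option σ)) :
    mealy (headPass act) .finished l = (.finished, l) := by
  induction l with
  | nil => rfl
  | cons x l ih => simp [mealy, headPass, ih]

theorem mealy_headPass_search {l : List (Option S × Option σ)} (h : ∀ x ∈ l, x.2 = none) :
    mealy (headPass act) .search l = (.search, l) := by
  induction l with
  | nil => rfl
  | cons x l ih =>
    obtain ⟨s, q⟩ := x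
    obtain rfl : q = none := h _ (List.mem_cons_self ..)
    have := ih fun x hx => h x (List.mem_cons_of_mem _ hx)
    cases s <;> simp [mealy, headPass, this]

theorem mealy_headPass_carry {q : σ} {l : List (Option S × Option σ)} (h : ∀ x ∈ l, x.2 = none)
    {t : S} {w : List S} (hl : l.filterMap Prod.fst = t :: w) :
    ∃ a b, (∀ x ∈ a, x.2 = none) ∧ (∀ x ∈ b, x.2 = none) ∧ a.filterMap Prod.fst = [] ∧
      b.filterMap Prod.fst = w ∧
      mealy (headPass act) (.carry q) l = (.finished, a ++ (some t, some q) :: b) := by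
  induction l with
  | nil => simp at hl
  | cons x l ih =>
    obtain ⟨s, q'⟩ := x
    obtain rfl : q' = none := h _ (List.mem_cons_self ..)
    have h' : ∀ x ∈ l, x.2 = none := fun x hx => h x (List.mem_cons_of_mem _ hx)
    cases s with
    | none =>
      obtain ⟨a, b, h1, h2, h3, h4, h5⟩ := ih h' (by simpa using hl)
      refine ⟨(none, none) :: a, b, by simpa using h1, h2, by simpa using h3, h4, ?_⟩
      simp [mealy, headPass, h5]
    | some s =>
      simp only [List.filterMap_cons, List.cons.injEq] at hl
      obtain ⟨rfl, rfl⟩ := hl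
      exact ⟨[], l, by simp, h', rfl, rfl, by simp [mealy, headPass, mealy_headPass_finished]⟩

theorem mealy_headPass {l₁ l₂ : List (Option S × Option σ)} (h₁ : ∀ x ∈ l₁, x.2 = none)
    {s : S} {q : σ} :
    mealy (headPass act) .search (l₁ ++ (some s, some q) :: l₂) =
      ((mealy (headPass act) (headPass act .search (some s, some q)).1 l₂).1,
        l₁ ++ (headPass act .search (some s, some q)).2 ::
          (mealy (headPass act) (headPass act .search (some s, some q)).1 l₂).2) := by
  rw [mealy_append, mealy_headPass_search h₁]
  simp [mealy]

end

section

variable {A : Type*} (M : LBA A)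

/-- The action of a deterministic machine. -/
noncomputable def _root_.LBA.action (q : M.State) (s : TapeSymbol A M.Work) :
    Option (M.State × TapeSymbol A M.Work × HeadMove) :=
  open Classical in if h : (M.trans q s).Nonempty then some h.choose else none

variable {M} in
theorem _root_.LBA.Deterministic.mem_trans (hM : M.Deterministic) {q : M.State}
    {s : TapeSymbol A M.Work} {p} : p ∈ M.trans q s ↔ M.action q s = some p := by
  unfold LBA.action
  constructor
  · intro h
    rw [dif_pos ⟨p, h⟩]
    exact congrArg some (hM q s (Set.Nonempty.some_mem ⟨p, h⟩) h)
  · intro h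
    split_ifs at h with h1
    rw [← Option.some.inj h]
    exact h1.choose_spec

/-- The actions that do not move the head to the left. -/
noncomputable def rightAction (q : M.State) (s : TapeSymbol A M.Work) :
    Option (M.State × TapeSymbol A M.Work × Bool) :=
  match M.action q s with
  | some (q', s', .stay) => some (q', s', false)
  | some (q', s', .right) => some (q', s', true)
  | _ => none

/-- The actions that move the head to the left. -/
noncomputable def leftAction (q : M.State) (s : TapeSymbol A M.Work) :
    Option (M.State × TapeSymbol A M.Work × Bool) :=
  match M.action q s with
  | some (q', s', .left) => some (q', s', true)
  | _ => none

/-- A cell of the simulating machine: a symbol or a blank, and the state at the position of the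
head. -/
abbrev SimCell := Option (TapeSymbol A M.Work) × Option M.State

/-- The tape after one step. -/
noncomputable def simStep (l : List (SimCell M)) : List (SimCell M) :=
  match mealy (headPass (rightAction M)) .search l with
  | (.finished, l') => l'
  | (_, l') => (mealy (headPass (leftAction M)) .search l'.reverse).2.reverse

/-- The simulating tape `l` represents the configuration `c`. -/
def Represents (l : List (SimCell M)) (c : M.Cfg) : Prop :=
  ∃ l₁ s l₂, (∀ x ∈ l₁, x.2 = none) ∧ (∀ x ∈ l₂, x.2 = none) ∧
    l = l₁ ++ (some s, some c.state) :: l₂ ∧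
    c.tape = l₁.filterMap Prod.fst ++ s :: l₂.filterMap Prod.fst ∧
    c.head = (l₁.filterMap Prod.fst).length ∧
    c.tape.head? = some .leftEnd ∧ c.tape.getLast? = some .rightEnd

variable {M}

/-- A moving state is carried across blanks to the next symbol. The right pass handles `stay` and
`right`; only if it carries nothing out does the reversed pass look for a move to the left. If the
machine has no action, neither pass changes the tape. -/
theorem simStep_cases (hM : M.Deterministic) {l : List (SimCell M)} {c : M.Cfg}
    (h : Represents M l c) : (simStep M l = l ∧ ∀ c', ¬ M.Step c c') ∨
      ∃ c', M.Step c c' ∧ (∀ c'', M.Step c c'' → c'' = c') ∧ Represents M (simStep M l) c' := by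
  obtain ⟨l₁, s, l₂, h1, h2, rfl, h4, h5, h6, h7⟩ := h
  have hs : c.tape[c.head]? = some s := by rw [h4, h5]; simp
  have h1' : ∀ x ∈ l₁.reverse, x.2 = none := fun x hx => h1 x (List.mem_reverse.1 hx)
  have h2' : ∀ x ∈ l₂.reverse, x.2 = none := fun x hx => h2 x (List.mem_reverse.1 hx)
  have hset : ∀ s', c.tape.set c.head s' =
      l₁.filterMap Prod.fst ++ s' :: l₂.filterMap Prod.fst := by
    intro s'; rw [h4, h5]; simp
  cases hact : M.action c.state s with
  | none =>
    left
    constructor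
    · have e1 : rightAction M c.state s = none := by simp [rightAction, hact]
      have e2 : leftAction M c.state s = none := by simp [leftAction, hact]
      have e3 : mealy (headPass (rightAction M)) .search (l₁ ++ (some s, some c.state) :: l₂) =
          (.search, l₁ ++ (some s, some c.state) :: l₂) := by
        rw [mealy_headPass h1]
        simp [headPass, e1, mealy_headPass_search h2]
      have e4 : mealy (headPass (leftAction M)) .search
          (l₂.reverse ++ (some s, some c.state) :: l₁.reverse) =
          (.search, l₂.reverse ++ (some s, some c.state) :: l₁.reverse) := by
        rw [mealy_headPass h2']
        simp [headPass, e2, mealy_headPass_search h1']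
      have e5 : (l₁ ++ (some s, some c.state) :: l₂).reverse =
        l₂.reverse ++ (some s, some c.state) :: l₁.reverse := by simp
      simp only [simStep, e3, e5, e4]
      simp
    · rintro c' ⟨s₁, q', s', m, h8, h9, -⟩
      obtain rfl : s = s₁ := by simpa [hs] using h8
      rw [hM.mem_trans, hact] at h9
      cases h9
  | some p =>
    obtain ⟨q', s', m⟩ := p
    right
    have hmem := hM.mem_trans.2 hact
    refine ⟨_, ⟨s, q', s', m, hs, hmem, rfl⟩, ?_, ?_⟩
    · rintro c'' ⟨s₁, q₁, s₁', m₁, h8, h9, h10⟩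
      obtain rfl : s = s₁ := by simpa [hs] using h8
      rw [hM.mem_trans, hact] at h9
      cases h9
      exact h10
    -- End markers are never overwritten, so they remain the outermost symbols.
    · have hends : (l₁.filterMap Prod.fst ++ s' :: l₂.filterMap Prod.fst).head? = some .leftEnd ∧
          (l₁.filterMap Prod.fst ++ s' :: l₂.filterMap Prod.fst).getLast? = some .rightEnd := by
        rw [h4] at h6 h7
        constructor
        · cases h8 : l₁.filterMap Prod.fst with
          | nil =>
            rw [h8] at h6
            obtain rfl : s = .leftEnd := by simpa using h6
            simpa using (M.trans_leftEnd _ _ _ _ hmem).1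
          | cons => rw [h8] at h6; simpa using h6
        · rcases List.eq_nil_or_concat (l₂.filterMap Prod.fst) with h8 | ⟨w, t, h8⟩
          · rw [h8] at h7 ⊢
            obtain rfl : s = .rightEnd := by simpa using h7
            simpa using (M.trans_rightEnd _ _ _ _ hmem).1
          · rw [h8] at h7 ⊢
            rw [List.concat_eq_append, ← List.cons_append, ← List.append_assoc,
              List.getLast?_concat] at h7 ⊢
            exact h7
      cases m with
      | stay =>
        have e1 : rightAction M c.state s = some (q', s', false) := by simp [rightAction, hact]
        have e3 : simStep M (l₁ ++ (some s, some c.state) :: l₂) =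
            l₁ ++ (some s', some q') :: l₂ := by
          have : mealy (headPass (rightAction M)) .search (l₁ ++ (some s, some c.state) :: l₂) =
              (.finished, l₁ ++ (some s', some q') :: l₂) := by
            rw [mealy_headPass h1]
            simp [headPass, e1, mealy_headPass_finished]
          simp only [simStep, this]
        rw [e3]
        refine ⟨l₁, s', l₂, h1, h2, rfl, hset s', h5, ?_⟩
        dsimp only
        rwa [hset]
      | right =>
        have e1 : rightAction M c.state s = some (q', s', true) := by simp [rightAction, hact]
        cases h8 : l₂.filterMap Prod.fst with
        | nil =>
          -- With no symbol to the right, the scanned one is the right marker, from which the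
          -- machine does not move right.
          rw [h4, h8] at h7
          obtain rfl : s = .rightEnd := by simpa using h7
          exact absurd rfl (M.trans_rightEnd _ _ _ _ hmem).2
        | cons t w =>
          obtain ⟨a, b, g1, g2, g3, g4, g5⟩ :=
            mealy_headPass_carry (act := rightAction M) (q := q') h2 h8
          have e3 : simStep M (l₁ ++ (some s, some c.state) :: l₂) =
              l₁ ++ (some s', none) :: (a ++ (some t, some q') :: b) := by
            have : mealy (headPass (rightAction M)) .search (l₁ ++ (some s, some c.state) :: l₂) =
                (.finished, l₁ ++ (some s', none) :: (a ++ (some t, some q') :: b)) := by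
              rw [mealy_headPass h1]
              simp [headPass, e1, g5]
            simp only [simStep, this]
          rw [e3]
          refine ⟨l₁ ++ (some s', none) :: a, t, b, ?_, g2, by simp, ?_, ?_, ?_⟩
          · intro x hx
            simp only [List.mem_append, List.mem_cons] at hx
            rcases hx with hx | rfl | hx
            exacts [h1 x hx, rfl, g1 x hx]
          · simp [hset, g3, g4, h8]
          · simp [HeadMove.apply, h5, g3]
          · dsimp only
            rwa [hset]
      | left =>
        have e1 : rightAction M c.state s = none := by simp [rightAction, hact]
        have e2 : leftAction M c.state s = some (q', s', true) := by simp [leftAction, hact]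
        cases h8 : l₁.reverse.filterMap Prod.fst with
        | nil =>
          rw [List.filterMap_reverse, List.reverse_eq_nil_iff] at h8
          rw [h4, h8] at h6
          obtain rfl : s = .leftEnd := by simpa using h6
          exact absurd rfl (M.trans_leftEnd _ _ _ _ hmem).2
        | cons t w =>
          obtain ⟨a, b, g1, g2, g3, g4, g5⟩ :=
            mealy_headPass_carry (act := leftAction M) (q := q') h1' h8
          have e3 : simStep M (l₁ ++ (some s, some c.state) :: l₂) =
              b.reverse ++ (some t, some q') :: (a.reverse ++ (some s', none) :: l₂) := by
            have e4 : mealy (headPass (rightAction M)) .search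
                (l₁ ++ (some s, some c.state) :: l₂) =
                (.search, l₁ ++ (some s, some c.state) :: l₂) := by
              rw [mealy_headPass h1]
              simp [headPass, e1, mealy_headPass_search h2]
            have e5 : mealy (headPass (leftAction M)) .search
                (l₂.reverse ++ (some s, some c.state) :: l₁.reverse) =
                (.finished, l₂.reverse ++ (some s', none) :: (a ++ (some t, some q') :: b)) := by
              rw [mealy_headPass h2']
              simp [headPass, e2, g5]
            have e6 : (l₁ ++ (some s, some c.state) :: l₂).reverse =
              l₂.reverse ++ (some s, some c.state) :: l₁.reverse := by simp
            simp only [simStep, e4, e6, e5]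
            simp
          have h9 : l₁.filterMap Prod.fst = w.reverse ++ [t] := by
            rw [List.filterMap_reverse] at h8
            rw [← List.reverse_reverse (List.filterMap _ _), h8]; simp
          rw [e3]
          refine ⟨b.reverse, t, a.reverse ++ (some s', none) :: l₂, ?_, ?_, rfl, ?_, ?_, ?_⟩
          · intro x hx; exact g2 x (List.mem_reverse.1 hx)
          · intro x hx
            simp only [List.mem_append, List.mem_cons, List.mem_reverse] at hx
            rcases hx with hx | rfl | hx
            exacts [g1 x hx, rfl, h2 x hx]
          · simp [hset, List.filterMap_reverse, g3, g4, h9]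
          · simp [HeadMove.apply, h5, h9, List.filterMap_reverse, g4]
          · dsimp only
            rwa [hset]

end

end TapeProgram

/-! ### Running time and membership test for deterministic automata -/

/-- Within a finite set of configurations, the first time at which `P` holds is small. -/
theorem exists_iterate_lt {X : Type*} (f : X → X) (P : X → Prop) (v : X → ℕ) {n : ℕ} {x : X}
    (hv : ∀ i, v (f^[i] x) < n)
    (hinj : ∀ i j, v (f^[i] x) = v (f^[j] x) → f^[i] x = f^[j] x) (h : ∃ i, P (f^[i] x)) :
    ∃ i < n, P (f^[i] x) := by
  classical
  refine ⟨Nat.find h, ?_, Nat.find_spec h⟩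
  by_contra hn
  -- Pigeonhole: if the first success came at time `n` or later, two configurations up to that time
  -- would have the same number.
  obtain ⟨i, hi, j, hj, hij, heq⟩ := Finset.exists_ne_map_eq_of_card_lt_of_maps_to
    (s := Finset.range (Nat.find h + 1)) (t := Finset.range n) 
    (by rw [Finset.card_range, Finset.card_range]; omega) (f := fun i => v (f^[i] x)) (fun i _ => by simpa using hv i)
  simp only [Finset.mem_range] at hi hj
  wlog hlt : i < j generalizing i j
  · exact this j i hij.symm heq.symm hj hi (by omega)
  -- Cutting out the cycle from `i` to `j` gives an earlier success.
  refine Nat.find_min h (m := Nat.find h - j + i) (by omega) ?_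
  rw [Function.iterate_add_apply, hinj _ _ heq, ← Function.iterate_add_apply]
  convert Nat.find_spec h using 3
  omega

namespace TapeProgram

section

variable {A : Type*} {M : LBA A}

/-- The tape shows an accepting state. -/
def ShowsAccepting (l : List (SimCell M)) : Prop := ∃ x ∈ l, ∃ q ∈ M.accepting, x.2 = some q

theorem Represents.showsAccepting_iff {l : List (SimCell M)} {c : M.Cfg} (h : Represents M l c) :
    ShowsAccepting l ↔ c.state ∈ M.accepting := by
  obtain ⟨l₁, s, l₂, h1, h2, rfl, -⟩ := h
  constructor
  · rintro ⟨x, hx, q, hq, hxq⟩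
    simp only [List.mem_append, List.mem_cons] at hx
    rcases hx with hx | rfl | hx
    · simp [h1 x hx] at hxq
    · simp only [Option.some.injEq] at hxq
      rwa [hxq]
    · simp [h2 x hx] at hxq
  · intro h
    exact ⟨(some s, some c.state), by simp, _, h, rfl⟩

theorem exists_represents (hM : M.Deterministic) {l : List (SimCell M)} {c : M.Cfg}
    (h : Represents M l c) (i : ℕ) : ∃ c', M.Reaches c c' ∧ Represents M ((simStep M)^[i] l) c' := by
  induction i with
  | zero => exact ⟨c, .refl, h⟩
  | succ i ih =>
    obtain ⟨c', h1, h2⟩ := ih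
    rw [Function.iterate_succ_apply']
    rcases simStep_cases hM h2 with ⟨h3, -⟩ | ⟨c'', h3, -, h4⟩
    · exact ⟨c', h1, h3.symm ▸ h2⟩
    · exact ⟨c'', h1.tail h3, h4⟩

/-- Since the machine is deterministic, its whole computation is represented along the orbit of
`simStep`. -/
theorem exists_represents_of_reaches (hM : M.Deterministic) {l : List (SimCell M)} {c c' : M.Cfg}
    (h : Represents M l c) (hc : M.Reaches c c') : ∃ i, Represents M ((simStep M)^[i] l) c' := by
  induction hc with
  | refl => exact ⟨0, h⟩
  | tail _ h1 ih =>
    obtain ⟨i, hi⟩ := ih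
    rcases simStep_cases hM hi with ⟨-, h2⟩ | ⟨c₁, -, h2, h3⟩
    · exact absurd h1 (h2 _)
    · refine ⟨i + 1, ?_⟩
      rw [Function.iterate_succ_apply', h2 _ h1]
      exact h3

theorem length_simStep (l : List (SimCell M)) : (simStep M l).length = l.length := by
  unfold simStep
  split <;> rename_i h
  · rw [← length_mealy (headPass (rightAction M)) .search l, h]
  · rw [List.length_reverse, length_mealy, List.length_reverse,
      ← length_mealy (headPass (rightAction M)) .search l, h]

/-- The body of the simulating loop. -/
def simBody (M : LBA A) : TapeProgram (SimCell M) (Option Unit) := fun l o l' =>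
  ShowsAccepting l ∧ o = some () ∧ l' = l ∨ ¬ ShowsAccepting l ∧ o = none ∧ l' = simStep M l

theorem implementable_simBody {d : Prop} : Implementable d (simBody M) := by
  classical
  have := M.finite_State
  convert (implementable_scan (d := d) (fun (b : Bool) (x : SimCell M) =>
      b || decide (∃ q ∈ M.accepting, x.2 = some q)) false).bind
    (S := fun b => if b then return' (some ()) else
      bind (fun l r l' => mealy (headPass (rightAction M)) .search l = (r, l')) fun r =>
        match r with
        | .finished => return' none
        | _ => bind (fun l r l' => mealy (headPass (leftAction M)) .search l.reverse =
            (r, l'.reverse)) fun _ => return' none) ?_ using 1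
  · have hscan : ∀ (l : List (SimCell M)) (b : Bool), l.foldl (fun (b : Bool) (x : SimCell M) =>
        b || decide (∃ q ∈ M.accepting, x.2 = some q)) b = true ↔
          b = true ∨ ShowsAccepting l := by
      intro l
      induction l with
      | nil => simp [ShowsAccepting]
      | cons x l ih =>
        intro b
        rw [List.foldl_cons, ih]
        simp [ShowsAccepting, or_assoc]
    ext l o l'
    by_cases h : ShowsAccepting l
    · have h1 := (hscan l false).2 (.inr h)
      constructor
      · rintro (⟨-, rfl, rfl⟩ | ⟨h', -⟩)
        · exact ⟨_, _, ⟨rfl, rfl⟩, by rw [h1]; exact ⟨rfl, rfl⟩⟩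
        · exact absurd h h'
      · rintro ⟨_, _, ⟨rfl, rfl⟩, h2⟩
        rw [h1] at h2
        exact .inl ⟨h, h2⟩
    · have h1 := (hscan l false).not.2 (by simp [h])
      rw [Bool.not_eq_true] at h1
      have key : (bind (fun l r l' => mealy (headPass (rightAction M)) .search l = (r, l'))
          fun r => match r with
          | .finished => return' none
          | _ => bind (fun l r l' => mealy (headPass (leftAction M)) .search l.reverse =
              (r, l'.reverse)) fun _ => return' none) l o l' ↔
          (o : Option Unit) = none ∧ l' = simStep M l := by
        unfold simStep
        constructor
        · rintro ⟨r, l₁, h2, h3⟩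
          rw [h2]
          cases r with
          | finished => exact h3
          | search =>
            obtain ⟨r', l₂, h4, rfl, rfl⟩ := h3
            exact ⟨rfl, by simp [h4]⟩
          | carry q =>
            obtain ⟨r', l₂, h4, rfl, rfl⟩ := h3
            exact ⟨rfl, by simp [h4]⟩
        · rintro ⟨rfl, h3⟩
          refine ⟨_, _, rfl, ?_⟩
          revert h3
          generalize mealy (headPass (rightAction M)) .search l = p
          obtain ⟨r, l₁⟩ := p
          rintro rfl
          cases r with
          | finished => exact ⟨rfl, rfl⟩
          | search => exact ⟨_, _, Prod.ext rfl (List.reverse_reverse _).symm, rfl, rfl⟩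
          | carry q => exact ⟨_, _, Prod.ext rfl (List.reverse_reverse _).symm, rfl, rfl⟩
      constructor
      · rintro (⟨h', -⟩ | ⟨-, h2⟩)
        · exact absurd h' h
        · exact ⟨_, _, ⟨rfl, rfl⟩, by rw [h1]; exact key.2 h2⟩
      · rintro ⟨_, _, ⟨rfl, rfl⟩, h2⟩
        rw [h1] at h2
        exact .inr ⟨h, key.1 h2⟩
  · intro b
    cases b
    · refine (implementable_mealy _ _).bind fun r => ?_
      cases r with
      | finished => exact implementable_return _
      | search => exact (implementable_mealy_reverse _ _).bind fun _ => implementable_return _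
      | carry => exact (implementable_mealy_reverse _ _).bind fun _ => implementable_return _
    · exact implementable_return _

/-- Replace the blanks at both ends by end markers, and put the head on the first cell. -/
noncomputable def simInit (M : LBA A) : TapeProgram (SimCell M) Bool :=
  bind (fun l r l' => mealy (replaceFirst (none, none) (some .leftEnd, some M.start)) none l =
    (r, l')) fun r => if r = some true then
      bind (fun l r l' => mealy (replaceFirst (none, none) (some .rightEnd, none)) none l.reverse =
        (r, l'.reverse)) fun r => return' (decide (r = some true))
    else return' false

theorem implementable_simInit {d : Prop} : Implementable d (simInit M) := by
  refine (implementable_mealy _ _).bind fun r => ?_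
  split_ifs
  · exact (implementable_mealy_reverse _ _).bind fun _ => implementable_return _
  · exact implementable_return _

theorem exists_simInit (l : List (SimCell M)) : ∃ b l', simInit M l b l' := by
  let p := mealy (replaceFirst (none, none) (some .leftEnd, some M.start)) none l
  have : ∃ b l', (if p.1 = some true then
      bind (fun l r l' => mealy (replaceFirst (none, none) (some .rightEnd, none)) none l.reverse =
        (r, l'.reverse)) fun r => return' (decide (r = some true))
    else return' false : TapeProgram (SimCell M) Bool) p.2 b l' := by
    split_ifs
    · exact ⟨_, _, _, _, Prod.ext rfl (List.reverse_reverse _).symm, rfl, rfl⟩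
    · exact ⟨_, _, rfl, rfl⟩
  obtain ⟨b, l', h⟩ := this
  exact ⟨b, l', p.1, p.2, rfl, h⟩

theorem simInit_true_iff {l l' : List (SimCell M)} : simInit M l true l' ↔
    ∃ m, l = (none, none) :: (m ++ [(none, none)]) ∧
      l' = (some .leftEnd, some M.start) :: (m ++ [(some .rightEnd, none)]) := by
  constructor
  · rintro ⟨r, l₁, h1, h2⟩
    split_ifs at h2 with h3
    · subst h3
      obtain ⟨m, rfl, rfl⟩ := mealy_replaceFirst.1 h1
      obtain ⟨r, l₂, h4, h5, rfl⟩ := h2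
      obtain rfl : r = some true := of_decide_eq_true h5.symm
      obtain ⟨n, h6, h7⟩ := mealy_replaceFirst.1 h4
      have h8 := congrArg List.reverse h6
      have h9 := congrArg List.reverse h7
      rw [List.reverse_reverse, List.reverse_cons] at h8 h9
      obtain ⟨k, rfl⟩ : ∃ k, n = k.reverse := ⟨n.reverse, by simp⟩
      cases k with
      -- A tape of length one fails: the left marker has already taken its only blank.
      | nil => simp at h8
      | cons x k =>
        simp only [List.reverse_reverse, List.cons_append, List.cons.injEq] at h8 h9
        obtain ⟨rfl, rfl⟩ := h8
        exact ⟨k, rfl, h9⟩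
    · simp [return'] at h2
  · rintro ⟨m, rfl, rfl⟩
    refine ⟨some true, _, mealy_replaceFirst.2 ⟨_, rfl, rfl⟩, ?_⟩
    dsimp only
    rw [if_pos rfl]
    refine ⟨some true, _, mealy_replaceFirst.2 ⟨m.reverse ++ [(some .leftEnd, some M.start)], ?_, ?_⟩,
      by simp, rfl⟩ <;> simp

end

/-- The language of a deterministic linear bounded automaton has a deterministic membership test
that always terminates. -/
theorem membershipTest_of_isDeterministicLBALanguage {A : Type*} [Finite A] {L : Language A}
    (h : L.IsDeterministicLBALanguage) : MembershipTest True L := by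
  classical
  obtain ⟨M, hM, rfl⟩ := h
  have := M.finite_State
  have : Finite (TapeSymbol A M.Work) := by
    have := M.finite_Work
    refine Finite.of_surjective (fun x : Option (Option (A ⊕ M.Work)) => match x with
      | none => TapeSymbol.leftEnd
      | some none => .rightEnd
      | some (some (.inl a)) => .input a
      | some (some (.inr s)) => .work s) ?_
    rintro (_ | _ | a | s)
    exacts [⟨none, rfl⟩, ⟨some none, rfl⟩, ⟨some (some (.inl a)), rfl⟩,
      ⟨some (some (.inr s)), rfl⟩]
  -- The counter digits run through as many values as a simulation cell, so the clock has one value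
  -- for each possible simulation tape of the given length.
  obtain ⟨k, ⟨η⟩⟩ := Finite.exists_equiv_fin (SimCell M)
  have hk : 0 < k := (η (none, none)).pos
  let e : SimCell M × Fin k ≃ SimCell M × Fin k := Equiv.refl _
  let e' : SimCell M × Fin k ≃ Fin k × SimCell M := Equiv.prodComm _ _
  let body : TapeProgram (SimCell M × Fin k) (Option Unit) := onTrack e (simBody M)
  let enc : Option A → SimCell M × Fin k := fun x => ((x.map .input, none), ⟨0, hk⟩)
  have hbody : Implementable True body := implementable_simBody.onTrack e
  have hcells : ∀ {l o l'}, body l o l' ↔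
      (ShowsAccepting (l.map Prod.fst) ∧ o = some () ∧ l'.map Prod.fst = l.map Prod.fst ∨
        ¬ ShowsAccepting (l.map Prod.fst) ∧ o = none ∧
          l'.map Prod.fst = simStep M (l.map Prod.fst)) ∧
      l'.map Prod.snd = l.map Prod.snd := Iff.rfl
  have htotal : ∀ l, ∃ o l', body l o l' := by
    intro l
    by_cases h : ShowsAccepting (l.map Prod.fst)
    · obtain ⟨l', h1, -⟩ := (implementable_simBody (d := True)).exists_onTrack e (l := l)
        (.inl ⟨h, rfl, rfl⟩)
      exact ⟨_, _, h1⟩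
    · obtain ⟨l', h1, -⟩ := (implementable_simBody (d := True)).exists_onTrack e (l := l)
        (.inr ⟨h, rfl, rfl⟩)
      exact ⟨_, _, h1⟩
  have hincr : ∀ {l b l'}, increment (Equiv.refl (Fin k)) e' l b l' →
      l'.map Prod.fst = l.map Prod.fst := fun h => (increment_spec h).1
  have hfilter : ∀ v : List (Option A), ((v.map enc).map Prod.fst).filterMap Prod.fst =
      v.reduceOption.map TapeSymbol.input := by
    intro v
    induction v with
    | nil => rfl
    | cons x v ih =>
      cases x
      · simpa [enc] using ih
      · simpa [enc] using ih
  have hunmarked : ∀ v : List (Option A), ∀ x ∈ (v.map enc).map Prod.fst, x.2 = none := by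
    simp [enc]
  have hinit : ∀ v : List (Option A), Represents M ((some .leftEnd, some M.start) ::
      ((v.map enc).map Prod.fst ++ [(some .rightEnd, none)])) (M.init v.reduceOption) := by
    intro v
    refine ⟨[], .leftEnd, (v.map enc).map Prod.fst ++ [(some .rightEnd, none)], by simp, ?_, rfl,
      ?_, rfl, rfl, ?_⟩
    · intro x hx
      rcases List.mem_append.1 hx with hx | hx
      · exact hunmarked v x hx
      · simp only [List.mem_singleton] at hx
        rw [hx]
    · rw [List.filterMap_append, hfilter]
      rfl
    · change (_ :: (_ ++ [_])).getLast? = _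
      rw [← List.cons_append, List.getLast?_concat]
  let prog : TapeProgram (SimCell M × Fin k) Bool :=
    bind (onTrack e (simInit M)) fun b => if b then
      bind (clockedLoop (Equiv.refl (Fin k)) e' body) fun o => return' o.isSome
    else return' false
  refine ⟨SimCell M × Fin k, inferInstance, enc, prog, ?_, ?_, ?_, ?_⟩
  · refine (implementable_simInit.onTrack e).bind fun b => ?_
    split_ifs
    · exact hbody.clockedLoop.bind fun o => implementable_return _
    · exact implementable_return _
  · rintro v l' ⟨b, l₁, h1, h2⟩
    cases b
    · simp [return'] at h2
    obtain ⟨o, l₂, h3, h4, rfl⟩ := h2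
    obtain ⟨m, h5, h6⟩ := simInit_true_iff.1 h1.1
    -- Initialization succeeded, so both end cells were blank; they now hold the markers, and the
    -- letters in between are unaffected.
    obtain ⟨v', rfl, rfl⟩ : ∃ v', v = none :: (v' ++ [none]) ∧ m = (v'.map enc).map Prod.fst := by
      change (v.map enc).map Prod.fst = _ at h5
      have henc : ∀ x, (enc x).1 = (none, none) → x = none := by
        intro x hx
        cases x <;> simp_all [enc]
      rw [List.map_map] at h5
      obtain ⟨x, v, rfl, hx, h7⟩ := List.map_eq_cons_iff.1 h5
      obtain ⟨v', w, rfl, rfl, h8⟩ := List.map_eq_append_iff.1 h7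
      obtain ⟨y, w, rfl, hy, h9⟩ := List.map_eq_cons_iff.1 h8
      obtain rfl := List.map_eq_nil_iff.1 h9
      exact ⟨v', by rw [henc x hx, henc y hy], by simp⟩
    have hrep := hinit v'
    rw [← h6] at hrep
    have H := clockedLoop_induction (fun m => ∃ i, m.map Prod.fst = (simStep M)^[i] (l₁.map Prod.fst))
      (fun _ _ => ∃ i, ShowsAccepting ((simStep M)^[i] (l₁.map Prod.fst))) ?_ ?_ ⟨0, rfl⟩ h3
    · obtain ⟨r, rfl⟩ := Option.isSome_iff_exists.1 h4.symm
      obtain ⟨i, hi⟩ := H.1 r rfl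
      obtain ⟨c, hc, hci⟩ := exists_represents hM hrep i
      have hv : (none :: (v' ++ [none])).reduceOption = v'.reduceOption := by
        simp [List.reduceOption_append]
      rw [hv]
      exact ⟨c, hc, hci.showsAccepting_iff.1 hi⟩
    · rintro m r m' ⟨i, hi⟩ ⟨⟨h, -⟩ | ⟨-, h, -⟩, -⟩
      · exact ⟨i, hi ▸ h⟩
      · cases h
    · rintro m m' b m'' ⟨i, hi⟩ ⟨⟨-, h, -⟩ | ⟨-, -, h⟩, -⟩ h'
      · cases h
      · refine ⟨i + 1, ?_⟩
        rw [Function.iterate_succ_apply', ← hi]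
        exact (hincr h').trans h
  · intro v hv
    have h0 : simInit M (((none :: (v ++ [none])).map enc).map Prod.fst) true
        ((some .leftEnd, some M.start) :: ((v.map enc).map Prod.fst ++ [(some .rightEnd, none)])) :=
      simInit_true_iff.2 ⟨(v.map enc).map Prod.fst, by simp [enc], rfl⟩
    obtain ⟨l₁, h1, h2⟩ := (implementable_simInit (d := True)).exists_onTrack e h0
    have hrep := hinit v
    obtain ⟨c, hc, hacc⟩ := hv
    set x := (some .leftEnd, some M.start) :: ((v.map enc).map Prod.fst ++ [(some .rightEnd, none)])
      with hx
    change l₁.map Prod.fst = x at h2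
    have hlen : ∀ i, ((simStep M)^[i] x).length = l₁.length := by
      intro i
      induction i with
      | zero => rw [Function.iterate_zero_apply, ← h2, List.length_map]
      | succ i ih => rw [Function.iterate_succ_apply', length_simStep, ih]
    -- Reading a simulation tape as a numeral to base `k` numbers the tapes injectively, so an
    -- accepting one appears before time `k ^ l₁.length`.
    obtain ⟨n, hn, hshow⟩ := exists_iterate_lt (simStep M) ShowsAccepting (counterValue η)
      (n := k ^ l₁.length) (x := x) (fun i => hlen i ▸ counterValue_lt η _)
      (fun i j h => counterValue_injective η (by rw [hlen, hlen]) h) (by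
        obtain ⟨i, hi⟩ := exists_represents_of_reaches hM hrep hc
        exact ⟨i, hi.showsAccepting_iff.2 hacc⟩)
    have H := exists_clockedLoop (η := Equiv.refl (Fin k)) (e := e') (R := body)
      (fun m => m.length = l₁.length ∧ ∃ i ≤ n, m.map Prod.fst = (simStep M)^[i] x ∧
        counterValue (Equiv.refl (Fin k)) (m.map Prod.snd) = i)
      (fun o _ => o.isSome = true) ?_ (l := l₁) ⟨rfl, 0, Nat.zero_le _, h2, ?_⟩
    · obtain ⟨o, l', h3, h4⟩ := H
      exact ⟨l', true, l₁, h1, o, l', h3, h4.symm, rfl⟩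
    · rintro m ⟨hm, i, hi, h3, h4⟩
      obtain ⟨o, m', h5⟩ := htotal m
      have hm' := hbody.length_eq h5
      obtain ⟨⟨h6, rfl, h7⟩ | ⟨h6, rfl, h7⟩, h8⟩ := hcells.1 h5
      · exact .inl ⟨_, _, h5, rfl⟩
      · refine .inr ⟨_, h5, hm', h8, fun b m'' h9 => ?_⟩
        have hne : i ≠ n := by
          rintro rfl
          exact h6 (h3 ▸ hshow)
        have h10 := (increment_spec h9).2
        have h11 : counterValue (Equiv.refl (Fin k)) (m'.map fun x => (e' x).1) = i := by
          rw [← h4]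
          exact congrArg _ h8
        rw [h11, hm', hm] at h10
        cases b
        · simp only [Bool.false_eq_true, if_false, add_zero] at h10 ⊢
          refine ⟨?_, i + 1, by omega, ?_, h10⟩
          · rw [← hm, ← hm']
            simpa using congrArg List.length (hincr h9)
          · rw [hincr h9, h7, h3, Function.iterate_succ_apply']
        · simp only [if_true] at h10
          omega
    · have h3 : l₁.map Prod.snd = ((none :: (v ++ [none])).map enc).map Prod.snd := h1.2
      rw [h3, List.map_map]
      exact counterValue_map_zero _ hk _
  · rintro - v
    obtain ⟨b, m, h1⟩ := exists_simInit ((v.map enc).map Prod.fst)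
    obtain ⟨l₁, h2, -⟩ := (implementable_simInit (d := True)).exists_onTrack e h1
    cases b
    · exact ⟨_, _, _, _, h2, rfl, rfl⟩
    · have H := exists_clockedLoop (η := Equiv.refl (Fin k)) (e := e') (R := body)
        (fun m => True) (fun o _ => True) ?_ (l := l₁) trivial
      · obtain ⟨o, l', h3, -⟩ := H
        exact ⟨_, _, _, _, h2, _, _, h3, rfl, rfl⟩
      · intro m _
        obtain ⟨o, m', h4⟩ := htotal m
        cases o with
        | some r => exact .inl ⟨_, _, h4, trivial⟩
        | none => exact .inr ⟨_, h4, hbody.length_eq h4, h4.2, by simp⟩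

end TapeProgram

/-! ### Word length and distance in the Cayley graph -/

section

variable {G : Type*} [Group G] {A : Type*} {val : A → G}

theorem evalWord_append (w w' : List A) :
    evalWord val (w ++ w') = evalWord val w * evalWord val w' := by
  simp [evalWord]

theorem evalWord_cons (a : A) (w : List A) : evalWord val (a :: w) = val a * evalWord val w := by
  simp [evalWord]

theorem evalWord_nil : evalWord val ([] : List A) = 1 := rfl

theorem wordLength_evalWord_le (w : List A) : wordLength val (evalWord val w) ≤ w.length :=
  Nat.sInf_le ⟨w, rfl, rfl⟩

theorem exists_evalWord_eq (hgen : Submonoid.closure (Set.range val) = ⊤) (g : G) :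
    ∃ w, evalWord val w = g := by
  have hg : g ∈ Submonoid.closure (Set.range val) := hgen ▸ Submonoid.mem_top g
  induction hg using Submonoid.closure_induction with
  | mem x hx =>
    obtain ⟨a, rfl⟩ := hx
    exact ⟨[a], by simp [evalWord]⟩
  | one => exact ⟨[], rfl⟩
  | mul x y _ _ hx hy =>
    obtain ⟨u, rfl⟩ := hx
    obtain ⟨v, rfl⟩ := hy
    exact ⟨u ++ v, evalWord_append u v⟩

theorem exists_evalWord_eq_length (hgen : Submonoid.closure (Set.range val) = ⊤) (g : G) :
    ∃ w, evalWord val w = g ∧ w.length = wordLength val g := by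
  obtain ⟨w, hw⟩ := exists_evalWord_eq hgen g
  exact Nat.sInf_mem (s := {n | ∃ w : List A, evalWord val w = g ∧ w.length = n}) ⟨_, w, hw, rfl⟩

theorem wordLength_mul_le (hgen : Submonoid.closure (Set.range val) = ⊤) (g h : G) :
    wordLength val (g * h) ≤ wordLength val g + wordLength val h := by
  obtain ⟨u, hu, hu'⟩ := exists_evalWord_eq_length hgen g
  obtain ⟨v, hv, hv'⟩ := exists_evalWord_eq_length hgen h
  calc wordLength val (g * h) = wordLength val (evalWord val (u ++ v)) := by
        rw [evalWord_append, hu, hv]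
    _ ≤ (u ++ v).length := wordLength_evalWord_le _
    _ = _ := by rw [List.length_append, hu', hv']

theorem wordLength_one : wordLength val (1 : G) = 0 :=
  Nat.le_zero.1 (wordLength_evalWord_le (val := val) [])

theorem wordLength_val_le (a : A) : wordLength val (val a) ≤ 1 := by
  have := wordLength_evalWord_le (val := val) [a]
  simpa [evalWord] using this

theorem finite_setOf_wordLength_le [Finite A] (hgen : Submonoid.closure (Set.range val) = ⊤)
    (n : ℕ) : {g : G | wordLength val g ≤ n}.Finite := by
  refine ((List.finite_length_le A n).image (evalWord val)).subset ?_
  intro g hg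
  obtain ⟨w, hw, hw'⟩ := exists_evalWord_eq_length hgen g
  exact ⟨w, hw'.trans_le hg, hw⟩

/-- The initial vertex of the edge on which a point lies. -/
def CayleyPoint.base : CayleyPoint G A → G
  | .vertex g => g
  | .edge g _ _ => g

theorem base_wordPath (w : List A) (t : ℝ≥0) :
    (wordPath val w t).base = evalWord val (w.take ⌊t⌋₊) := by
  unfold wordPath
  split
  · rfl
  · rename_i h
    rw [List.getElem?_eq_none_iff] at h
    rw [List.take_of_length_le h]
    rfl

theorem exists_mem_ends (p : CayleyPoint G A) : ∃ x, x ∈ p.ends val := by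
  cases p with
  | vertex g => exact ⟨_, rfl⟩
  | edge g a s => exact ⟨_, .inl rfl⟩

theorem ends_wordPath {w : List A} {t : ℝ≥0} {x : G × ℝ} (hx : x ∈ (wordPath val w t).ends val) :
    0 ≤ x.2 ∧ (x.1 = (wordPath val w t).base ∨ ∃ a, x.1 = (wordPath val w t).base * val a) := by
  unfold wordPath at hx ⊢
  split at hx
  · rename_i h
    have h1 : (⌊t⌋₊ : ℝ) ≤ t := by exact_mod_cast Nat.floor_le t.2
    have h2 : (t : ℝ) < ⌊t⌋₊ + 1 := by exact_mod_cast Nat.lt_floor_add_one t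
    rcases hx with rfl | rfl
    · exact ⟨by simpa using h1, .inl rfl⟩
    · exact ⟨by simp only; linarith, .inr ⟨_, rfl⟩⟩
  · rename_i h
    obtain rfl := hx
    exact ⟨le_rfl, .inl rfl⟩

/-- A connection between the two points runs through end vertices of their edges, and each of these
is at most one letter away from the base, which costs 2. Edge segments have nonnegative length, so
the vertex distance is bounded as well. Points on a common edge have the same base. -/
theorem wordLength_base_le (hgen : Submonoid.closure (Set.range val) = ⊤)
    (ι : A → A) (hval : ∀ a, val (ι a) = (val a)⁻¹) {w w' : List A} {t u : ℝ≥0} {K : ℝ}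
    (h : cayleyDist val (wordPath val w t) (wordPath val w' u) ≤ K) :
    wordLength val ((evalWord val (w.take ⌊t⌋₊))⁻¹ * evalWord val (w'.take ⌊u⌋₊)) ≤
      ⌈K + 1⌉₊ + 2 := by
  have hinv : ∀ a, wordLength val (val a)⁻¹ ≤ 1 := fun a => hval a ▸ wordLength_val_le (ι a)
  rw [← base_wordPath, ← base_wordPath]
  obtain ⟨x₀, hx₀⟩ := exists_mem_ends (val := val) (wordPath val w t)
  obtain ⟨y₀, hy₀⟩ := exists_mem_ends (val := val) (wordPath val w' u)
  -- The distance is an infimum, and `K + 1` leaves room to pick an actual connection without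
  -- showing that the infimum is attained.
  obtain ⟨r, hr, hrK⟩ := exists_lt_of_csInf_lt ⟨_, .inl ⟨x₀, hx₀, y₀, hy₀, rfl⟩⟩
    (h.trans_lt (lt_add_one K))
  rcases hr with ⟨x, hx, y, hy, rfl⟩ | ⟨g, a, s, s', h1, h2, -⟩
  · obtain ⟨hx0, hx1⟩ := ends_wordPath hx
    obtain ⟨hy0, hy1⟩ := ends_wordPath hy
    have hd : wordLength val (x.1⁻¹ * y.1) ≤ ⌈K + 1⌉₊ := by
      have h3 : ((wordDist val x.1 y.1 : ℕ) : ℝ) ≤ ⌈K + 1⌉₊ :=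
        (by linarith : (wordDist val x.1 y.1 : ℝ) ≤ K + 1).trans (Nat.le_ceil _)
      exact_mod_cast h3
    obtain ⟨k, hk, hk'⟩ : ∃ k, wordLength val k ≤ 1 ∧ x.1 = (wordPath val w t).base * k := by
      rcases hx1 with h3 | ⟨a, h3⟩
      · exact ⟨1, by rw [wordLength_one]; exact zero_le_one, by rw [h3, mul_one]⟩
      · exact ⟨_, wordLength_val_le a, h3⟩
    obtain ⟨k', hl, hl'⟩ : ∃ k, wordLength val k ≤ 1 ∧ (wordPath val w' u).base = y.1 * k := by
      rcases hy1 with h3 | ⟨a, h3⟩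
      · exact ⟨1, by rw [wordLength_one]; exact zero_le_one, by rw [h3, mul_one]⟩
      · exact ⟨_, hinv a, by rw [h3]; group⟩
    have h3 : (wordPath val w t).base⁻¹ * (wordPath val w' u).base =
        k * (x.1⁻¹ * y.1) * k' := by
      rw [hl', hk']; group
    rw [h3]
    have h4 := wordLength_mul_le hgen (k * (x.1⁻¹ * y.1)) k'
    have h5 := wordLength_mul_le hgen k (x.1⁻¹ * y.1)
    omega
  · rw [h1, h2]
    simp [CayleyPoint.base, wordLength_one]

/-- While the path is on its edge number `i`, including both ends, the rounded time is `i` or `i +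
1`, so the prefixes differ by at most one letter. Beyond the end of the word both prefixes are the
whole word. -/
theorem exists_take_floor (ι : A → A) (hval : ∀ a, val (ι a) = (val a)⁻¹) {w : List A} {i : ℕ}
    {t : ℝ≥0} (hi : (i : ℝ≥0) ≤ t) (hit : i < w.length → t ≤ i + 1) :
    ∃ h, evalWord val (w.take ⌊t⌋₊) = evalWord val (w.take i) * h ∧ wordLength val h ≤ 1 ∧
      wordLength val h⁻¹ ≤ 1 := by
  have hi' : i ≤ ⌊t⌋₊ := Nat.le_floor hi
  by_cases h : i < w.length
  · have h1 : ⌊t⌋₊ ≤ i + 1 := by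
      have := Nat.floor_le_floor (hit h)
      have h2 : ⌊(i : ℝ≥0) + 1⌋₊ = i + 1 := by exact_mod_cast Nat.floor_natCast (R := ℝ≥0) (i + 1)
      omega
    rcases Nat.eq_or_lt_of_le hi' with h2 | h2
    · exact ⟨1, by rw [← h2, mul_one], by simp [wordLength_one], by simp [wordLength_one]⟩
    · have h3 : ⌊t⌋₊ = i + 1 := by omega
      refine ⟨val w[i], ?_, wordLength_val_le _, by rw [← hval]; exact wordLength_val_le _⟩
      rw [h3, List.take_succ_eq_append_getElem h, evalWord_append, evalWord_cons, evalWord_nil,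
        mul_one]
  · refine ⟨1, ?_, by simp [wordLength_one], by simp [wordLength_one]⟩
    rw [mul_one, List.take_of_length_le (by omega), List.take_of_length_le (by omega)]

/-! ### Merging two fellow travelling words -/

/-- The letters of the first word of a merged pair. -/
def lefts {B : Type*} (s : List (A ⊕ B)) : List A := s.filterMap Sum.getLeft?

/-- The letters of the second word of a merged pair. -/
def rights {B : Type*} (s : List (A ⊕ B)) : List B := s.filterMap Sum.getRight?

/-- The element that leads from the end of the first word of a merged pair to the end of the
second one. -/
def mergeDiff (val : A → G) (s : List (A ⊕ A)) : G :=
  (evalWord val (lefts s))⁻¹ * evalWord val (rights s)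

/-- Two fellow travelling words can be merged so that prefixes stay close. -/
theorem exists_merge_of_reparameterization (hgen : Submonoid.closure (Set.range val) = ⊤)
    (ι : A → A) (hval : ∀ a, val (ι a) = (val a)⁻¹) {K : ℝ} {w w' : List A} {φ ψ : ℝ≥0 → ℝ≥0}
    (hφ : IsReparameterization φ) (hψ : IsReparameterization ψ)
    (h : ∀ t, cayleyDist val (wordPath val w (φ t)) (wordPath val w' (ψ t)) ≤ K) :
    ∃ s : List (A ⊕ A), lefts s = w ∧ rights s = w' ∧
      ∀ p, p <+: s → wordLength val (mergeDiff val p) ≤ ⌈K + 1⌉₊ + 4 := by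
  -- Induction on the number of unread letters. The pair of positions `(i, j)` is admissible if at
  -- some common time both paths are on their current edges, or have finished.
  have key : ∀ n i j : ℕ, i ≤ w.length → j ≤ w'.length → (w.length - i) + (w'.length - j) = n →
      (∃ t, (i : ℝ≥0) ≤ φ t ∧ (j : ℝ≥0) ≤ ψ t ∧ (i < w.length → φ t ≤ i + 1) ∧
        (j < w'.length → ψ t ≤ j + 1)) →
      ∃ s : List (A ⊕ A), lefts s = w.drop i ∧ rights s = w'.drop j ∧
        ∀ p, p <+: s → wordLength val ((evalWord val (w.take i ++ lefts p))⁻¹ *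
          evalWord val (w'.take j ++ rights p)) ≤ ⌈K + 1⌉₊ + 4 := by
    -- Prefixes at an admissible pair of positions are close: the bound for base points plus one
    -- letter on each side gives the constant 4.
    have hclose : ∀ (i j : ℕ) (t : ℝ≥0), (i : ℝ≥0) ≤ φ t → (j : ℝ≥0) ≤ ψ t → (i < w.length → φ t ≤ i + 1) →
        (j < w'.length → ψ t ≤ j + 1) → wordLength val ((evalWord val (w.take i))⁻¹ *
          evalWord val (w'.take j)) ≤ ⌈K + 1⌉₊ + 4 := by
      intro i j t h1 h2 h3 h4
      obtain ⟨g, h5, h6, -⟩ := exists_take_floor ι hval h1 h3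
      obtain ⟨g', h7, -, h8⟩ := exists_take_floor ι hval h2 h4
      have h9 := wordLength_base_le hgen ι hval (h t)
      set x := (evalWord val (w.take ⌊φ t⌋₊))⁻¹ * evalWord val (w'.take ⌊ψ t⌋₊) with hx
      have h10 : (evalWord val (w.take i))⁻¹ * evalWord val (w'.take j) = g * x * g'⁻¹ := by
        rw [hx, h5, h7]; group
      have h11 := wordLength_mul_le hgen (g * x) g'⁻¹
      have h12 := wordLength_mul_le hgen g x
      rw [h10]
      omega
    -- Passing to `max t T` keeps the lower bounds known at time `t`, while the path that advances
    -- is exactly at its next vertex.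
    have hmove : ∀ (f : ℝ≥0 → ℝ≥0), Monotone f → ∀ (x : ℝ≥0) (t T : ℝ≥0), f t ≤ x → f T = x →
        f (max t T) = x := by
      intro f hf x t T h1 h2
      rw [hf.map_max, h2, max_eq_right h1]
    intro n
    induction n with
    | zero =>
      rintro i j hi hj hn ⟨t, h1, h2, h3, h4⟩
      refine ⟨[], ?_, ?_, ?_⟩
      · rw [List.drop_of_length_le (by omega)]; rfl
      · rw [List.drop_of_length_le (by omega)]; rfl
      · intro p hp
        rw [List.prefix_nil.1 hp]
        simpa [lefts, rights] using hclose i j t h1 h2 h3 h4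
    | succ n ih =>
      rintro i j hi hj hn ⟨t, h1, h2, h3, h4⟩
      -- Advance in the first word if its path can reach the next vertex before the second has left
      -- its current edge.
      by_cases hT : i < w.length ∧ ∃ T, φ T = i + 1 ∧ (j < w'.length → ψ T ≤ j + 1)
      · obtain ⟨hi', T, hT1, hT2⟩ := hT
        have h5 := hmove φ hφ.1 _ t T (h3 hi') hT1
        have H := ih (i + 1) j hi' hj (by omega) ⟨max t T, ?_, ?_, ?_, ?_⟩
        · obtain ⟨s, h6, h7, h8⟩ := H
          refine ⟨.inl w[i] :: s, ?_, h7, ?_⟩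
          · rw [List.drop_eq_getElem_cons hi', ← h6]; rfl
          · intro p hp
            rcases List.prefix_cons_iff.1 hp with rfl | ⟨p, rfl, hp'⟩
            · simpa [lefts, rights] using hclose i j t h1 h2 h3 h4
            · have := h8 p hp'
              rw [List.take_succ_eq_append_getElem hi', List.append_assoc] at this
              exact this
        · rw [h5]; push_cast; rfl
        · exact h2.trans (hψ.1 (le_max_left _ _))
        · rw [h5]; intro _; push_cast; exact le_self_add
        · intro hj'
          rw [hψ.1.map_max]
          exact max_le (h4 hj') (hT2 hj')
      -- Otherwise the second path is the first to reach its next vertex: surjectivity gives arrival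
      -- times `T` and `U`, and `T ≤ U` would bring back the previous case.
      · have hj' : j < w'.length ∧ ∃ U, ψ U = j + 1 ∧ (i < w.length → φ U ≤ i + 1) := by
          obtain ⟨U, hU⟩ := hψ.2 (j + 1)
          obtain ⟨T, hT'⟩ := hφ.2 (i + 1)
          have hj' : j < w'.length := by
            by_contra hj'
            exact hT ⟨by omega, T, hT', fun h => absurd h hj'⟩
          refine ⟨hj', U, hU, fun hi' => ?_⟩
          rcases le_total T U with h5 | h5
          · exact absurd ⟨hi', T, hT', fun _ => hU ▸ hψ.1 h5⟩ hT
          · exact hT' ▸ hφ.1 h5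
        obtain ⟨hj', T, hT1, hT2⟩ := hj'
        have h5 := hmove ψ hψ.1 _ t T (h4 hj') hT1
        have H := ih i (j + 1) hi hj' (by omega) ⟨max t T, ?_, ?_, ?_, ?_⟩
        · obtain ⟨s, h6, h7, h8⟩ := H
          refine ⟨.inr w'[j] :: s, h6, ?_, ?_⟩
          · rw [List.drop_eq_getElem_cons hj', ← h7]; rfl
          · intro p hp
            rcases List.prefix_cons_iff.1 hp with rfl | ⟨p, rfl, hp'⟩
            · simpa [lefts, rights] using hclose i j t h1 h2 h3 h4
            · have := h8 p hp'
              rw [List.take_succ_eq_append_getElem hj', List.append_assoc] at this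
              exact this
        · exact h1.trans (hφ.1 (le_max_left _ _))
        · rw [h5]; push_cast; rfl
        · intro hi'
          rw [hφ.1.map_max]
          exact max_le (h3 hi') (hT2 hi')
        · rw [h5]; intro _; push_cast; exact le_self_add
  obtain ⟨z, hz⟩ := hφ.2 0
  obtain ⟨z', hz'⟩ := hψ.2 0
  have h0 : φ 0 = 0 := le_antisymm ((hφ.1 zero_le).trans_eq hz) zero_le
  have h0' : ψ 0 = 0 := le_antisymm ((hψ.1 zero_le).trans_eq hz') zero_le
  obtain ⟨s, h1, h2, h3⟩ := key _ 0 0 zero_le zero_le rfl ⟨0, by simp [h0, h0']⟩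
  exact ⟨s, by simpa using h1, by simpa using h2, fun p hp => by simpa [mergeDiff] using h3 p hp⟩

/-- Balls are finite because the alphabet is, so the metric condition becomes a finite set of
differences that an automaton can remember. -/
theorem IsAsynchronousCombing.exists_merge [Finite A]
    (hgen : Submonoid.closure (Set.range val) = ⊤)
    (ι : A → A) (hval : ∀ a, val (ι a) = (val a)⁻¹) {L : Language A}
    (hL : IsAsynchronousCombing val L) :
    ∃ S : Set G, S.Finite ∧ ∀ w ∈ L, ∀ w' ∈ L,
      wordDist val (evalWord val w) (evalWord val w') ≤ 1 →
      ∃ s : List (A ⊕ A), lefts s = w ∧ rights s = w' ∧ ∀ p, p <+: s → mergeDiff val p ∈ S := by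
  obtain ⟨-, K, hK⟩ := hL
  refine ⟨_, finite_setOf_wordLength_le hgen (⌈K + 1⌉₊ + 4), fun w hw w' hw' h => ?_⟩
  obtain ⟨φ, ψ, hφ, hψ, h1⟩ := hK w hw w' hw' h
  exact exists_merge_of_reparameterization hgen ι hval hφ hψ h1

end

/-! ### The difference automaton and the search for the next normal form -/

section

variable {G : Type*} [Group G] {A B : Type*} {val : A → G}

theorem lefts_cons_inl (a : A) (s : List (A ⊕ B)) : lefts (.inl a :: s) = a :: lefts s := rfl

theorem lefts_cons_inr (b : B) (s : List (A ⊕ B)) : lefts (.inr b :: s) = lefts s := rfl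

theorem rights_cons_inl (a : A) (s : List (A ⊕ B)) : rights (.inl a :: s) = rights s := rfl

theorem rights_cons_inr (b : B) (s : List (A ⊕ B)) : rights (.inr b :: s) = b :: rights s := rfl

theorem length_lefts_add_length_rights (s : List (A ⊕ B)) :
    (lefts s).length + (rights s).length = s.length := by
  induction s with
  | nil => rfl
  | cons x s ih =>
    cases x
    · rw [lefts_cons_inl, rights_cons_inl, List.length_cons, List.length_cons]; omega
    · rw [lefts_cons_inr, rights_cons_inr, List.length_cons, List.length_cons]; omega

theorem mergeDiff_cons_inl_mul (a : A) (s : List (A ⊕ A)) (g : G) :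
    (evalWord val (lefts (.inl a :: s)))⁻¹ * g * evalWord val (rights (.inl a :: s)) =
      (evalWord val (lefts s))⁻¹ * ((val a)⁻¹ * g) * evalWord val (rights s) := by
  rw [lefts_cons_inl, rights_cons_inl, evalWord_cons]; group

theorem mergeDiff_cons_inr_mul (a : A) (s : List (A ⊕ A)) (g : G) :
    (evalWord val (lefts (.inr a :: s)))⁻¹ * g * evalWord val (rights (.inr a :: s)) =
      (evalWord val (lefts s))⁻¹ * (g * val a) * evalWord val (rights s) := by
  rw [lefts_cons_inr, rights_cons_inr, evalWord_cons]; group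

/-- The effect of one letter of a merged pair on the difference. -/
def mergeMove (val : A → G) (g : G) : A ⊕ A → G
  | .inl a => (val a)⁻¹ * g
  | .inr a => g * val a

/-- The transitions of the automaton that reads a merged pair and keeps track of the difference
as long as it stays in `S`. -/
noncomputable def mergeStep (val : A → G) (S : Set G) (q : Option S) (x : A ⊕ A) : Option S :=
  open Classical in
  q.bind fun g => if h : mergeMove val g.1 x ∈ S then some ⟨_, h⟩ else none

/-- The automaton stays alive exactly as long as the differences of the prefixes read lie in `S`,
and its state is the current difference. An arbitrary initial difference is allowed for the sake of
the induction. -/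
theorem foldl_mergeStep (S : Set G) (s : List (A ⊕ A)) (g : S) (k : G) :
    ((s.foldl (mergeStep val S) (some g)).map Subtype.val = some k) ↔
      (∀ p, p <+: s → (evalWord val (lefts p))⁻¹ * g.1 * evalWord val (rights p) ∈ S) ∧
        (evalWord val (lefts s))⁻¹ * g.1 * evalWord val (rights s) = k := by
  have hnone : ∀ s : List (A ⊕ A), s.foldl (mergeStep val S) none = none := by
    intro s; induction s <;> simp_all [mergeStep]
  induction s generalizing g with
  | nil =>
    simp [lefts, rights, evalWord_nil]
  | cons x s ih =>
    have hmul : ∀ p : List (A ⊕ A), (evalWord val (lefts (x :: p)))⁻¹ * g.1 *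
        evalWord val (rights (x :: p)) =
        (evalWord val (lefts p))⁻¹ * mergeMove val g.1 x * evalWord val (rights p) := by
      intro p
      cases x
      · exact mergeDiff_cons_inl_mul _ _ _
      · exact mergeDiff_cons_inr_mul _ _ _
    rw [List.foldl_cons]
    by_cases h : mergeMove val g.1 x ∈ S
    · have : mergeStep val S (some g) x = some ⟨_, h⟩ := by simp [mergeStep, h]
      rw [this, hmul]
      refine (ih ⟨_, h⟩ ).trans ?_
      refine and_congr_left fun _ => ⟨fun h1 p hp => ?_, fun h1 p hp => ?_⟩
      · rcases List.prefix_cons_iff.1 hp with rfl | ⟨p, rfl, hp'⟩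
        · simp [lefts, rights, evalWord_nil]
        · rw [hmul]; exact h1 p hp'
      · rw [← hmul]
        exact h1 _ ((List.prefix_cons_inj _).2 hp)
    · have : mergeStep val S (some g) x = none := by simp [mergeStep, h]
      rw [this, hnone]
      simp only [Option.map_none, reduceCtorEq, false_iff]
      rintro ⟨h1, -⟩
      have := h1 [x] (by simp)
      rw [hmul] at this
      simp [lefts, rights, evalWord_nil, h] at this

/-- A cell with three tracks: the choices during a search, and two words. -/
abbrev MergeCell (A : Type*) := Option (A ⊕ A) × Option A × Option A

/-- The merged pair on the first track. -/
def chosen (t : List (MergeCell A)) : List (A ⊕ A) := t.filterMap Prod.fst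

/-- The word on the track for letters still to be read. -/
def pending (t : List (Option A × Option A)) : List A := t.filterMap Prod.fst

/-- The word on the track for the current normal form. -/
def current (t : List (Option A × Option A)) : List A := t.filterMap Prod.snd

namespace TapeProgram

variable {d : Prop} {Z : Type*}

theorem testable_mergeDiff {S : Set G} (hS : S.Finite) (h1 : 1 ∈ S) (g : G) :
    Testable d Z fun t : List (MergeCell A) =>
      (∀ p, p <+: chosen t → mergeDiff val p ∈ S) ∧ mergeDiff val (chosen t) = g := by
  have := hS.to_subtype
  convert testable_foldl (d := d) (Z := Z) (fun (q : Option S) (x : MergeCell A) =>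
    match x.1 with | some y => mergeStep val S q y | none => q) (some ⟨1, h1⟩)
    (fun q => q.map Subtype.val = some g) using 2 with t
  have := foldl_mergeStep (val := val) S (chosen t) ⟨1, h1⟩ g
  simp only [mul_one] at this
  unfold mergeDiff
  rw [← this, chosen, List.foldl_filterMap]
  refine iff_of_eq (congrArg (fun f => Option.map Subtype.val (List.foldl f (some ⟨1, h1⟩) t) =
    some g) ?_)
  funext q x
  cases x.1 <;> rfl

theorem testable_lefts_eq [Finite A] {Z₂ : Type*} (e : Z ≃ (Option A × Option A) × Z₂) :
    Testable d Z fun t : List (MergeCell A) =>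
      lefts (chosen t) = current (t.map Prod.snd) := by
  obtain ⟨R, hR, h1, h2⟩ := exists_compare (d := d) A
  convert testable_of_implementable e
    (fun x : MergeCell A => (x.1.bind Sum.getLeft?, x.2.2)) hR (fun _ l => h2 _) using 2 with t
  rw [h1]
  simp [lefts, chosen, current, List.reduceOption, List.filterMap_filterMap, List.filterMap_map]

/-- There is a program that looks for a merged pair whose first word is the current word, whose
differences stay in `S` and end at `g`, and whose second word passes a test. -/
theorem exists_mergeSearch [Finite A] {Z₂ : Type*} (e : Z ≃ (Option A × Option A) × Z₂)
    {S : Set G} (hS : S.Finite) (h1 : 1 ∈ S) (g : G) {P : List (MergeCell A) → Prop}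
    (hP : Testable d Z P) : ∃ R : TapeProgram (MergeCell A × Z) Bool, Implementable d R ∧
      (∀ l b l', R l b l' → l'.map (·.1.2) = l.map (·.1.2) ∧ (b = true →
        lefts (chosen (l'.map Prod.fst)) = current (l.map (·.1.2)) ∧
        mergeDiff val (chosen (l'.map Prod.fst)) = g ∧ P (l'.map Prod.fst))) ∧
      (∀ (l : List (MergeCell A × Z)) (s : List (A ⊕ A)) (k : ℕ), l.length = s.length + k + 2 →
        lefts s = current (l.map (·.1.2)) →
        (∀ p, p <+: s → mergeDiff val p ∈ S) → mergeDiff val s = g →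
        (∀ t : List (MergeCell A),
          t.map Prod.fst = none :: (s.map some ++ List.replicate k none ++ [none]) → P t) →
        ∃ l', R l true l') ∧
      (d → ∀ l, ∃ b l', R l b l') := by
  obtain ⟨R, hR, h2, h3, h4⟩ := (((testable_lefts_eq e).and
    (testable_mergeDiff (val := val) hS h1 g)).and hP).search
  refine ⟨R, hR, fun l b l' h => ?_, fun l s k hl h5 h6 h7 h8 => h3 l ?_, h4⟩
  · obtain ⟨h5, h6⟩ := h2 l b l' h
    refine ⟨h5, fun hb => ?_⟩
    obtain ⟨⟨h7, -, h8⟩, h9⟩ := h6 hb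
    refine ⟨h7.trans ?_, h8, h9⟩
    rw [List.map_map, ← h5]
    rfl
  · let y : List (Option (A ⊕ A)) := none :: (s.map some ++ List.replicate k none ++ [none])
    have hy : y.length = (l.map (·.1.2)).length := by
      simp [y, hl]; omega
    have h9 : (y.zip (l.map (·.1.2))).map Prod.fst = y := List.map_fst_zip hy.le
    have h10 : (y.zip (l.map (·.1.2))).map Prod.snd = l.map (·.1.2) := List.map_snd_zip hy.ge
    have h11 : chosen (y.zip (l.map (·.1.2))) = s := by
      have : chosen (y.zip (l.map (·.1.2))) = ((y.zip (l.map (·.1.2))).map Prod.fst).reduceOption := by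
        simp [chosen, List.reduceOption, List.filterMap_map]
      rw [this, h9]
      simp [y, List.reduceOption_append, reduceOption_map_some, List.reduceOption_replicate_none]
    refine ⟨_, h10, ⟨?_, ?_⟩, h8 _ h9⟩
    · rw [h10, h11, h5]
    · rw [h11]
      exact ⟨h6, h7⟩

end TapeProgram

end

/-- For `n ≥ 1` the additive constant is absorbed into the linear term. Absolute values are taken
since `lam` and `eps` may be negative. -/
theorem IsShort.exists_length_le {G : Type*} [Group G] {A : Type*} {val : A → G} {L : Language A}
    (hL : IsShort val L) (m : ℕ) : ∃ C : ℕ, ∀ n, 1 ≤ n → ∀ w ∈ L,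
      wordLength val (evalWord val w) ≤ m * n → w.length ≤ C * n := by
  obtain ⟨lam, eps, h⟩ := hL
  refine ⟨⌈|lam| * m + |eps|⌉₊, fun n hn w hw hwn => ?_⟩
  have h1 : (1 : ℝ) ≤ n := by exact_mod_cast hn
  have h2 : (wordLength val (evalWord val w) : ℝ) ≤ m * n := by exact_mod_cast hwn
  have h3 : (w.length : ℝ) ≤ ⌈|lam| * m + |eps|⌉₊ * n := by
    calc (w.length : ℝ) ≤ lam * wordLength val (evalWord val w) + eps := h w hw
      _ ≤ |lam| * (m * n) + |eps| * n := by
        refine add_le_add ?_ ?_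
        · exact mul_le_mul (le_abs_self _) h2 (Nat.cast_nonneg _) (abs_nonneg _)
        · exact (le_abs_self _).trans (le_mul_of_one_le_right (abs_nonneg _) h1)
      _ = (|lam| * m + |eps|) * n := by ring
      _ ≤ _ := mul_le_mul_of_nonneg_right (Nat.le_ceil _) (by linarith)
  exact_mod_cast h3

/-! ### The program for the word problem -/

namespace TapeProgram

variable {A : Type*} {d : Prop} {Z : Type*}

/-- Remove the first pending letter and return it. -/
def popPending : TapeProgram (MergeCell A × Z) (Option A) :=
  onTrack
    { toFun := fun x => (x.1.2.1, x.1.1, x.1.2.2, x.2)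
      invFun := fun y => ((y.2.1, y.1, y.2.2.1), y.2.2.2)
      left_inv := fun _ => rfl
      right_inv := fun _ => rfl }
    fun l r l' => mealy popCell none l = (r, l')

theorem implementable_popPending [Finite A] :
    Implementable d (popPending : TapeProgram (MergeCell A × Z) _) :=
  (implementable_mealy _ _).onTrack _

theorem exists_popPending [Finite A] (l : List (MergeCell A × Z)) :
    ∃ r l', popPending l r l' := by
  obtain ⟨l', h, -⟩ := (implementable_mealy (d := True) (popCell (α := A)) none).exists_onTrack
    { toFun := fun x : MergeCell A × Z => (x.1.2.1, x.1.1, x.1.2.2, x.2)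
      invFun := fun y => ((y.2.1, y.1, y.2.2.1), y.2.2.2)
      left_inv := fun _ => rfl
      right_inv := fun _ => rfl } (l := l) rfl
  exact ⟨_, l', h⟩

theorem popPending_spec {l l' : List (MergeCell A × Z)} {r : Option A} (h : popPending l r l') :
    r = (pending (l.map (·.1.2))).head? ∧
      pending (l'.map (·.1.2)) = (pending (l.map (·.1.2))).tail ∧
      current (l'.map (·.1.2)) = current (l.map (·.1.2)) := by
  obtain ⟨h1, h2⟩ := h
  obtain ⟨h3, h4⟩ := mealy_popCell (l.map fun x => x.1.2.1)
  have h5 : ∀ l : List (MergeCell A × Z),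
      pending (l.map (·.1.2)) = (l.map fun x => x.1.2.1).reduceOption := by
    intro l
    simp [pending, List.reduceOption, List.filterMap_map]
  refine ⟨?_, ?_, ?_⟩
  · rw [h5, ← h3]
    exact (congrArg Prod.fst h1).symm
  · rw [h5, h5, ← h4]
    exact congrArg (fun p => p.2.reduceOption) h1.symm
  · have h6 := congrArg (List.filterMap fun y : Option (A ⊕ A) × Option A × Z => y.2.1) h2
    simpa [current, List.filterMap_map, Function.comp_def] using h6

/-- Make the second word of the merged pair the current word. -/
def updateCurrent : TapeProgram (MergeCell A × Z) Unit :=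
  mapCells fun x => ((x.1.1, x.1.2.1, x.1.1.bind Sum.getRight?), x.2)

theorem updateCurrent_spec (l : List (MergeCell A × Z)) : ∃ l', updateCurrent l () l' ∧
    l'.length = l.length ∧ pending (l'.map (·.1.2)) = pending (l.map (·.1.2)) ∧
    current (l'.map (·.1.2)) = rights (chosen (l.map Prod.fst)) := by
  refine ⟨_, rfl, by simp, ?_, ?_⟩
  · simp [pending, List.filterMap_map, Function.comp_def]
  · simp [current, rights, chosen, List.filterMap_filterMap, List.filterMap_map, Function.comp_def]

theorem rights_chosen (t : List (MergeCell A)) :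
    (t.map fun x => x.1.bind Sum.getRight?).reduceOption = rights (chosen t) := by
  simp [rights, chosen, List.reduceOption, List.filterMap_filterMap, List.filterMap_map]

/-- A test of the second word of a merged pair for membership in a language. -/
theorem exists_testable_rights_mem.{u} {A : Type u} [Finite A] {d : Prop} {L : Language A}
    (hL : MembershipTest d L) : ∃ (Z Z₂ : Type u) (_ : Finite Z) (_ : Nonempty Z)
      (_ : Z ≃ (Option A × Option A) × Z₂) (P : List (MergeCell A) → Prop), Testable d Z P ∧
      (∀ t, P t → rights (chosen t) ∈ L) ∧
      ∀ (t : List (MergeCell A)) (s : List (A ⊕ A)) (k : ℕ),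
        t.map Prod.fst = none :: (s.map some ++ List.replicate k none ++ [none]) →
        rights s ∈ L → P t := by
  obtain ⟨Λ, _, enc, R, hR, h1, h2, h3⟩ := hL
  have hmap : ∀ t : List (MergeCell A), t.map (fun x => enc (x.1.bind Sum.getRight?)) =
      (t.map fun x => x.1.bind Sum.getRight?).map enc := by simp
  -- The work space has one track for comparing two words and one for the membership test.
  refine ⟨(Option A × Option A) × Λ, Λ, inferInstance, ⟨((none, none), enc none)⟩, Equiv.refl _,
    _, testable_of_implementable (Equiv.prodComm _ _)
      (fun x : MergeCell A => enc (x.1.bind Sum.getRight?)) hR fun hd l => ?_, ?_, ?_⟩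
  · rw [hmap]
    exact h3 hd _
  · rintro t ⟨l', h⟩
    rw [hmap] at h
    rw [← rights_chosen]
    exact h1 _ _ h
  · intro t s k ht hs
    have h4 : t.map (fun x => x.1.bind Sum.getRight?) = none ::
        ((s.map some ++ List.replicate k none).map
          (fun x : Option (A ⊕ A) => x.bind Sum.getRight?) ++ [none]) := by
      have := congrArg (List.map fun x : Option (A ⊕ A) => x.bind Sum.getRight?) ht
      simpa [Function.comp_def] using this
    rw [hmap, h4]
    refine h2 _ ?_
    rw [List.map_append, List.reduceOption_append]
    convert hs using 1
    simp [rights, List.reduceOption]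

/-- There is a program that decides whether the pending word represents the identity. -/
theorem exists_wordProgram.{u} {G : Type*} [Group G] {A : Type u} [Finite A] {val : A → G}
    (hgen : Submonoid.closure (Set.range val) = ⊤) (ι : A → A) (hval : ∀ a, val (ι a) = (val a)⁻¹)
    {d : Prop} {L : Language A} (hcomb : IsAsynchronousCombing val L) (hshort : IsShort val L)
    (hmem : MembershipTest d L) : ∃ (Z : Type u) (_ : Finite Z) (_ : Nonempty Z)
      (R : TapeProgram (MergeCell A × Z) Bool), Implementable d R ∧
      (∀ l l', current (l.map (·.1.2)) = [] → R l true l' →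
        evalWord val (pending (l.map (·.1.2))) = 1) ∧
      (∀ m : ℕ, ∃ c, ∀ (l : List (MergeCell A × Z)) (n : ℕ), 1 ≤ n → c * n ≤ l.length →
        current (l.map (·.1.2)) = [] → (pending (l.map (·.1.2))).length ≤ m * n →
        evalWord val (pending (l.map (·.1.2))) = 1 → ∃ l', R l true l') ∧
      (d → ∀ l, ∃ b l', R l b l') := by
  obtain ⟨u₀, hu₀, hu₀'⟩ := hcomb.1 1
  obtain ⟨S₀, hS₀, hmerge⟩ := hcomb.exists_merge hgen ι hval
  -- The ball is added for the very first search, from the empty word to `u₀`: the empty word need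
  -- not lie in `L`, and the differences are then the prefixes of `u₀`.
  let S : Set G := S₀ ∪ {g | wordLength val g ≤ u₀.length}
  have hS : S.Finite := hS₀.union (finite_setOf_wordLength_le hgen _)
  have h1S : 1 ∈ S := .inr (by simp [wordLength_one])
  obtain ⟨Z, Z₂, _, _, e, P, hP, hP₁, hP₂⟩ := exists_testable_rights_mem hmem
  obtain ⟨σ, _, step, q, acc, hacc⟩ :=
    exists_foldl_filterMap_eq (fun x : MergeCell A => x.1.bind Sum.getRight?) u₀
  have hacc' : ∀ t, acc (t.foldl step q) ↔ rights (chosen t) = u₀ := by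
    intro t
    rw [hacc, ← rights_chosen]
    simp [List.reduceOption, List.filterMap_map]
  choose Q hQ hQ₁ hQ₂ hQ₃ using fun a : A => exists_mergeSearch e hS h1S (val a) hP
  -- The search for the second word `u₀` with final difference 1 is used twice: to write `u₀` at the
  -- start, and at the end to verify that the current word represents 1.
  obtain ⟨Q₀, hQ₀, hQ₀₁, hQ₀₂, hQ₀₃⟩ :=
    exists_mergeSearch (d := d) e hS h1S 1 (testable_foldl step q acc)
  let body : TapeProgram (MergeCell A × Z) (Option Bool) := bind popPending fun r => match r with
    | none => return' (some true)
    | some a => bind (Q a) fun b => if b then bind updateCurrent fun _ => return' none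
      else return' (some false)
  have hbody : Implementable d body := by
    refine implementable_popPending.bind fun r => ?_
    cases r with
    | none => exact implementable_return _
    | some a =>
      refine (hQ a).bind fun b => ?_
      cases b
      · exact implementable_return _
      · exact (implementable_mapCells _).bind fun _ => implementable_return _
  let prog : TapeProgram (MergeCell A × Z) Bool := bind Q₀ fun b => if b then
      bind updateCurrent fun _ => bind body.loop fun b => if b then Q₀ else return' false
    else return' false
  have hupdate : ∀ {l : List (MergeCell A × Z)} {x l'}, updateCurrent l x l' →
      l'.length = l.length ∧ pending (l'.map (·.1.2)) = pending (l.map (·.1.2)) ∧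
      current (l'.map (·.1.2)) = rights (chosen (l.map Prod.fst)) := by
    intro l x l' h
    obtain ⟨l'', h1, h2⟩ := updateCurrent_spec l
    rw [show l' = l'' from h.trans h1.symm]
    exact h2
  have hbody₁ : ∀ {l o l'}, body l o l' →
      (o = some true → pending (l.map (·.1.2)) = [] ∧
        current (l'.map (·.1.2)) = current (l.map (·.1.2))) ∧
      (o = none → ∃ a, pending (l.map (·.1.2)) = a :: pending (l'.map (·.1.2)) ∧
        evalWord val (current (l'.map (·.1.2))) =
          evalWord val (current (l.map (·.1.2))) * val a ∧ current (l'.map (·.1.2)) ∈ L) := by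
    rintro l o l' ⟨r, l₁, h1, h2⟩
    obtain ⟨h3, h4, h5⟩ := popPending_spec h1
    cases r with
    | none =>
      obtain ⟨rfl, rfl⟩ := h2
      exact ⟨fun _ => ⟨List.head?_eq_none_iff.1 h3.symm, h5⟩, by simp⟩
    | some a =>
      obtain ⟨b, l₂, h6, h7⟩ := h2
      cases b
      · obtain ⟨rfl, rfl⟩ := h7
        simp
      · obtain ⟨_, l₃, h8, rfl, rfl⟩ := h7
        obtain ⟨h9, h10, h11⟩ := hupdate h8
        obtain ⟨h12, h13⟩ := hQ₁ a _ _ _ h6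
        obtain ⟨h14, h15, h16⟩ := h13 rfl
        refine ⟨by simp, fun _ => ⟨a, ?_, ?_, h11 ▸ hP₁ _ h16⟩⟩
        · rw [h10, h12, h4]
          exact (List.cons_head?_tail h3.symm).symm
        · rw [h11, ← h5, ← h14, ← h15, mergeDiff, mul_inv_cancel_left]
  have hQ₀' : ∀ {l l'}, Q₀ l true l' → l'.map (·.1.2) = l.map (·.1.2) ∧
      rights (chosen (l'.map Prod.fst)) = u₀ ∧ evalWord val (current (l.map (·.1.2))) = 1 := by
    intro l l' h
    obtain ⟨h1, h2⟩ := hQ₀₁ _ _ _ h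
    obtain ⟨h3, h4, h5⟩ := h2 rfl
    rw [hacc'] at h5
    rw [mergeDiff, h5, hu₀', mul_one, inv_eq_one, h3] at h4
    exact ⟨h1, h5, h4⟩
  refine ⟨Z, inferInstance, inferInstance, prog, ?_, ?_, ?_, ?_⟩
  · refine hQ₀.bind fun b => ?_
    cases b
    · exact implementable_return _
    · refine (implementable_mapCells _).bind fun _ => hbody.loop.bind fun b => ?_
      cases b
      · exact implementable_return _
      · exact hQ₀
  · rintro l l' hl ⟨b, l₁, h1, h2⟩
    cases b
    · simp [return'] at h2
    obtain ⟨_, l₂, h3, b, l₃, h4, h5⟩ := h2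
    cases b
    · simp [return'] at h5
    obtain ⟨h6, h7, -⟩ := hQ₀' h1
    obtain ⟨-, h8, h9⟩ := hupdate h3
    -- The value of the current word times the value of the unread letters does not change.
    have H := loop_induction (fun m => evalWord val (current (m.map (·.1.2))) *
        evalWord val (pending (m.map (·.1.2))) = evalWord val (pending (l.map (·.1.2))))
      (fun b m => b = true → evalWord val (current (m.map (·.1.2))) =
        evalWord val (pending (l.map (·.1.2)))) ?_ ?_ ?_ h4
    · rw [← H rfl]
      exact (hQ₀' h5).2.2
    · rintro m b m' h10 h11 rfl
      obtain ⟨h12, h13⟩ := (hbody₁ h11).1 rfl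
      rw [h13, ← h10, h12, evalWord_nil, mul_one]
    · intro m m' h10 h11
      obtain ⟨a, h12, h13, -⟩ := (hbody₁ h11).2 rfl
      rw [h13, ← h10, h12, evalWord_cons, mul_assoc]
    · rw [h8, h9, h7, hu₀', one_mul, h6]
  · intro m
    obtain ⟨C, hC⟩ := hshort.exists_length_le m
    -- A merged pair of two words of length at most `C * n` has at most `2 * (C * n)` letters, and
    -- two blank end cells are added.
    refine ⟨2 * C + 2, fun l n hn hlen hl hpend hone => ?_⟩
    have hN : 2 * (C * n) + 2 ≤ l.length := by
      calc 2 * (C * n) + 2 ≤ 2 * (C * n) + 2 * n := by omega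
        _ = (2 * C + 2) * n := by ring
        _ ≤ _ := hlen
    have hCv : ∀ w ∈ L, ∀ v : List A, evalWord val w = evalWord val v → v.length ≤ m * n →
        w.length ≤ C * n := fun w hw v hv hv' =>
      hC n hn w hw (hv ▸ (wordLength_evalWord_le v).trans hv')
    have hu₀len : u₀.length ≤ C * n := hCv _ hu₀ [] hu₀' (Nat.zero_le _)
    have hsearch : ∀ w ∈ L, ∀ w' ∈ L, wordDist val (evalWord val w) (evalWord val w') ≤ 1 →
        w.length ≤ C * n → w'.length ≤ C * n → ∃ (s : List (A ⊕ A)) (k : ℕ),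
          l.length = s.length + k + 2 ∧ lefts s = w ∧ rights s = w' ∧
          (∀ p, p <+: s → mergeDiff val p ∈ S) ∧
          mergeDiff val s = (evalWord val w)⁻¹ * evalWord val w' := by
      intro w hw w' hw' h hwl hwl'
      obtain ⟨s, hs, hs', hp⟩ := hmerge w hw w' hw' h
      have := length_lefts_add_length_rights s
      rw [hs, hs'] at this
      exact ⟨s, l.length - s.length - 2, by omega, hs, hs', fun p hps => .inl (hp p hps),
        by rw [mergeDiff, hs, hs']⟩
    have htest : ∀ s : List (A ⊕ A), rights s = u₀ → ∀ (k : ℕ) (t : List (MergeCell A)),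
        t.map Prod.fst = none :: (s.map some ++ List.replicate k none ++ [none]) →
        acc (t.foldl step q) := by
      intro s hs k t ht
      have h1 : chosen t = (t.map Prod.fst).reduceOption := by
        simp [chosen, List.reduceOption, List.filterMap_map]
      rw [hacc', h1, ht]
      simpa [List.reduceOption_append, reduceOption_map_some, List.reduceOption_replicate_none]
        using hs
    have hstart : ∃ l₁, Q₀ l true l₁ := by
      have hl₀ : lefts (u₀.map Sum.inr : List (A ⊕ A)) = [] := by
        simp [lefts, List.filterMap_map, Function.comp_def]
      have hr₀ : rights (u₀.map Sum.inr : List (A ⊕ A)) = u₀ := by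
        simp [rights, List.filterMap_map, Function.comp_def]
      refine hQ₀₂ l (u₀.map .inr) (l.length - u₀.length - 2) (by rw [List.length_map]; omega)
        (hl₀.trans hl.symm) (fun p hp => .inr ?_) ?_ (htest _ hr₀ _)
      · have h1 : lefts p <+: lefts (u₀.map Sum.inr) := hp.filterMap _
        have h2 : rights p <+: rights (u₀.map Sum.inr) := hp.filterMap _
        rw [hl₀, List.prefix_nil] at h1
        rw [hr₀] at h2
        rw [mergeDiff, h1, evalWord_nil, inv_one, one_mul]
        exact (wordLength_evalWord_le _).trans h2.length_le
      · rw [mergeDiff, hl₀, hr₀, hu₀', evalWord_nil]; simp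
    obtain ⟨l₁, h1⟩ := hstart
    obtain ⟨h2, h3, -⟩ := hQ₀' h1
    obtain ⟨l₂, h4, h5, h6, h7⟩ := updateCurrent_spec l₁
    -- The word `v` is the part already read. It represents the same element as the current word, so
    -- its length bounds that of the current word through shortness.
    have H := exists_loop (R := body) (fun x => x.length = l.length ∧
        current (x.map (·.1.2)) ∈ L ∧ ∃ v : List A,
          (v ++ pending (x.map (·.1.2))).length ≤ m * n ∧
          evalWord val (current (x.map (·.1.2))) = evalWord val v ∧
          evalWord val (v ++ pending (x.map (·.1.2))) = 1)
      (fun b x => b = true ∧ x.length = l.length ∧ current (x.map (·.1.2)) ∈ L ∧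
        evalWord val (current (x.map (·.1.2))) = 1)
      (fun x => (pending (x.map (·.1.2))).length) ?_ (l := l₂) ?_
    · obtain ⟨b, l₃, h8, rfl, h9, h10, h11⟩ := H
      obtain ⟨s, k, h12, h13, h14, h15, h16⟩ := hsearch _ h10 u₀ hu₀
        (by rw [h11, hu₀', wordDist]; simp [wordLength_one])
        (hCv _ h10 [] h11 (Nat.zero_le _)) hu₀len
      obtain ⟨l₄, h17⟩ := hQ₀₂ l₃ s k (h9.trans h12) h13 h15
        (by rw [h16, h11, hu₀']; simp) (htest s h14 k)
      exact ⟨l₄, true, l₁, h1, (), l₂, h4, true, l₃, h8, h17⟩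
    · rintro x ⟨hx, hxL, v, hv, hv', hv1⟩
      obtain ⟨r, x₁, h8⟩ := exists_popPending x
      obtain ⟨h9, h10, h11⟩ := popPending_spec h8
      have hx₁ := (implementable_popPending (d := True)).length_eq h8
      cases r with
      | none =>
        have h12 := List.head?_eq_none_iff.1 h9.symm
        refine .inl ⟨true, x₁, ⟨_, _, h8, rfl, rfl⟩, rfl, hx₁.trans hx, h11 ▸ hxL, ?_⟩
        rw [h11, hv', ← hv1, h12, List.append_nil]
      | some a =>
        have h12 : pending (x.map (·.1.2)) = a :: pending (x₁.map (·.1.2)) := by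
          rw [h10]
          exact (List.cons_head?_tail h9.symm).symm
        have hva : ((v ++ [a]) ++ pending (x₁.map (·.1.2))) = v ++ pending (x.map (·.1.2)) := by
          rw [h12]; simp
        obtain ⟨w', hw', hw''⟩ := hcomb.1 (evalWord val (v ++ [a]))
        have hval' : (evalWord val (current (x.map (·.1.2))))⁻¹ * evalWord val w' = val a := by
          rw [hv', hw'', evalWord_append, evalWord_cons, evalWord_nil]; group
        have hlen₁ : v.length ≤ m * n := by
          rw [List.length_append] at hv; omega
        have hlen₂ : (v ++ [a]).length ≤ m * n := by
          rw [← hva, List.length_append] at hv; omega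
        obtain ⟨s, k, h13, h14, h15, h16, h17⟩ := hsearch _ hxL w' hw'
          (by rw [wordDist, hval']; exact wordLength_val_le a) (hCv _ hxL v hv' hlen₁)
          (hCv _ hw' _ hw'' hlen₂)
        obtain ⟨x₂, h18⟩ := hQ₂ a x₁ s k (by rw [hx₁, hx, h13]) (h14.trans h11.symm) h16
          (h17.trans hval') (fun t ht => hP₂ t s k ht (h15 ▸ hw'))
        obtain ⟨x₃, h19, h20, -, -⟩ := updateCurrent_spec x₂
        have hb : body x none x₃ := ⟨some a, x₁, h8, true, x₂, h18, (), x₃, h19, rfl, rfl⟩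
        obtain ⟨a', h21, h22, h23⟩ := (hbody₁ hb).2 rfl
        obtain ⟨rfl, h24⟩ := List.cons.inj (h12.symm.trans h21)
        refine .inr ⟨x₃, hb, ⟨(hbody.length_eq hb).trans hx, h23, v ++ [a], ?_, ?_, ?_⟩, ?_⟩
        · rw [← h24, hva]; exact hv
        · rw [h22, hv', evalWord_append, evalWord_cons, evalWord_nil, mul_one]
        · rw [← h24, hva]; exact hv1
        · rw [h21]; simp
    · refine ⟨?_, ?_, [], ?_, ?_, ?_⟩
      · rw [h5]; simpa using congrArg List.length h2
      · rw [h7, h3]; exact hu₀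
      · rw [h6, h2]; exact hpend
      · rw [h7, h3, hu₀', evalWord_nil]
      · rw [h6, h2]; exact hone
  · intro hd l
    obtain ⟨b, l₁, h1⟩ := hQ₀₃ hd l
    cases b
    · exact ⟨_, _, _, _, h1, rfl, rfl⟩
    obtain ⟨l₂, h2, -⟩ := updateCurrent_spec l₁
    -- Every repetition consumes a pending letter, so the loop stops on any tape.
    have H := exists_loop (R := body) (fun _ => True) (fun _ _ => True)
      (fun x => (pending (x.map (·.1.2))).length) ?_ (l := l₂) trivial
    · obtain ⟨b, l₃, h3, -⟩ := H
      cases b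
      · exact ⟨_, _, _, _, h1, _, _, h2, _, _, h3, rfl, rfl⟩
      · obtain ⟨b, l₄, h4⟩ := hQ₀₃ hd l₃
        exact ⟨_, _, _, _, h1, _, _, h2, _, _, h3, h4⟩
    · rintro x -
      have : ∃ o x', body x o x' := by
        obtain ⟨r, x₁, h3⟩ := exists_popPending x
        cases r with
        | none => exact ⟨_, _, _, _, h3, rfl, rfl⟩
        | some a =>
          obtain ⟨b, x₂, h4⟩ := hQ₃ a hd x₁
          cases b
          · exact ⟨_, _, _, _, h3, _, _, h4, rfl, rfl⟩
          · exact ⟨_, _, _, _, h3, _, _, h4, (), _, rfl, rfl, rfl⟩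
      obtain ⟨o, x', h3⟩ := this
      cases o with
      | some b => exact .inl ⟨_, _, h3, trivial⟩
      | none =>
        obtain ⟨a, h4, -⟩ := (hbody₁ h3).2 rfl
        exact .inr ⟨_, h3, trivial, by rw [h4]; simp⟩

end TapeProgram

/-! ### Subgroups and the main theorem -/

open TapeProgram in
/-- For a subgroup, letters of the alphabet `B` are encoded by blocks of cells that hold words over
the generators of the group. -/
theorem exists_subgroupProgram.{u} {G : Type*} [Group G] {A : Type u} [Finite A] {val : A → G}
    (hgen : Submonoid.closure (Set.range val) = ⊤) (ι : A → A) (hval : ∀ a, val (ι a) = (val a)⁻¹)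
    {d : Prop} {L : Language A} (hcomb : IsAsynchronousCombing val L) (hshort : IsShort val L)
    (hmem : MembershipTest d L) (H : Subgroup G) {B : Type*} [Finite B] (valH : B → H) :
    ∃ (Γ : Type u) (_ : Finite Γ) (c : ℕ) (_ : 0 < c) (enc : B → Block Γ c)
      (R : TapeProgram Γ Bool), Implementable d R ∧
      {w | ∃ l, R (w.flatMap fun b => (enc b).1) true l} = wordProblem valH ∧
      (d → ∀ l, ∃ b l', R l b l') := by
  obtain ⟨Z, _, ⟨z⟩, R, hR, hR₁, hR₂, hR₃⟩ := exists_wordProgram hgen ι hval hcomb hshort hmem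
  choose v hv using fun b => exists_evalWord_eq hgen (valH b : G)
  obtain ⟨m, hm⟩ : ∃ m, ∀ b, (v b).length ≤ m := by
    obtain ⟨m, hm⟩ := (Set.finite_range fun b => (v b).length).bddAbove
    exact ⟨m, fun b => hm ⟨b, rfl⟩⟩
  obtain ⟨c, hc⟩ := hR₂ m
  let cell : Option A → MergeCell A × Z := fun x => ((none, x, none), z)
  -- A block has `m` cells for the spelling of its letter and `c` cells to meet the space bound of
  -- the program; the extra cell makes the block length positive.
  let block : B → List (MergeCell A × Z) := fun b =>
    ((v b).map some ++ List.replicate (c + m + 1 - (v b).length) none).map cell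
  have hblock : ∀ b, (block b).length = c + m + 1 := by
    intro b
    have := hm b
    simp [block]; omega
  have hlen : ∀ w : List B, (w.flatMap block).length = (c + m + 1) * w.length := by
    intro w
    induction w with
    | nil => simp
    | cons b w ih => rw [List.flatMap_cons, List.length_append, ih, hblock, List.length_cons]; ring
  have hcur : ∀ w : List B, current ((w.flatMap block).map (·.1.2)) = [] := by
    intro w
    simp only [current, List.filterMap_map, List.filterMap_eq_nil_iff, List.mem_flatMap]
    rintro x ⟨b, -, hx⟩
    obtain ⟨y, -, rfl⟩ := List.mem_map.1 hx
    rfl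
  have hpend : ∀ w : List B, pending ((w.flatMap block).map (·.1.2)) = w.flatMap v := by
    intro w
    induction w with
    | nil => rfl
    | cons b w ih =>
      rw [List.flatMap_cons, List.flatMap_cons, ← ih]
      simp [pending, block, cell, List.filterMap_map, Function.comp_def]
  have heval : ∀ w : List B, evalWord val (w.flatMap v) = evalWord valH w := by
    intro w
    induction w with
    | nil => rfl
    | cons b w ih => rw [List.flatMap_cons, evalWord_append, hv, ih, evalWord_cons]; rfl
  have hvlen : ∀ w : List B, (w.flatMap v).length ≤ m * w.length := by
    intro w
    induction w with
    | nil => simp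
    | cons b w ih =>
      have := hm b
      rw [List.flatMap_cons, List.length_append, List.length_cons, mul_add_one]; omega
  have hword : ∀ w : List B, w ∈ wordProblem valH ↔ evalWord val (w.flatMap v) = 1 := by
    intro w
    rw [heval]
    exact OneMemClass.coe_eq_one.symm
  -- The program `R` is guaranteed to succeed only on tapes long enough for some `n ≥ 1`, so the
  -- empty word is accepted separately.
  let prog : TapeProgram (MergeCell A × Z) Bool :=
    bind (scan (fun _ _ => true) false) fun b => if b then R else return' true
  have hscan : ∀ l : List (MergeCell A × Z), l ≠ [] →
      l.foldl (fun (_ : Bool) _ => true) false = true := by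
    have : ∀ l : List (MergeCell A × Z), l.foldl (fun (_ : Bool) _ => true) true = true := by
      intro l; induction l <;> simp_all
    intro l hl
    cases l with
    | nil => exact absurd rfl hl
    | cons => exact this _
  have hprog : ∀ {l b l'}, l ≠ [] → (prog l b l' ↔ R l b l') := by
    intro l b l' hl
    constructor
    · rintro ⟨_, _, ⟨rfl, rfl⟩, h⟩
      rw [hscan _ hl] at h
      exact h
    · intro h
      refine ⟨true, l, ⟨(hscan l hl).symm, rfl⟩, h⟩
  refine ⟨MergeCell A × Z, inferInstance, c + m + 1, Nat.succ_pos _, fun b => ⟨block b, hblock b⟩,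
    prog, ?_, ?_, ?_⟩
  · refine (implementable_scan _ _).bind fun b => ?_
    cases b
    · exact implementable_return _
    · exact hR
  · refine Set.ext fun w => Iff.trans ?_ (hword w).symm
    change (∃ l, prog (w.flatMap block) true l) ↔ _
    rcases w.eq_nil_or_concat with rfl | hw
    · refine iff_of_true ⟨[], false, [], ⟨rfl, rfl⟩, rfl, rfl⟩ rfl
    · have hw : 1 ≤ w.length := by
        obtain ⟨w', b, rfl⟩ := hw
        simp
      have hne : w.flatMap block ≠ [] := by
        intro h
        have := hlen w
        rw [h, List.length_nil] at this
        have := Nat.mul_pos (Nat.succ_pos (c + m)) hw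
        simp only [Nat.succ_eq_add_one] at this
        omega
      rw [← hpend]
      constructor
      · rintro ⟨l, hl⟩
        exact hR₁ _ l (hcur w) ((hprog hne).1 hl)
      · intro h
        obtain ⟨l, hl⟩ := hc (w.flatMap block) w.length hw
          (by rw [hlen]; exact Nat.mul_le_mul_right _ (by omega)) (hcur w)
          (by rw [hpend]; exact hvlen w) h
        exact ⟨l, (hprog hne).2 hl⟩
  · intro hd l
    by_cases hl : l = []
    · subst hl
      exact ⟨true, [], false, [], ⟨rfl, rfl⟩, rfl, rfl⟩
    · obtain ⟨b, l', h⟩ := hR₃ hd l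
      exact ⟨b, l', (hprog hl).2 h⟩

/-- The two parts are the cases `d := False` and `d := True` of one program; they differ in the
membership test for `L`. In the second, the program returns a value on every tape, which yields
halting. -/
theorem mainTheorem1 {G : Type*} [Group G]
    -- a finite alphabet of monoid generators of `G`, with an involution
    {A : Type*} [Finite A] (val : A → G) (hgen : Submonoid.closure (Set.range val) = ⊤)
    (ι : A → A) (hι : Function.Involutive ι) (hval : ∀ a, val (ι a) = (val a)⁻¹)
    -- a short asynchronous combing with a departure function
    (L : Language A) (hcomb : IsAsynchronousCombing val L) (hshort : IsShort val L)
    (hdep : ∃ D : ℕ → ℕ, IsDepartureFunction val L D)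
    -- a finitely generated subgroup, with a finite alphabet of monoid generators
    (H : Subgroup G) {B : Type*} [Finite B] (valH : B → H)
    (hgenH : Submonoid.closure (Set.range valH) = ⊤) :
    (L.deleteEmpty.IsContextSensitive →
      (wordProblem valH).deleteEmpty.IsContextSensitive ∧ (wordProblem valH).IsLBALanguage) ∧
    (L.IsDeterministicLBALanguage → (wordProblem valH).IsDecidedByDeterministicLBA) := by
  refine ⟨fun h => ?_, fun h => ?_⟩
  · obtain ⟨Γ, _, c, hc, enc, R, hR, hlang, -⟩ := exists_subgroupProgram hgen ι hval hcomb hshort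
      (TapeProgram.membershipTest_of_isContextSensitive h) H valH
    constructor
    · rw [← hlang]
      exact hR.isContextSensitive hc enc
    · obtain ⟨M, -, -, hM⟩ := hR.exists_LBA hc enc
      exact ⟨M, hM.trans hlang⟩
  · obtain ⟨Γ, _, c, hc, enc, R, hR, hlang, htotal⟩ := exists_subgroupProgram hgen ι hval hcomb
      hshort (TapeProgram.membershipTest_of_isDeterministicLBALanguage h) H valH
    obtain ⟨M, hdet, hhalt, hM⟩ := hR.exists_LBA hc enc
    exact ⟨M, hdet trivial, hhalt fun w => htotal trivial _, hM.trans hlang⟩
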